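/- Let $t\in\mathbb{C}$, $t\neq 0$, and put $c=13-6t-6t^{-1}$ and $h_{1,2}=-\frac12+\frac{3}{4t}$. For $h\in\mathbb{C}$ let $\mathcal{V}_h$ denote the Verma module of the Virasoro Lie algebra of central charge $c$ and lowest conformal weight $h$, generated by the lowest weight vector $v_h$, and let $\mathcal{K}_{1,2}$ be the quotient of $\mathcal{V}_{h_{1,2}}$ by the submodule generated by $(L_{-1}^2-t^{-1}L_{-2})v_{h_{1,2}}$. An intertwining operator of type $\binom{W_3}{W_1\,W_2}$ among modules for the Virasoro vertex operator algebra of central charge $c$ is a linear map $$\mathcal{Y}: W_1\to \mathrm{Hom}(W_2,W_3)\{z\}[\log z],\qquad \mathcal{Y}(w_1,z)=\sum_{h\in\mathbb{C}}\sum_{k\geq 0}(w_1)_{h;k}\,z^{-h-1}(\log z)^k ,$$ such that for all $w_1\in W_1$ and $n\in\mathbb{Z}$: 1. for all $w_2\in W_2$ and $h\in\mathbb{C}$, $(w_1)_{h+m;k}w_2=0$ for all sufficiently positive $m\in\mathbb{Z}$, independently of $k$; 2. $L_n\mathcal{Y}(w_1,z)=\mathcal{Y}(w_1,z)L_n+\sum_{i\geq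 0}\binom{n+1}{i}z^{n+1-i}\mathcal{Y}(L_{i-1}w_1,z)$; 3. $\mathcal{Y}(L_nw_1,z)=\sum_{i\geq 0}(-1)^i\binom{n+1}{i}\left(L_{n-i}z^i\mathcal{Y}(w_1,z)+(-1)^nz^{n+1-i}\mathcal{Y}(w_1,z)L_{i-1}\right)$; 4. $\mathcal{Y}(L_{-1}w_1,z)=\frac{d}{dz}\mathcal{Y}(w_1,z)$. It is surjective if $W_3$ is spanned by the vectors $(w_1)_{h;k}w_2$ with $w_1\in W_1$, $w_2\in W_2$, $h\in\mathbb{C}$, $k\in\mathbb{Z}_{\geq 0}$. Let $h_1,h_2\in\mathbb{C}$ satisfy $$h_2=h_1+\frac{1}{4t}-\frac{1}{2t}\sqrt{4th_1+(t-1)^2}$$ for some choice of the square root such that $\frac1t\sqrt{4th_1+(t-1)^2}\notin\mathbb{Z}_{\geq 1}$ (for that same choice). Then there is a surjective intertwining operator of type $\binom{\mathcal{V}_{h_2}}{\mathcal{K}_{1,2}\,\mathcal{V}_{h_1}}$, and it is unique up to scale: every surjective intertwining operator of this type is a non-zero scalar multiple of it. -/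

import Mathlib

noncomputable section

/-! ## The Virasoro Lie algebra -/

/-- The bracket of the Witt algebra on the free vector space with basis indexed by `ℤ`:
`(m, n) ↦ (m - n) (m + n)`, extended bilinearly. -/
def wittBracket : (ℤ →₀ ℂ) →ₗ[ℂ] (ℤ →₀ ℂ) →ₗ[ℂ] (ℤ →₀ ℂ) :=
  Finsupp.lift _ ℂ ℤ fun m => Finsupp.lift _ ℂ ℤ fun n =>
    Finsupp.single (m + n) ((m : ℂ) - n)

/-- The Virasoro cocycle `(m, n) ↦ (m ^ 3 - m) / 12 * δ_{m, -n}`, extended bilinearly. -/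
def virasoroCocycle : (ℤ →₀ ℂ) →ₗ[ℂ] (ℤ →₀ ℂ) →ₗ[ℂ] ℂ :=
  Finsupp.lift _ ℂ ℤ fun m => Finsupp.lift _ ℂ ℤ fun n =>
    if m = -n then ((m : ℂ) ^ 3 - m) / 12 else 0

/-- The underlying space of the Virasoro Lie algebra over `ℂ`. The first component is spanned by
the `L n`, `n : ℤ`, and the second one by the central element `C`. -/
def Virasoro : Type := (ℤ →₀ ℂ) × ℂ

namespace Virasoro

instance : AddCommGroup Virasoro := inferInstanceAs (AddCommGroup ((ℤ →₀ ℂ) × ℂ))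

instance : Module ℂ Virasoro := inferInstanceAs (Module ℂ ((ℤ →₀ ℂ) × ℂ))

/-- The basis element `L_n`. -/
def L (n : ℤ) : Virasoro := (Finsupp.single n 1, 0)

/-- The central basis element `C`. -/
def C : Virasoro := (0, 1)

instance : Bracket Virasoro Virasoro :=
  ⟨fun x y => (wittBracket x.1 y.1, virasoroCocycle x.1 y.1)⟩

theorem bracket_def (x y : Virasoro) :
    ⁅x, y⁆ = ((wittBracket x.1 y.1, virasoroCocycle x.1 y.1) : (ℤ →₀ ℂ) × ℂ) := rfl

theorem wittBracket_single (m n : ℤ) (a b : ℂ) :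
    wittBracket (Finsupp.single m a) (Finsupp.single n b) =
      Finsupp.single (m + n) (a * b * ((m : ℂ) - n)) := by
  rw [wittBracket, Finsupp.lift_apply, Finsupp.sum_single_index (by simp), LinearMap.smul_apply,
    Finsupp.lift_apply, Finsupp.sum_single_index (by simp), Finsupp.smul_single,
    Finsupp.smul_single, smul_eq_mul, smul_eq_mul, mul_assoc]

theorem virasoroCocycle_single (m n : ℤ) (a b : ℂ) :
    virasoroCocycle (Finsupp.single m a) (Finsupp.single n b) =
      a * b * (if m = -n then ((m : ℂ) ^ 3 - m) / 12 else 0) := by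
  simp [virasoroCocycle, mul_assoc]

theorem wittBracket_self (x : ℤ →₀ ℂ) : wittBracket x x = 0 := by
  have h : ∀ x y : ℤ →₀ ℂ, wittBracket x y + wittBracket y x = 0 := by
    intro x y
    induction x using Finsupp.induction_linear with
    | zero => simp
    | add f g hf hg => rw [map_add, LinearMap.add_apply, map_add, add_add_add_comm, hf, hg, add_zero]
    | single m a =>
      induction y using Finsupp.induction_linear with
      | zero => simp
      | add f g hf hg =>
        rw [map_add, map_add, LinearMap.add_apply, add_add_add_comm, hf, hg, add_zero]
      | single n b =>
        rw [wittBracket_single, wittBracket_single, add_comm n m, ← Finsupp.single_add]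
        rw [show a * b * ((m : ℂ) - n) + b * a * ((n : ℂ) - m) = 0 by ring, Finsupp.single_zero]
  have h2 := h x x
  rw [← two_smul ℂ] at h2
  exact (smul_eq_zero.mp h2).resolve_left two_ne_zero

theorem virasoroCocycle_self (x : ℤ →₀ ℂ) : virasoroCocycle x x = 0 := by
  have h : ∀ x y : ℤ →₀ ℂ, virasoroCocycle x y + virasoroCocycle y x = 0 := by
    intro x y
    induction x using Finsupp.induction_linear with
    | zero => simp
    | add f g hf hg => rw [map_add, LinearMap.add_apply, map_add, add_add_add_comm, hf, hg, add_zero]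
    | single m a =>
      induction y using Finsupp.induction_linear with
      | zero => simp
      | add f g hf hg =>
        rw [map_add, map_add, LinearMap.add_apply, add_add_add_comm, hf, hg, add_zero]
      | single n b =>
        rw [virasoroCocycle_single, virasoroCocycle_single]
        by_cases hmn : m = -n
        · subst hmn
          simp
          ring
        · rw [if_neg hmn, if_neg (by omega)]
          simp
  have h2 := h x x
  rw [← two_mul] at h2
  exact (mul_eq_zero.mp h2).resolve_left two_ne_zero

theorem wittBracket_leibniz (x y z : ℤ →₀ ℂ) :
    wittBracket x (wittBracket y z) =
      wittBracket (wittBracket x y) z + wittBracket y (wittBracket x z) := by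
  induction x using Finsupp.induction_linear with
  | zero => simp
  | add f g hf hg => simp only [map_add, LinearMap.add_apply, hf, hg]; abel
  | single m a =>
    induction y using Finsupp.induction_linear with
    | zero => simp
    | add f g hf hg => simp only [map_add, LinearMap.add_apply, hf, hg]; abel
    | single n b =>
      induction z using Finsupp.induction_linear with
      | zero => simp
      | add f g hf hg => simp only [map_add, hf, hg]; abel
      | single k d =>
        simp only [wittBracket_single]
        rw [show n + (m + k) = m + (n + k) by ring, show m + n + k = m + (n + k) by ring,
          ← Finsupp.single_add]
        congr 1
        push_cast
        ring

theorem virasoroCocycle_leibniz (x y z : ℤ →₀ ℂ) :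
    virasoroCocycle x (wittBracket y z) =
      virasoroCocycle (wittBracket x y) z + virasoroCocycle y (wittBracket x z) := by
  induction x using Finsupp.induction_linear with
  | zero => simp
  | add f g hf hg => simp only [map_add, LinearMap.add_apply, hf, hg]; abel
  | single m a =>
    induction y using Finsupp.induction_linear with
    | zero => simp
    | add f g hf hg => simp only [map_add, LinearMap.add_apply, hf, hg]; abel
    | single n b =>
      induction z using Finsupp.induction_linear with
      | zero => simp
      | add f g hf hg => simp only [map_add, hf, hg]; abel
      | single k d =>
        simp only [wittBracket_single, virasoroCocycle_single]
        by_cases h : k = -(m + n)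
        · subst h
          rw [if_pos (by ring), if_pos (by ring), if_pos (by ring)]
          push_cast
          ring
        · rw [if_neg (by omega), if_neg (by omega), if_neg (by omega)]
          ring

instance : LieRing Virasoro where
  add_lie x y z := by
    refine Prod.ext ?_ ?_
    · exact LinearMap.congr_fun (map_add wittBracket x.1 y.1) z.1
    · exact LinearMap.congr_fun (map_add virasoroCocycle x.1 y.1) z.1
  lie_add x y z := by
    refine Prod.ext ?_ ?_
    · exact map_add (wittBracket x.1) y.1 z.1
    · exact map_add (virasoroCocycle x.1) y.1 z.1
  lie_self x := Prod.ext (wittBracket_self x.1) (virasoroCocycle_self x.1)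
  leibniz_lie x y z :=
    Prod.ext (wittBracket_leibniz x.1 y.1 z.1) (virasoroCocycle_leibniz x.1 y.1 z.1)

instance : LieAlgebra ℂ Virasoro where
  lie_smul a x y := by
    refine Prod.ext ?_ ?_
    · exact map_smul (wittBracket x.1) a y.1
    · exact map_smul (virasoroCocycle x.1) a y.1

theorem lie_L_L (m n : ℤ) :
    ⁅L m, L n⁆ = ((m : ℂ) - n) • L (m + n) +
      (if m = -n then ((m : ℂ) ^ 3 - m) / 12 else 0) • C := by
  refine Prod.ext ?_ ?_
  · change wittBracket (Finsupp.single m 1) (Finsupp.single n 1) =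
      ((m : ℂ) - n) • Finsupp.single (m + n) (1 : ℂ) + _ • (0 : ℤ →₀ ℂ)
    simp [wittBracket_single]
  · change virasoroCocycle (Finsupp.single m 1) (Finsupp.single n 1) =
      ((m : ℂ) - n) • (0 : ℂ) + _ • (1 : ℂ)
    simp [virasoroCocycle_single]

theorem lie_C_right (x : Virasoro) : ⁅x, C⁆ = 0 := by
  refine Prod.ext ?_ ?_
  · exact map_zero (wittBracket x.1)
  · exact map_zero (virasoroCocycle x.1)

end Virasoro

/-! ## Verma modules and the module `K_{1,2}` -/

/-- The universal enveloping algebra of the Virasoro algebra. -/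
abbrev VirasoroEnv : Type := UniversalEnvelopingAlgebra ℂ Virasoro

/-- The left ideal of `U(Vir)` generated by `C - c`, `L 0 - h` and the `L n` with `n > 0`. -/
def vermaIdeal (c h : ℂ) : Submodule VirasoroEnv VirasoroEnv :=
  Submodule.span VirasoroEnv
    ({UniversalEnvelopingAlgebra.ι ℂ Virasoro.C - algebraMap ℂ VirasoroEnv c,
      UniversalEnvelopingAlgebra.ι ℂ (Virasoro.L 0) - algebraMap ℂ VirasoroEnv h} ∪
      {u | ∃ n : ℤ, 0 < n ∧ u = UniversalEnvelopingAlgebra.ι ℂ (Virasoro.L n)})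

/-- The Verma module of central charge `c` and lowest conformal weight `h`, that is, the module
induced from the one-dimensional module of `Vir_{≥ 0} = span {L n | n ≥ 0} + ℂ C` on which
`C`, `L 0`, `L n` (`n > 0`) act by `c`, `h`, `0`. The induced module
`U(Vir) ⊗_{U(Vir_{≥ 0})} ℂ` is written as the quotient of `U(Vir)` by a left ideal. -/
def Verma (c h : ℂ) : Type := VirasoroEnv ⧸ vermaIdeal c h

namespace Verma

attribute [local instance 100] LieRing.ofAssociativeRing

variable (c h : ℂ)

instance : AddCommGroup (Verma c h) :=
  inferInstanceAs (AddCommGroup (VirasoroEnv ⧸ vermaIdeal c h))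

instance : Module VirasoroEnv (Verma c h) :=
  inferInstanceAs (Module VirasoroEnv (VirasoroEnv ⧸ vermaIdeal c h))

instance : Module ℂ (Verma c h) :=
  inferInstanceAs (Module ℂ (VirasoroEnv ⧸ vermaIdeal c h))

instance : IsScalarTower ℂ VirasoroEnv (Verma c h) :=
  inferInstanceAs (IsScalarTower ℂ VirasoroEnv (VirasoroEnv ⧸ vermaIdeal c h))

/-- The Virasoro algebra acts through its enveloping algebra. -/
instance : LieRingModule Virasoro (Verma c h) where
  bracket x w := UniversalEnvelopingAlgebra.ι ℂ x • w
  add_lie x y w := by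
    change UniversalEnvelopingAlgebra.ι ℂ (x + y) • w = _
    rw [map_add, add_smul]
  lie_add x v w := smul_add (UniversalEnvelopingAlgebra.ι ℂ x) v w
  leibniz_lie x y w := by
    change UniversalEnvelopingAlgebra.ι ℂ x • UniversalEnvelopingAlgebra.ι ℂ y • w =
      UniversalEnvelopingAlgebra.ι ℂ ⁅x, y⁆ • w +
        UniversalEnvelopingAlgebra.ι ℂ y • UniversalEnvelopingAlgebra.ι ℂ x • w
    rw [LieHom.map_lie, LieRing.of_associative_ring_bracket, sub_smul, mul_smul, mul_smul]
    abel

theorem lie_def (x : Virasoro) (w : Verma c h) :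
    ⁅x, w⁆ = UniversalEnvelopingAlgebra.ι ℂ x • w := rfl

instance : LieModule ℂ Virasoro (Verma c h) where
  smul_lie a x w := by
    rw [lie_def, lie_def, map_smul, smul_assoc]
  lie_smul a x w := by
    rw [lie_def, lie_def, ← algebraMap_smul VirasoroEnv a w,
      ← algebraMap_smul VirasoroEnv a (UniversalEnvelopingAlgebra.ι ℂ x • w), smul_smul, smul_smul,
      Algebra.commutes]

/-- The generating vector `v_h` of minimal conformal weight. -/
def vec : Verma c h := Submodule.Quotient.mk (p := vermaIdeal c h) 1

end Verma

/-- The central charge `c = 13 - 6 t - 6 t⁻¹`. -/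
def centralCharge (t : ℂ) : ℂ := 13 - 6 * t - 6 * t⁻¹

/-- The conformal weight `h_{1,2} = - 1 / 2 + 3 / (4 t)`. -/
def weightOneTwo (t : ℂ) : ℂ := -1 / 2 + 3 / (4 * t)

/-- The vector `(L_{-1} ^ 2 - t⁻¹ L_{-2}) v_{1,2}` of the Verma module of lowest conformal weight
`h_{1,2}`. -/
def singularOneTwo (t : ℂ) : Verma (centralCharge t) (weightOneTwo t) :=
  ⁅Virasoro.L (-1), ⁅Virasoro.L (-1), Verma.vec (centralCharge t) (weightOneTwo t)⁆⁆ -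
    t⁻¹ • ⁅Virasoro.L (-2), Verma.vec (centralCharge t) (weightOneTwo t)⁆

/-- The module `K_{1,2}`, the quotient of the Verma module of lowest conformal weight `h_{1,2}` by
the submodule generated by `(L_{-1} ^ 2 - t⁻¹ L_{-2}) v_{1,2}`. -/
abbrev KacOneTwo (t : ℂ) : Type :=
  Verma (centralCharge t) (weightOneTwo t) ⧸
    LieSubmodule.lieSpan ℂ Virasoro ({singularOneTwo t} : Set _)

/-! ## Intertwining operators -/

/-- The space `E{z}[log z]` of polynomials in `log z` whose coefficients are formal series
`∑ e_a z ^ a` over all complex exponents `a`. For `f : LogSeries E`, the value `f k a` is the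
coefficient of `z ^ a (log z) ^ k`. -/
abbrev LogSeries (E : Type*) [AddCommGroup E] : Type _ := ℕ →₀ (ℂ → E)

section Intertwining

variable {W₁ W₂ W₃ : Type*}
  [AddCommGroup W₁] [Module ℂ W₁]
  [AddCommGroup W₂] [Module ℂ W₂]
  [AddCommGroup W₃] [Module ℂ W₃]

/-- The coefficient `(w₁)_{h;k}` of `z ^ (-h-1) (log z) ^ k` in `𝒴(w₁, z)`. -/
def intertwiningMode (𝒴 : W₁ →ₗ[ℂ] LogSeries (W₂ →ₗ[ℂ] W₃)) (w₁ : W₁) (h : ℂ) (k : ℕ) :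
    W₂ →ₗ[ℂ] W₃ :=
  𝒴 w₁ k (-h - 1)

/-- `𝒴` is surjective: `W₃` is spanned by the vectors `(w₁)_{h;k} w₂`. -/
def IsSurjectiveIntertwining (𝒴 : W₁ →ₗ[ℂ] LogSeries (W₂ →ₗ[ℂ] W₃)) : Prop :=
  Submodule.span ℂ {w₃ : W₃ | ∃ (w₁ : W₁) (w₂ : W₂) (h : ℂ) (k : ℕ),
    w₃ = intertwiningMode 𝒴 w₁ h k w₂} = ⊤

variable [LieRingModule Virasoro W₁] [LieRingModule Virasoro W₂] [LieRingModule Virasoro W₃]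

/-- Intertwining operators `𝒴 : W₁ → Hom(W₂, W₃){z}[log z]` among modules for the Virasoro vertex
operator algebra. The identities between formal series are applied to `w₂` and compared at each
`z ^ a (log z) ^ k`. All sums over `i` have finitely many non-zero terms when `𝒴` is lower
truncated and each vector of `W₁` and of `W₂` is annihilated by `L n` for `n` large enough, which
is part of the notion of a module for the Virasoro vertex operator algebra. -/
structure IsIntertwiningOperator (𝒴 : W₁ →ₗ[ℂ] LogSeries (W₂ →ₗ[ℂ] W₃)) : Prop where
  /-- `(w₁)_{h+n;k} w₂ = 0` for `n` sufficiently positive, independently of `k`. -/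
  lower_truncation : ∀ (w₁ : W₁) (w₂ : W₂) (h : ℂ), ∃ N : ℤ, ∀ n : ℤ, N ≤ n → ∀ k : ℕ,
    intertwiningMode 𝒴 w₁ (h + n) k w₂ = 0
  /-- `L_n 𝒴(w₁, z) = 𝒴(w₁, z) L_n + ∑_{i ≥ 0} binom(n+1, i) z^{n+1-i} 𝒴(L_{i-1} w₁, z)`. -/
  commutator_formula : ∀ (w₁ : W₁) (n : ℤ) (w₂ : W₂) (k : ℕ) (a : ℂ),
    ⁅Virasoro.L n, 𝒴 w₁ k a w₂⁆ =
      𝒴 w₁ k a ⁅Virasoro.L n, w₂⁆ +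
        ∑ᶠ i : ℕ, ((Ring.choose (n + 1) i : ℤ) : ℂ) •
          𝒴 ⁅Virasoro.L ((i : ℤ) - 1), w₁⁆ k (a - ((n : ℂ) + 1 - i)) w₂
  /-- `𝒴(L_n w₁, z) = ∑_{i ≥ 0} (-1)^i binom(n+1, i)
  (L_{n-i} z^i 𝒴(w₁, z) + (-1)^n z^{n+1-i} 𝒴(w₁, z) L_{i-1})`. -/
  iterate_formula : ∀ (w₁ : W₁) (n : ℤ) (w₂ : W₂) (k : ℕ) (a : ℂ),
    𝒴 ⁅Virasoro.L n, w₁⁆ k a w₂ =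
      ∑ᶠ i : ℕ, ((-1 : ℂ) ^ i * ((Ring.choose (n + 1) i : ℤ) : ℂ)) •
        (⁅Virasoro.L (n - i), 𝒴 w₁ k (a - i) w₂⁆ +
          ((-1 : ℂ) ^ n) •
            𝒴 w₁ k (a - ((n : ℂ) + 1 - i)) ⁅Virasoro.L ((i : ℤ) - 1), w₂⁆)
  /-- `𝒴(L_{-1} w₁, z) = d/dz 𝒴(w₁, z)`, where
  `d/dz (z^a (log z)^k) = a z^{a-1} (log z)^k + k z^{a-1} (log z)^{k-1}`. -/
  derivative_property : ∀ (w₁ : W₁) (k : ℕ) (a : ℂ),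
    𝒴 ⁅Virasoro.L (-1), w₁⁆ k a =
      (a + 1) • 𝒴 w₁ k (a + 1) + ((k : ℂ) + 1) • 𝒴 w₁ (k + 1) (a + 1)

end Intertwining

end

/-!
# The fusion of `K_{1,2}` with a Verma module

The series `𝒴(w, z) u` is studied as a function of `w` for fixed `u`: an operator without logarithms
is a linear map `u ↦ Y u` from `V_{h₁}` to linear maps `Y u : K_{1,2} → V_{h₂}{z}`.

*Existence.* The commutator formula says that `Y` intertwines `L n` with the operator `homL n` on
`Hom(K_{1,2}, V_{h₂}{z})`, and the operators `homL n` satisfy the Virasoro relations (`homL_homL`).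
By the universal property of `V_{h₁}` it is enough to find the value `g = Y v_{h₁}`, a vector of
lowest weight `h₁` for the `homL n`. As in skew-symmetry, write `g = exp(z L₋₁) ∘ g'`. The conditions on
`g` hold as soon as `g'` intertwines `L n` with the action `densityL h₁ n` on `V_{h₂}{z}`
(`homL_zero_expL`, `homL_one_expL`, `homL_two_expL`), so by the universal property of `K_{1,2}`
only one series `f = ∑ f_n z ^ (Δ + n)` is needed, namely a vector of lowest weight `h_{1,2}` for
`densityL h₁` that is annihilated by the operator corresponding to `L₋₁ ^ 2 - t⁻¹ L₋₂`. The last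
condition is a second order differential equation, that is, a recursion for the `f_n` with leading
coefficient `indicial t h₁ (Δ + n) = n (t n - s)`. The condition on `s` says that it can be
solved with `f_0 = v_{h₂}`. By the relations between `c`, `h_{1,2}` and `t` the solution is then
automatically of lowest weight (`lie_lowestSeries`).

The property `𝒴(L₋₁ w, z) = d/dz 𝒴(w, z)` and the iterate formula for `L₋₂` hold on `v_{h₁}` by a
direct computation with `exp(z L₋₁)`, and they pass from `u` to `L m u` (`homL_lie_L_neg_one`,
`iterate_neg_two_lie`). The iterate formula for `n ≥ -1` is an inversion of the commutator formula
(`iterate_natCast`), and for `n ≤ -3` it follows from the one for `L₋₂` by commuting with `L₋₁`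
(`iterate_pred`).

*Surjectivity.* The span of all coefficients is a submodule by the commutator formula, and contains
the leading coefficient `f_0 = v_{h₂}`.

*Uniqueness.* Let `𝒴` be any intertwining operator and let `F k a` be the coefficient of
`z ^ a (log z) ^ k` in `𝒴(v_{1,2}, z) v_{h₁}`. It is a generalized eigenvector of `L 0`, which is
semisimple on `V_{h₂}` with eigenvalues in `h₂ + ℕ` and lowest weight space spanned by `v_{h₂}`
(`Verma.maxGenEigenspace_opL_zero_le`). Therefore the logarithms vanish, the exponents lie in
`Δ + ℕ`, and `F 0 Δ` is a multiple of `v_{h₂}`. The relation `L₋₁ ^ 2 v_{1,2} = t⁻¹ L₋₂ v_{1,2}`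
gives a recursion with the same indicial polynomial, so `F` is determined by `F 0 Δ`; the commutator
and iterate formulas then determine `𝒴` (`IsIntertwiningOperator.eq_of_apply_vec_eq`).
-/

noncomputable section

/-! ### Modules generated by a lowest weight vector -/

section Modules

variable {V : Type*} [AddCommGroup V] [Module ℂ V] [LieRingModule Virasoro V]
  [LieModule ℂ Virasoro V]

theorem Virasoro.lie_L_lie_L {c : ℂ} (hC : ∀ v : V, ⁅Virasoro.C, v⁆ = c • v) (m n : ℤ) (v : V) :
    ⁅Virasoro.L m, ⁅Virasoro.L n, v⁆⁆ = ⁅Virasoro.L n, ⁅Virasoro.L m, v⁆⁆ +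
      ((m : ℂ) - n) • ⁅Virasoro.L (m + n), v⁆ +
      (if m = -n then ((m : ℂ) ^ 3 - m) / 12 else 0) • c • v := by
  rw [leibniz_lie, Virasoro.lie_L_L, add_lie, smul_lie, smul_lie, hC]
  abel

end Modules

/-- The universal enveloping algebra is generated by the image of the Lie algebra. -/
theorem UniversalEnvelopingAlgebra.eq_top_of_ι_mem {R L : Type*} [CommRing R] [LieRing L]
    [LieAlgebra R L] (B : Subalgebra R (UniversalEnvelopingAlgebra R L))
    (hB : ∀ x : L, UniversalEnvelopingAlgebra.ι R x ∈ B) : B = ⊤ := by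
  let _ : LieRing B := LieRing.ofAssociativeRing
  let _ : LieRing (UniversalEnvelopingAlgebra R L) := LieRing.ofAssociativeRing
  let f : L →ₗ⁅R⁆ B :=
    { toFun := fun x => ⟨UniversalEnvelopingAlgebra.ι R x, hB x⟩
      map_add' := fun x y => by ext; simp only [map_add]; rfl
      map_smul' := fun a x => by ext; simp only [map_smul]; rfl
      map_lie' := fun {x y} => Subtype.ext (LieHom.map_lie (UniversalEnvelopingAlgebra.ι R) x y) }
  have key : B.val.comp (UniversalEnvelopingAlgebra.lift R f) =
      AlgHom.id R (UniversalEnvelopingAlgebra R L) := by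
    apply UniversalEnvelopingAlgebra.hom_ext
    ext x
    change ((UniversalEnvelopingAlgebra.lift R f (UniversalEnvelopingAlgebra.ι R x) : B) :
      UniversalEnvelopingAlgebra R L) = UniversalEnvelopingAlgebra.ι R x
    rw [UniversalEnvelopingAlgebra.lift_ι_apply]
    rfl
  refine eq_top_iff.mpr fun u _ => ?_
  have := DFunLike.congr_fun key u
  change ((UniversalEnvelopingAlgebra.lift R f u : B) : UniversalEnvelopingAlgebra R L) = u at this
  rw [← this]
  exact SetLike.coe_mem _

namespace Virasoro

theorem mem_of_L_mem_of_C_mem (S : Submodule ℂ Virasoro) (hL : ∀ n, L n ∈ S) (hC : C ∈ S)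
    (x : Virasoro) : x ∈ S := by
  obtain ⟨f, a⟩ := x
  have h : ((f, a) : Virasoro) = (f.sum fun n b => b • L n) + a • C := by
    refine Prod.ext ?_ ?_
    · have : (f.sum fun n b => b • L n).1 = f.sum fun n b => b • Finsupp.single n (1 : ℂ) :=
        map_finsuppSum (LinearMap.fst ℂ (ℤ →₀ ℂ) ℂ) f _
      change f = (f.sum fun n b => b • L n).1 + a • (0 : ℤ →₀ ℂ)
      rw [this]
      simp
    · have : (f.sum fun n b => b • L n).2 = f.sum fun n b => b • (0 : ℂ) :=
        map_finsuppSum (LinearMap.snd ℂ (ℤ →₀ ℂ) ℂ) f _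
      change a = (f.sum fun n b => b • L n).2 + a • (1 : ℂ)
      rw [this]
      simp
  rw [h]
  exact S.add_mem (S.sum_mem fun n _ => S.smul_mem _ (hL n)) (S.smul_mem _ hC)

end Virasoro

namespace Verma

variable {c h : ℂ}
attribute [local instance 100] LieRing.ofAssociativeRing

theorem smul_vec (u : VirasoroEnv) :
    u • vec c h = Submodule.Quotient.mk (p := vermaIdeal c h) u := by
  change u • Submodule.Quotient.mk (p := vermaIdeal c h) 1 = _
  rw [← Submodule.Quotient.mk_smul, smul_eq_mul, mul_one]

theorem exists_smul_vec (w : Verma c h) : ∃ u : VirasoroEnv, w = u • vec c h := by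
  obtain ⟨u, rfl⟩ := Submodule.Quotient.mk_surjective (vermaIdeal c h) w
  exact ⟨u, (smul_vec u).symm⟩

theorem smul_vec_eq_zero {u : VirasoroEnv} (hu : u ∈ vermaIdeal c h) : u • vec c h = 0 := by
  rw [smul_vec]
  exact (Submodule.Quotient.mk_eq_zero _).mpr hu

theorem lie_L_vec_of_pos {n : ℤ} (hn : 0 < n) : ⁅Virasoro.L n, vec c h⁆ = 0 :=
  smul_vec_eq_zero (Submodule.subset_span (Or.inr ⟨n, hn, rfl⟩))

theorem lie_L_zero_vec : ⁅Virasoro.L 0, vec c h⁆ = h • vec c h := by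
  rw [← sub_eq_zero, lie_def, ← algebraMap_smul VirasoroEnv h (vec c h), ← sub_smul]
  exact smul_vec_eq_zero (Submodule.subset_span (Or.inl (Or.inr rfl)))

theorem ι_C_mul_comm (u : VirasoroEnv) :
    UniversalEnvelopingAlgebra.ι ℂ Virasoro.C * u =
      u * UniversalEnvelopingAlgebra.ι ℂ Virasoro.C := by
  have := UniversalEnvelopingAlgebra.eq_top_of_ι_mem
    (Subalgebra.centralizer ℂ {UniversalEnvelopingAlgebra.ι ℂ Virasoro.C}) (fun x => by
      rw [Subalgebra.mem_centralizer_iff]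
      rintro _ rfl
      have h := LieHom.map_lie (UniversalEnvelopingAlgebra.ι ℂ) x Virasoro.C
      rw [Virasoro.lie_C_right, map_zero, LieRing.of_associative_ring_bracket] at h
      exact (sub_eq_zero.mp h.symm).symm)
  have hu : u ∈ Subalgebra.centralizer ℂ {UniversalEnvelopingAlgebra.ι ℂ Virasoro.C} := by
    rw [this]; trivial
  exact (Subalgebra.mem_centralizer_iff ℂ).mp hu _ rfl

theorem lie_C (w : Verma c h) : ⁅Virasoro.C, w⁆ = c • w := by
  obtain ⟨u, rfl⟩ := exists_smul_vec w
  rw [← sub_eq_zero, lie_def, smul_smul, ι_C_mul_comm,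
    ← algebraMap_smul VirasoroEnv c (u • vec c h), smul_smul, Algebra.commutes,
    ← sub_smul, ← mul_sub, mul_smul]
  rw [smul_vec_eq_zero, smul_zero]
  exact Submodule.subset_span (Or.inl (Or.inl rfl))

/-- Induction principle: a subspace that contains the generator and is stable under all `L n` is
everything. -/
theorem mem_of_vec_mem (S : Submodule ℂ (Verma c h)) (hvec : vec c h ∈ S)
    (hL : ∀ (n : ℤ), ∀ w ∈ S, ⁅Virasoro.L n, w⁆ ∈ S) (w : Verma c h) : w ∈ S := by
  let B : Subalgebra ℂ VirasoroEnv :=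
    { carrier := {u | ∀ w ∈ S, u • w ∈ S}
      mul_mem' := fun {a b} ha hb w hw => by
        rw [mul_smul]; exact ha _ (hb _ hw)
      add_mem' := fun {a b} ha hb w hw => by
        rw [add_smul]; exact S.add_mem (ha _ hw) (hb _ hw)
      algebraMap_mem' := fun r w hw => by
        rw [algebraMap_smul]; exact S.smul_mem r hw }
  have hB : B = ⊤ := UniversalEnvelopingAlgebra.eq_top_of_ι_mem B fun x => by
    refine Virasoro.mem_of_L_mem_of_C_mem
      (B.toSubmodule.comap
        (UniversalEnvelopingAlgebra.ι ℂ : Virasoro →ₗ⁅ℂ⁆ VirasoroEnv).toLinearMap) ?_ ?_ x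
    · intro n w hw
      exact hL n w hw
    · intro w hw
      change ⁅Virasoro.C, w⁆ ∈ S
      rw [lie_C]
      exact S.smul_mem c hw
  obtain ⟨u, rfl⟩ := exists_smul_vec w
  have hu : u ∈ B := by rw [hB]; trivial
  exact hu _ hvec

/-- The universal property of a Verma module, for a Virasoro action given by operators `ℓ n`. It is
enough that `ℓ 1` and `ℓ 2` annihilate the image of the generator, since they generate the other
`ℓ n` with `n > 0`. -/
theorem exists_lift {M : Type*} [AddCommGroup M] [Module ℂ M] (ℓ : ℤ → Module.End ℂ M)
    (hℓ : ∀ (m n : ℤ) (x : M), ℓ m (ℓ n x) = ℓ n (ℓ m x) + ((m : ℂ) - n) • ℓ (m + n) x +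
      (if m = -n then ((m : ℂ) ^ 3 - m) / 12 else 0) • c • x)
    (x : M) (h0 : ℓ 0 x = h • x) (h1 : ℓ 1 x = 0) (h2 : ℓ 2 x = 0) :
    ∃ φ : Verma c h →ₗ[ℂ] M, φ (vec c h) = x ∧ ∀ n w, φ ⁅Virasoro.L n, w⁆ = ℓ n (φ w) := by
  have hpos : ∀ k : ℕ, ℓ (k + 1) x = 0 := by
    intro k
    induction k with
    | zero => simpa using h1
    | succ k ih =>
      rcases Nat.eq_zero_or_pos k with rfl | hk
      · simpa using h2
      have h3 := hℓ (k + 1) 1 x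
      rw [ih, h1, map_zero, map_zero, if_neg (by omega), zero_smul, add_zero, zero_add] at h3
      have h4 : ((((k : ℤ) + 1 : ℤ) : ℂ) - (1 : ℤ)) ≠ 0 := by
        push_cast
        simp only [add_sub_cancel_right]
        exact_mod_cast hk.ne'
      simpa using (smul_eq_zero.mp h3.symm).resolve_left h4
  -- The representation given by the operators `ℓ n` makes `M` a module over the enveloping algebra.
  let ρ₀ : Virasoro →ₗ[ℂ] Module.End ℂ M :=
    (Finsupp.lift (Module.End ℂ M) ℂ ℤ ℓ).comp (LinearMap.fst ℂ (ℤ →₀ ℂ) ℂ) +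
      (LinearMap.toSpanSingleton ℂ (Module.End ℂ M) (c • 1)).comp (LinearMap.snd ℂ (ℤ →₀ ℂ) ℂ)
  have hρL : ∀ n, ρ₀ (Virasoro.L n) = ℓ n := by
    intro n
    change Finsupp.lift (Module.End ℂ M) ℂ ℤ ℓ (Finsupp.single n 1) + (0 : ℂ) • (c • 1) = ℓ n
    rw [Finsupp.lift_apply, Finsupp.sum_single_index (zero_smul ℂ (ℓ n)), one_smul, zero_smul,
      add_zero]
  have hρC : ρ₀ Virasoro.C = c • 1 := by
    change Finsupp.lift (Module.End ℂ M) ℂ ℤ ℓ 0 + (1 : ℂ) • (c • 1) = c • 1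
    rw [map_zero, one_smul, zero_add]
  have hρ : ∀ x y : Virasoro, ρ₀ ⁅x, y⁆ = ⁅ρ₀ x, ρ₀ y⁆ := by
    let B₁ : Virasoro →ₗ[ℂ] Virasoro →ₗ[ℂ] Module.End ℂ M :=
      LinearMap.mk₂ ℂ (fun x y => ρ₀ ⁅x, y⁆ - (ρ₀ x * ρ₀ y - ρ₀ y * ρ₀ x))
        (fun x x' y => by simp only [add_lie, map_add, add_mul, mul_add]; abel)
        (fun a x y => by
          simp only [smul_lie, map_smul, smul_mul_assoc, mul_smul_comm, smul_sub])
        (fun x y y' => by simp only [lie_add, map_add, add_mul, mul_add]; abel)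
        (fun a x y => by
          simp only [lie_smul, map_smul, smul_mul_assoc, mul_smul_comm, smul_sub])
    have hB₁ : ∀ x y, B₁ x y = ρ₀ ⁅x, y⁆ - (ρ₀ x * ρ₀ y - ρ₀ y * ρ₀ x) := fun _ _ => rfl
    have hcomm : ∀ T : Module.End ℂ M, (c • 1) * T = T * (c • 1) := fun T => by
      rw [smul_mul_assoc, mul_smul_comm, one_mul, mul_one]
    have hC : ∀ x, x ∈ LinearMap.ker (B₁.flip Virasoro.C) := fun x => by
      rw [LinearMap.mem_ker, LinearMap.flip_apply, hB₁, Virasoro.lie_C_right, map_zero, hρC, hcomm,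
        sub_self, sub_zero]
    have hzero : ∀ x y, B₁ x y = 0 := by
      intro x y
      refine Virasoro.mem_of_L_mem_of_C_mem (LinearMap.ker (B₁.flip y)) (fun m => ?_) ?_ x
      · refine Virasoro.mem_of_L_mem_of_C_mem (LinearMap.ker (B₁ (Virasoro.L m))) (fun n => ?_)
          (hC _) y
        rw [LinearMap.mem_ker, hB₁, Virasoro.lie_L_L, map_add, map_smul, map_smul, hρL, hρL, hρL,
          hρC]
        ext z
        have := hℓ m n z
        simp only [LinearMap.sub_apply, LinearMap.add_apply, LinearMap.smul_apply,
          Module.End.mul_apply, Module.End.one_apply, this, LinearMap.zero_apply]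
        abel
      · rw [LinearMap.mem_ker, LinearMap.flip_apply, hB₁, ← lie_skew, Virasoro.lie_C_right,
          neg_zero, map_zero, hρC, hcomm, sub_self, sub_zero]
    intro x y
    exact sub_eq_zero.mp (hzero x y)
  let ρ : Virasoro →ₗ⁅ℂ⁆ Module.End ℂ M := { ρ₀ with map_lie' := fun {x y} => hρ x y }
  let F : VirasoroEnv →ₐ[ℂ] Module.End ℂ M := UniversalEnvelopingAlgebra.lift ℂ ρ
  have hF : ∀ y, F (UniversalEnvelopingAlgebra.ι ℂ y) = ρ₀ y := fun y =>
    UniversalEnvelopingAlgebra.lift_ι_apply ℂ ρ y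
  let _ : Module VirasoroEnv M := Module.compHom M F.toRingHom
  have hsmul : ∀ (u : VirasoroEnv) (y : M), u • y = F u y := fun _ _ => rfl
  have hker : vermaIdeal c h ≤ LinearMap.ker (LinearMap.toSpanSingleton VirasoroEnv M x) := by
    refine Submodule.span_le.mpr ?_
    rintro u ((rfl | rfl) | ⟨n, hn, rfl⟩) <;>
      rw [SetLike.mem_coe, LinearMap.mem_ker, LinearMap.toSpanSingleton_apply, hsmul]
    · rw [map_sub, hF, hρC, AlgHom.commutes, Algebra.algebraMap_eq_smul_one, sub_self,
        LinearMap.zero_apply]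
    · rw [map_sub, hF, hρL, AlgHom.commutes, Algebra.algebraMap_eq_smul_one, LinearMap.sub_apply,
        h0]
      exact sub_self _
    · obtain ⟨k, rfl⟩ : ∃ k : ℕ, n = k + 1 := ⟨(n - 1).toNat, by omega⟩
      rw [hF, hρL, hpos]
  let φ : Verma c h →ₗ[VirasoroEnv] M := (vermaIdeal c h).liftQ _ hker
  have hφ : ∀ u : VirasoroEnv, φ (u • vec c h) = F u x := by
    intro u
    rw [smul_vec]
    rfl
  refine ⟨{ toFun := φ, map_add' := map_add φ, map_smul' := fun a w => ?_ }, ?_, ?_⟩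
  · obtain ⟨u, rfl⟩ := exists_smul_vec w
    rw [← smul_assoc, hφ, hφ, map_smul]
    rfl
  · change φ (vec c h) = x
    rw [← one_smul VirasoroEnv (vec c h), hφ, map_one]
    rfl
  · intro n w
    change φ ⁅Virasoro.L n, w⁆ = ℓ n (φ w)
    rw [lie_def, map_smul, hsmul, hF, hρL]

end Verma

namespace KacOneTwo

variable {t : ℂ}

attribute [local instance 100] LieRing.ofAssociativeRing

/-- The generating vector of `K_{1,2}`, the image of the vector `v_{1,2}`. -/
def vec (t : ℂ) : KacOneTwo t :=
  LieSubmodule.Quotient.mk (Verma.vec (centralCharge t) (weightOneTwo t))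

theorem mk_lie (x : Virasoro) (w : Verma (centralCharge t) (weightOneTwo t)) :
    (LieSubmodule.Quotient.mk ⁅x, w⁆ : KacOneTwo t) =
      ⁅x, (LieSubmodule.Quotient.mk w : KacOneTwo t)⁆ :=
  rfl

theorem exists_mk (w : KacOneTwo t) :
    ∃ u : Verma (centralCharge t) (weightOneTwo t), w = LieSubmodule.Quotient.mk u := by
  obtain ⟨u, rfl⟩ := Submodule.Quotient.mk_surjective _ w
  exact ⟨u, rfl⟩

theorem lie_C (w : KacOneTwo t) : ⁅Virasoro.C, w⁆ = centralCharge t • w := by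
  obtain ⟨u, rfl⟩ := exists_mk w
  rw [← mk_lie, Verma.lie_C]
  rfl

theorem lie_L_vec_of_pos {n : ℤ} (hn : 0 < n) : ⁅Virasoro.L n, vec t⁆ = 0 := by
  rw [vec, ← mk_lie, Verma.lie_L_vec_of_pos hn]
  rfl

theorem lie_L_zero_vec : ⁅Virasoro.L 0, vec t⁆ = weightOneTwo t • vec t := by
  rw [vec, ← mk_lie, Verma.lie_L_zero_vec]
  rfl

theorem lie_L_neg_one_lie_L_neg_one_vec :
    ⁅Virasoro.L (-1), ⁅Virasoro.L (-1), vec t⁆⁆ = t⁻¹ • ⁅Virasoro.L (-2), vec t⁆ := by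
  rw [← sub_eq_zero]
  change (LieSubmodule.Quotient.mk (singularOneTwo t) : KacOneTwo t) = 0
  exact LieSubmodule.Quotient.mk_eq_zero'.mpr (LieSubmodule.subset_lieSpan rfl)

theorem mem_of_vec_mem (S : Submodule ℂ (KacOneTwo t)) (hvec : vec t ∈ S)
    (hL : ∀ (n : ℤ), ∀ w ∈ S, ⁅Virasoro.L n, w⁆ ∈ S) (w : KacOneTwo t) : w ∈ S := by
  obtain ⟨u, rfl⟩ := exists_mk w
  exact Verma.mem_of_vec_mem (S.comap (Submodule.mkQ (LieSubmodule.lieSpan ℂ Virasoro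
    ({singularOneTwo t} : Set _)).toSubmodule)) hvec (fun n w hw => hL n _ hw) u

/-- The universal property of `K_{1,2}`. -/
theorem exists_lift {M : Type*} [AddCommGroup M] [Module ℂ M] (ℓ : ℤ → Module.End ℂ M)
    (hℓ : ∀ (m n : ℤ) (x : M), ℓ m (ℓ n x) = ℓ n (ℓ m x) + ((m : ℂ) - n) • ℓ (m + n) x +
      (if m = -n then ((m : ℂ) ^ 3 - m) / 12 else 0) • centralCharge t • x)
    (x : M) (h0 : ℓ 0 x = weightOneTwo t • x) (h1 : ℓ 1 x = 0) (h2 : ℓ 2 x = 0)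
    (hs : ℓ (-1) (ℓ (-1) x) = t⁻¹ • ℓ (-2) x) :
    ∃ φ : KacOneTwo t →ₗ[ℂ] M, φ (vec t) = x ∧ ∀ n w, φ ⁅Virasoro.L n, w⁆ = ℓ n (φ w) := by
  obtain ⟨φ, hφ, hφL⟩ := Verma.exists_lift (h := weightOneTwo t) ℓ hℓ x h0 h1 h2
  let N : LieSubmodule ℂ Virasoro (Verma (centralCharge t) (weightOneTwo t)) :=
    { LinearMap.ker φ with
      lie_mem := fun {y w} hw => by
        refine Virasoro.mem_of_L_mem_of_C_mem ((LinearMap.ker φ).comap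
          ((LinearMap.flip (LieModule.toEnd ℂ Virasoro
            (Verma (centralCharge t) (weightOneTwo t))).toLinearMap) w)) (fun n => ?_) ?_ y
        · have hw' : φ w = 0 := hw
          change φ ⁅Virasoro.L n, w⁆ = 0
          rw [hφL, hw', map_zero]
        · have hw' : φ w = 0 := hw
          change φ ⁅Virasoro.C, w⁆ = 0
          rw [Verma.lie_C, map_smul, hw', smul_zero] }
  have hN : LieSubmodule.lieSpan ℂ Virasoro ({singularOneTwo t} : Set _) ≤ N := by
    rw [LieSubmodule.lieSpan_le]
    rintro _ rfl
    change φ (singularOneTwo t) = 0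
    rw [singularOneTwo, map_sub, map_smul, hφL, hφL, hφL, hφ, hs, sub_self]
  refine ⟨Submodule.liftQ _ φ hN, hφ, fun n w => ?_⟩
  obtain ⟨u, rfl⟩ := exists_mk w
  exact hφL n u

end KacOneTwo

/-! ### Binomial coefficients with integral upper argument -/

/-- The generalized binomial coefficient `binom(n, i)`, `n : ℤ`, as a complex number. -/
def intChoose (n : ℤ) (i : ℕ) : ℂ := ((Ring.choose n i : ℤ) : ℂ)

theorem intChoose_zero (n : ℤ) : intChoose n 0 = 1 := by
  simp [intChoose]

theorem intChoose_succ_succ (n : ℤ) (i : ℕ) :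
    intChoose (n + 1) (i + 1) = intChoose n i + intChoose n (i + 1) := by
  rw [intChoose, Ring.choose_succ_succ]
  push_cast
  rfl

theorem succ_mul_intChoose_succ_succ (n : ℤ) (i : ℕ) :
    ((i : ℂ) + 1) * intChoose (n + 1) (i + 1) = ((n : ℂ) + 1) * intChoose n i := by
  have h := Ring.choose_add_smul_choose n i 1
  rw [Nat.choose_one_right, Nat.cast_one, Ring.choose_one_right, nsmul_eq_mul] at h
  rw [intChoose, intChoose]
  exact_mod_cast h

theorem succ_mul_intChoose_succ (n : ℤ) (i : ℕ) :
    ((i : ℂ) + 1) * intChoose n (i + 1) = ((n : ℂ) - i) * intChoose n i := by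
  have h1 := succ_mul_intChoose_succ_succ n i
  rw [intChoose_succ_succ] at h1
  linear_combination h1

theorem intChoose_natCast (n i : ℕ) : intChoose n i = (n.choose i : ℂ) := by
  rw [intChoose, Ring.choose_natCast]
  simp

theorem intChoose_add (m n : ℤ) (k : ℕ) :
    intChoose (m + n) k =
      ∑ i ∈ Finset.range (k + 1), intChoose m i * intChoose n (k - i) := by
  rw [intChoose, Ring.add_choose_eq k (Commute.all m n),
    Finset.Nat.sum_antidiagonal_eq_sum_range_succ_mk]
  push_cast
  rfl

theorem intChoose_neg_one (i : ℕ) : intChoose (-1) i = (-1) ^ i := by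
  induction i with
  | zero => simp [intChoose_zero]
  | succ i ih =>
    have h := intChoose_succ_succ (-1) i
    have h0 : intChoose 0 (i + 1) = 0 := by
      have := intChoose_natCast 0 (i + 1)
      simpa using this
    rw [show (-1 : ℤ) + 1 = 0 by norm_num, h0, ih] at h
    rw [pow_succ]
    linear_combination -h

/-! ### Smooth modules -/

/-- Every vector is annihilated by all `L n` with `n` large enough. -/
class IsSmoothModule (W : Type*) [AddCommGroup W] [LieRingModule Virasoro W] : Prop where
  exists_lie_eq_zero : ∀ w : W, ∃ N : ℕ, ∀ n : ℤ, (N : ℤ) ≤ n → ⁅Virasoro.L n, w⁆ = 0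

section Smooth

variable {W X Y : Type*} [AddCommGroup W] [Module ℂ W] [LieRingModule Virasoro W]
  [AddCommGroup X] [Module ℂ X] [AddCommGroup Y] [Module ℂ Y]

theorem hasFiniteSupport_smooth [IsSmoothModule W] (r : ℤ) (T : ℕ → W →ₗ[ℂ] X) (w : W) :
    (Function.support fun i : ℕ => T i ⁅Virasoro.L (r + i), w⁆).Finite := by
  obtain ⟨N, hN⟩ := IsSmoothModule.exists_lie_eq_zero w
  refine (Finset.range (N + r.natAbs)).finite_toSet.subset fun i hi => ?_
  by_contra hi'
  rw [Finset.mem_coe, Finset.mem_range, not_lt] at hi'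
  exact hi (by simp [hN (r + i) (by omega)])

variable [LieModule ℂ Virasoro W]

/-- The vectors annihilated by all `L n` with `n` large enough. -/
def smoothVectors (W : Type*) [AddCommGroup W] [Module ℂ W] [LieRingModule Virasoro W]
    [LieModule ℂ Virasoro W] : Submodule ℂ W where
  carrier := {w | ∃ N : ℕ, ∀ n : ℤ, (N : ℤ) ≤ n → ⁅Virasoro.L n, w⁆ = 0}
  zero_mem' := ⟨0, fun n _ => lie_zero _⟩
  add_mem' := by
    rintro v w ⟨M, hM⟩ ⟨N, hN⟩
    exact ⟨M + N, fun n hn => by rw [lie_add, hM n (by omega), hN n (by omega), add_zero]⟩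
  smul_mem' := by
    rintro a w ⟨N, hN⟩
    exact ⟨N, fun n hn => by rw [lie_smul, hN n hn, smul_zero]⟩

theorem lie_L_mem_smoothVectors {c : ℂ} (hC : ∀ w : W, ⁅Virasoro.C, w⁆ = c • w) (m : ℤ) {w : W}
    (hw : w ∈ smoothVectors W) : ⁅Virasoro.L m, w⁆ ∈ smoothVectors W := by
  obtain ⟨N, hN⟩ := hw
  refine ⟨N + m.natAbs + 1, fun n hn => ?_⟩
  rw [Virasoro.lie_L_lie_L hC, hN n (by omega), hN (n + m) (by omega), if_neg (by omega), lie_zero]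
  simp

variable [IsSmoothModule W]

/-- The sum `∑ i ≥ 0, T i (L (r + i) w)` on a smooth module, where it has finitely many non-zero
terms. -/
def smoothSum (r : ℤ) (T : ℕ → W →ₗ[ℂ] X) : W →ₗ[ℂ] X where
  toFun w := ∑ᶠ i : ℕ, T i ⁅Virasoro.L (r + i), w⁆
  map_add' v w := by
    simp only [lie_add, map_add]
    exact finsum_add_distrib (hasFiniteSupport_smooth r T v) (hasFiniteSupport_smooth r T w)
  map_smul' a w := by
    simp only [lie_smul, map_smul, RingHom.id_apply]
    exact (smul_finsum _ _).symm

theorem smoothSum_apply (r : ℤ) (T : ℕ → W →ₗ[ℂ] X) (w : W) :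
    smoothSum r T w = ∑ᶠ i : ℕ, T i ⁅Virasoro.L (r + i), w⁆ := rfl

theorem exists_smoothSum_eq_sum (r : ℤ) (w : W) : ∃ N : ℕ, ∀ B : ℕ, N ≤ B →
    ∀ T : ℕ → W →ₗ[ℂ] X, smoothSum r T w = ∑ i ∈ Finset.range B, T i ⁅Virasoro.L (r + i), w⁆ := by
  obtain ⟨N, hN⟩ := IsSmoothModule.exists_lie_eq_zero w
  refine ⟨N + r.natAbs, fun B hB T => ?_⟩
  refine finsum_eq_sum_of_support_subset _ fun i hi => ?_
  by_contra hi'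
  rw [Finset.mem_coe, Finset.mem_range, not_lt] at hi'
  exact hi (by simp [hN (r + i) (by omega)])

theorem map_smoothSum (g : X →ₗ[ℂ] Y) (r : ℤ) (T : ℕ → W →ₗ[ℂ] X) (w : W) :
    g (smoothSum r T w) = smoothSum r (fun i => g ∘ₗ T i) w := by
  exact map_finsum g (hasFiniteSupport_smooth r T w)

theorem smoothSum_add (r : ℤ) (T T' : ℕ → W →ₗ[ℂ] X) (w : W) :
    smoothSum r (fun i => T i + T' i) w = smoothSum r T w + smoothSum r T' w :=
  finsum_add_distrib (hasFiniteSupport_smooth r T w) (hasFiniteSupport_smooth r T' w)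

theorem smoothSum_sub (r : ℤ) (T T' : ℕ → W →ₗ[ℂ] X) (w : W) :
    smoothSum r (fun i => T i - T' i) w = smoothSum r T w - smoothSum r T' w :=
  finsum_sub_distrib (hasFiniteSupport_smooth r T w) (hasFiniteSupport_smooth r T' w)

theorem smoothSum_smul (a : ℂ) (r : ℤ) (T : ℕ → W →ₗ[ℂ] X) (w : W) :
    smoothSum r (fun i => a • T i) w = a • smoothSum r T w :=
  (smul_finsum _ _).symm

theorem smoothSum_succ (r : ℤ) (T : ℕ → W →ₗ[ℂ] X) (w : W) :
    smoothSum r T w = T 0 ⁅Virasoro.L r, w⁆ + smoothSum (r + 1) (fun i => T (i + 1)) w := by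
  obtain ⟨M, hM⟩ := exists_smoothSum_eq_sum (X := X) r w
  obtain ⟨N, hN⟩ := exists_smoothSum_eq_sum (X := X) (r + 1) w
  rw [hM (M + N + 1) (by omega), hN (M + N) (by omega), Finset.sum_range_succ', add_comm]
  congr 1
  · simp
  · refine Finset.sum_congr rfl fun i _ => ?_
    rw [show r + ((i + 1 : ℕ) : ℤ) = r + 1 + i by push_cast; ring]

end Smooth

/-! ### Lower truncated series -/

/-- The lower truncated series `∑ f a z ^ a` with complex exponents: on each coset of `ℤ`, the
coefficients vanish for exponents of sufficiently negative real part. -/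
def truncSeries (V : Type*) [AddCommGroup V] [Module ℂ V] : Submodule ℂ (ℂ → V) where
  carrier := {f | ∀ a, ∃ N : ℕ, ∀ n : ℕ, N ≤ n → f (a - n) = 0}
  zero_mem' := fun _ => ⟨0, fun _ _ => rfl⟩
  add_mem' := by
    intro f g hf hg a
    obtain ⟨M, hM⟩ := hf a
    obtain ⟨N, hN⟩ := hg a
    exact ⟨M + N, fun n hn => by
      rw [Pi.add_apply, hM n (by omega), hN n (by omega), add_zero]⟩
  smul_mem' := by
    intro b f hf a
    obtain ⟨N, hN⟩ := hf a
    exact ⟨N, fun n hn => by rw [Pi.smul_apply, hN n hn, smul_zero]⟩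

namespace truncSeries

variable {V : Type*} [AddCommGroup V] [Module ℂ V]

@[ext]
theorem ext {f g : truncSeries V} (h : ∀ a, f.1 a = g.1 a) : f = g := Subtype.ext (funext h)

theorem add_coe_apply (f g : truncSeries V) (a : ℂ) : (f + g).1 a = f.1 a + g.1 a := rfl

theorem sub_coe_apply (f g : truncSeries V) (a : ℂ) : (f - g).1 a = f.1 a - g.1 a := rfl

theorem smul_coe_apply (b : ℂ) (f : truncSeries V) (a : ℂ) : (b • f).1 a = b • f.1 a := rfl

theorem zero_coe_apply (a : ℂ) : (0 : truncSeries V).1 a = 0 := rfl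

/-- The coefficient of `z ^ a`. -/
def coeff (a : ℂ) : truncSeries V →ₗ[ℂ] V where
  toFun f := f.1 a
  map_add' _ _ := rfl
  map_smul' _ _ := rfl

theorem coeff_apply (a : ℂ) (f : truncSeries V) : coeff a f = f.1 a := rfl

/-- Multiplication by `z ^ j`. -/
def shift (j : ℤ) : Module.End ℂ (truncSeries V) where
  toFun f := ⟨fun a => f.1 (a - j), fun a => by
    obtain ⟨N, hN⟩ := f.2 (a - j)
    exact ⟨N, fun n hn => by change f.1 (a - n - j) = 0; rw [sub_right_comm]; exact hN n hn⟩⟩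
  map_add' _ _ := rfl
  map_smul' _ _ := rfl

theorem shift_apply (j : ℤ) (f : truncSeries V) (a : ℂ) : (shift j f).1 a = f.1 (a - j) := rfl

theorem shift_shift (i j : ℤ) (f : truncSeries V) : shift i (shift j f) = shift (i + j) f := by
  ext a
  rw [shift_apply, shift_apply, shift_apply]
  push_cast
  ring_nf

theorem shift_zero (f : truncSeries V) : shift 0 f = f := by
  ext a
  simp [shift_apply]

/-- The derivative `d / dz`. -/
def deriv : Module.End ℂ (truncSeries V) where
  toFun f := ⟨fun a => (a + 1) • f.1 (a + 1), fun a => by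
    obtain ⟨N, hN⟩ := f.2 (a + 1)
    exact ⟨N, fun n hn => by
      change (a - n + 1) • f.1 (a - n + 1) = 0
      rw [show a - (n : ℂ) + 1 = a + 1 - n by ring, hN n hn, smul_zero]⟩⟩
  map_add' f g := by ext a; exact smul_add _ _ _
  map_smul' b f := by ext a; exact smul_comm _ _ _

theorem deriv_apply (f : truncSeries V) (a : ℂ) : (deriv f).1 a = (a + 1) • f.1 (a + 1) := rfl

theorem deriv_shift (j : ℤ) (f : truncSeries V) :
    deriv (shift j f) = shift j (deriv f) + (j : ℂ) • shift (j - 1) f := by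
  ext a
  rw [deriv_apply, add_coe_apply, smul_coe_apply, shift_apply, shift_apply, shift_apply,
    deriv_apply, show a - ((j - 1 : ℤ) : ℂ) = a + 1 - j by push_cast; ring,
    show a - (j : ℂ) + 1 = a + 1 - j by ring, ← add_smul]
  congr 1
  ring

theorem finite_support_act (P : ℕ → Module.End ℂ V) (f : truncSeries V) (a : ℂ) :
    (Function.support fun i : ℕ => P i (f.1 (a - i))).Finite := by
  obtain ⟨N, hN⟩ := f.2 a
  refine (Finset.range N).finite_toSet.subset fun i hi => ?_
  by_contra hi'
  rw [Finset.mem_coe, Finset.mem_range, not_lt] at hi'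
  exact hi (by simp [hN i hi'])

/-- The action `f ↦ ∑ i ≥ 0, z ^ i P_i f` of a power series with operator coefficients. -/
def act (P : ℕ → Module.End ℂ V) : Module.End ℂ (truncSeries V) where
  toFun f := ⟨fun a => ∑ᶠ i : ℕ, P i (f.1 (a - i)), fun a => by
    obtain ⟨N, hN⟩ := f.2 a
    refine ⟨N, fun n hn => finsum_eq_zero_of_forall_eq_zero fun i => ?_⟩
    rw [show a - (n : ℂ) - i = a - ((n + i : ℕ) : ℂ) by push_cast; ring, hN _ (by omega), map_zero]⟩
  map_add' f g := by
    ext a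
    simp only [add_coe_apply, map_add]
    exact finsum_add_distrib (finite_support_act P f a) (finite_support_act P g a)
  map_smul' b f := by
    ext a
    simp only [smul_coe_apply, map_smul, RingHom.id_apply]
    exact (smul_finsum _ _).symm

theorem act_apply (P : ℕ → Module.End ℂ V) (f : truncSeries V) (a : ℂ) :
    (act P f).1 a = ∑ᶠ i : ℕ, P i (f.1 (a - i)) := rfl

theorem exists_act_apply_eq_sum (f : truncSeries V) (a : ℂ) : ∃ N : ℕ, ∀ B : ℕ, N ≤ B →
    ∀ P : ℕ → Module.End ℂ V, (act P f).1 a = ∑ i ∈ Finset.range B, P i (f.1 (a - i)) := by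
  obtain ⟨N, hN⟩ := f.2 a
  refine ⟨N, fun B hB P => finsum_eq_sum_of_support_subset _ fun i hi => ?_⟩
  by_contra hi'
  rw [Finset.mem_coe, Finset.mem_range, not_lt] at hi'
  exact hi (by simp [hN i (by omega)])

theorem act_add (P Q : ℕ → Module.End ℂ V) (f : truncSeries V) :
    act (fun i => P i + Q i) f = act P f + act Q f := by
  ext a
  exact finsum_add_distrib (finite_support_act P f a) (finite_support_act Q f a)

theorem act_smul (b : ℂ) (P : ℕ → Module.End ℂ V) (f : truncSeries V) :
    act (fun i => b • P i) f = b • act P f := by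
  ext a
  exact (smul_finsum _ _).symm

theorem act_shift (P : ℕ → Module.End ℂ V) (j : ℤ) (f : truncSeries V) :
    act P (shift j f) = shift j (act P f) := by
  ext a
  simp only [act_apply, shift_apply, sub_right_comm]

/-- Coefficientwise application of an operator. -/
def map (T : Module.End ℂ V) : Module.End ℂ (truncSeries V) where
  toFun f := ⟨fun a => T (f.1 a), fun a => by
    obtain ⟨N, hN⟩ := f.2 a
    exact ⟨N, fun n hn => by change T (f.1 (a - n)) = 0; rw [hN n hn, map_zero]⟩⟩
  map_add' f g := by ext a; exact map_add T _ _
  map_smul' b f := by ext a; exact map_smul T _ _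

theorem map_apply (T : Module.End ℂ V) (f : truncSeries V) (a : ℂ) :
    (map T f).1 a = T (f.1 a) := rfl

theorem act_eq_sum_range {P : ℕ → Module.End ℂ V} {N : ℕ} (hP : ∀ i, N ≤ i → P i = 0)
    (f : truncSeries V) : act P f = ∑ i ∈ Finset.range N, shift i (map (P i) f) := by
  ext a
  have h : (∑ i ∈ Finset.range N, shift i (map (P i) f)).1 a =
      ∑ i ∈ Finset.range N, P i (f.1 (a - i)) := by
    rw [← coeff_apply, map_sum]
    rfl
  rw [h, act_apply]
  refine finsum_eq_sum_of_support_subset _ fun i hi => ?_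
  by_contra hi'
  rw [Finset.mem_coe, Finset.mem_range, not_lt] at hi'
  exact hi (by simp only [hP i hi', LinearMap.zero_apply])

theorem map_shift (T : Module.End ℂ V) (j : ℤ) (f : truncSeries V) :
    map T (shift j f) = shift j (map T f) := rfl

theorem map_deriv (T : Module.End ℂ V) (f : truncSeries V) :
    map T (deriv f) = deriv (map T f) := by
  ext a
  exact map_smul T _ _

theorem act_map (P : ℕ → Module.End ℂ V) (T : Module.End ℂ V) (f : truncSeries V) :
    act P (map T f) = act (fun i => P i * T) f := rfl

theorem map_act (T : Module.End ℂ V) (P : ℕ → Module.End ℂ V) (f : truncSeries V) :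
    map T (act P f) = act (fun i => T * P i) f := by
  ext a
  exact map_finsum T (finite_support_act P f a)

theorem act_succ (P : ℕ → Module.End ℂ V) (f : truncSeries V) :
    act P f = map (P 0) f + shift 1 (act (fun i => P (i + 1)) f) := by
  ext a
  obtain ⟨M, hM⟩ := exists_act_apply_eq_sum f a
  obtain ⟨N, hN⟩ := exists_act_apply_eq_sum f (a - 1)
  rw [add_coe_apply, shift_apply, Int.cast_one, hM (M + N + 1) (by omega), hN (M + N) (by omega),
    Finset.sum_range_succ', add_comm, map_apply]
  congr 1
  · simp
  · refine Finset.sum_congr rfl fun i _ => ?_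
    rw [show a - ((i + 1 : ℕ) : ℂ) = a - 1 - i by push_cast; ring]

theorem deriv_act (P : ℕ → Module.End ℂ V) (f : truncSeries V) :
    deriv (act P f) = act P (deriv f) + act (fun i => ((i : ℂ) + 1) • P (i + 1)) f := by
  ext a
  obtain ⟨M, hM⟩ := exists_act_apply_eq_sum f (a + 1)
  obtain ⟨N, hN⟩ := exists_act_apply_eq_sum f a
  obtain ⟨K, hK⟩ := exists_act_apply_eq_sum (deriv f) a
  rw [deriv_apply, add_coe_apply, hM (M + N + K + 1) (by omega), hN (M + N + K) (by omega),
    hK (M + N + K + 1) (by omega), Finset.smul_sum, ← sub_eq_iff_eq_add', ← Finset.sum_sub_distrib,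
    Finset.sum_range_succ']
  rw [show ∀ x y : V, y = 0 → x + y = x from fun x y hy => by rw [hy, add_zero]]
  · refine Finset.sum_congr rfl fun i _ => ?_
    rw [deriv_apply, map_smul, show a - ((i + 1 : ℕ) : ℂ) + 1 = a - i by push_cast; ring,
      show a + 1 - ((i + 1 : ℕ) : ℂ) = a - i by push_cast; ring, ← sub_smul, LinearMap.smul_apply]
    congr 1
    ring
  · rw [deriv_apply, map_smul, Nat.cast_zero, sub_zero, sub_zero, sub_self]

theorem act_act (P Q : ℕ → Module.End ℂ V) (f : truncSeries V) :
    act P (act Q f) =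
      act (fun n => ∑ k ∈ Finset.range (n + 1), P k * Q (n - k)) f := by
  ext a
  obtain ⟨N, hN⟩ := f.2 a
  have h1 : ∀ k : ℕ, (act Q f).1 (a - k) =
      ∑ l ∈ Finset.range (N - k), Q l (f.1 (a - (k + l : ℕ))) := by
    intro k
    have h2 : (act Q f).1 (a - k) = ∑ᶠ l : ℕ, Q l (f.1 (a - (k + l : ℕ))) := by
      rw [act_apply]
      refine finsum_congr fun l => ?_
      rw [Nat.cast_add, sub_sub]
    rw [h2]
    refine finsum_eq_sum_of_support_subset _ fun i hi => ?_
    by_contra hi'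
    rw [Finset.mem_coe, Finset.mem_range, not_lt] at hi'
    refine hi ?_
    change Q i (f.1 (a - (k + i : ℕ))) = 0
    rw [hN _ (by omega), map_zero]
  obtain ⟨M, hM⟩ := exists_act_apply_eq_sum f a
  obtain ⟨K, hK⟩ := exists_act_apply_eq_sum (act Q f) a
  have h3 : ∀ B, N ≤ B → ∀ u : ℕ → V, (∀ i, N ≤ i → u i = 0) →
      ∑ i ∈ Finset.range B, u i = ∑ i ∈ Finset.range N, u i := by
    intro B hB u hu
    refine (Finset.sum_subset (Finset.range_subset_range.mpr hB) fun i _ hi => hu i ?_).symm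
    simpa using hi
  rw [hM (M + N) (by omega), hK (K + N) (by omega), h3 (K + N) (by omega),
    h3 (M + N) (by omega)]
  · simp only [h1, map_sum, LinearMap.sum_apply, Module.End.mul_apply]
    rw [← Finset.sum_range_diag_flip]
    refine Finset.sum_congr rfl fun n _ => Finset.sum_congr rfl fun k hk => ?_
    rw [Finset.mem_range] at hk
    rw [show k + (n - k) = n by omega]
  · intro i hi
    rw [hN i hi, map_zero]
  · intro i hi
    rw [h1, show N - i = 0 by omega, Finset.range_zero, Finset.sum_empty, map_zero]

end truncSeries

/-- The operator `L n`. -/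
def Virasoro.opL {V : Type*} [AddCommGroup V] [Module ℂ V] [LieRingModule Virasoro V]
    [LieModule ℂ Virasoro V] (n : ℤ) : Module.End ℂ V where
  toFun v := ⁅Virasoro.L n, v⁆
  map_add' v w := lie_add _ v w
  map_smul' a v := lie_smul a _ v

/-! ### The operator `exp (z L₋₁)` -/

section Exponential

variable {V : Type*} [AddCommGroup V] [Module ℂ V] [LieRingModule Virasoro V]
  [LieModule ℂ Virasoro V]

namespace Virasoro

theorem opL_apply (n : ℤ) (v : V) : opL n v = ⁅L n, v⁆ := rfl

theorem opL_mul_opL_neg_one (n : ℤ) :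
    (opL n * opL (-1) : Module.End ℂ V) = opL (-1) * opL n + ((n : ℂ) + 1) • opL (n - 1) := by
  ext v
  simp only [Module.End.mul_apply, LinearMap.add_apply, LinearMap.smul_apply, opL_apply]
  rw [leibniz_lie, lie_L_L, add_lie, smul_lie, smul_lie, add_comm]
  have : (if n = -(-1) then ((n : ℂ) ^ 3 - n) / 12 else 0) = 0 := by
    split_ifs with h
    · subst h; norm_num
    · rfl
  rw [this, zero_smul, add_zero, ← sub_eq_add_neg]
  simp

variable (V) in
/-- The divided power `L_{-1} ^ k / k!`. -/
def divPow (k : ℕ) : Module.End ℂ V := ((k.factorial : ℂ)⁻¹) • opL (-1) ^ k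

theorem divPow_zero : divPow V 0 = 1 := by simp [divPow]

theorem succ_smul_divPow_succ (k : ℕ) :
    ((k : ℂ) + 1) • divPow V (k + 1) = divPow V k * opL (-1) := by
  rw [divPow, divPow, smul_smul, Nat.factorial_succ, pow_succ, smul_mul_assoc]
  congr 1
  have : ((k : ℂ) + 1) ≠ 0 := by exact_mod_cast k.succ_ne_zero
  push_cast
  field_simp

theorem succ_smul_divPow_succ' (k : ℕ) :
    ((k : ℂ) + 1) • divPow V (k + 1) = opL (-1) * divPow V k := by
  rw [succ_smul_divPow_succ, divPow, smul_mul_assoc, mul_smul_comm, ← pow_succ, pow_succ']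

theorem sum_range_succ_smul {X : Type*} [AddCommGroup X] [Module ℂ X] (k : ℕ) (u : ℕ → X) :
    ∑ i ∈ Finset.range (k + 1), ((i + 1 : ℕ) : ℂ) • u (i + 1) =
      ∑ i ∈ Finset.range (k + 2), (i : ℂ) • u i := by
  rw [Finset.sum_range_succ' _ (k + 1), Nat.cast_zero, zero_smul, add_zero]

theorem sum_range_sub_smul {X : Type*} [AddCommGroup X] [Module ℂ X] (k : ℕ) (u : ℕ → X) :
    ∑ i ∈ Finset.range (k + 1), ((k + 1 - i : ℂ)) • u i =
      ∑ i ∈ Finset.range (k + 2), ((k + 1 - i : ℂ)) • u i := by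
  rw [Finset.sum_range_succ _ (k + 1), Nat.cast_add, Nat.cast_one, sub_self, zero_smul, add_zero]

theorem opL_mul_divPow (n : ℤ) (k : ℕ) :
    opL n * divPow V k =
      ∑ i ∈ Finset.range (k + 1), intChoose (n + 1) i • (divPow V (k - i) * opL (n - i)) := by
  induction k generalizing n with
  | zero => simp [divPow_zero, intChoose_zero]
  | succ k ih =>
    have hk : ((k : ℂ) + 1) ≠ 0 := by exact_mod_cast k.succ_ne_zero
    rw [← (smul_right_injective _ hk).eq_iff]
    rw [← mul_smul_comm, succ_smul_divPow_succ', ← mul_assoc, opL_mul_opL_neg_one, add_mul,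
      mul_assoc, ih, smul_mul_assoc, ih, Finset.mul_sum, Finset.smul_sum, Finset.smul_sum]
    have h1 : ∀ i ∈ Finset.range (k + 1), opL (-1) * intChoose (n + 1) i •
        (divPow V (k - i) * opL (n - i)) =
        (((k + 1 - i : ℂ)) * intChoose (n + 1) i) • (divPow V (k + 1 - i) * opL (n - i)) := by
      intro i hi
      rw [Finset.mem_range] at hi
      obtain ⟨j, rfl⟩ : ∃ j, k = j + i := ⟨k - i, by omega⟩
      rw [mul_smul_comm, ← mul_assoc, Nat.add_sub_cancel, show j + i + 1 - i = j + 1 by omega,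
        ← succ_smul_divPow_succ', smul_mul_assoc, smul_smul]
      congr 1
      push_cast
      ring
    have h2 : ∀ i ∈ Finset.range (k + 1), ((n : ℂ) + 1) • intChoose (n - 1 + 1) i •
        (divPow V (k - i) * opL (n - 1 - i)) =
        (((i + 1 : ℕ) : ℂ) * intChoose (n + 1) (i + 1)) •
          (divPow V (k + 1 - (i + 1)) * opL (n - (i + 1 : ℕ))) := by
      intro i _
      rw [smul_smul, sub_add_cancel, ← succ_mul_intChoose_succ_succ, Nat.add_sub_add_right]
      push_cast
      rw [sub_sub, add_comm (1 : ℤ)]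
    rw [Finset.sum_congr rfl h1, Finset.sum_congr rfl h2]
    have h5 := sum_range_succ_smul k (fun i => intChoose (n + 1) i •
      (divPow V (k + 1 - i) * opL (n - i)))
    have h6 := sum_range_sub_smul k (fun i => intChoose (n + 1) i •
      (divPow V (k + 1 - i) * opL (n - i)))
    simp only [smul_smul] at h5 h6
    rw [h5, h6, ← Finset.sum_add_distrib]
    refine Finset.sum_congr rfl fun i _ => ?_
    rw [← add_smul, smul_smul]
    congr 1
    ring

theorem divPow_mul_opL (n : ℤ) (k : ℕ) :
    divPow V k * opL n =
      ∑ i ∈ Finset.range (k + 1),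
        ((-1) ^ i * intChoose (n + 1) i) • (opL (n - i) * divPow V (k - i)) := by
  induction k generalizing n with
  | zero => simp [divPow_zero, intChoose_zero]
  | succ k ih =>
    have hk : ((k : ℂ) + 1) ≠ 0 := by exact_mod_cast k.succ_ne_zero
    rw [← (smul_right_injective _ hk).eq_iff]
    have hc : (opL (-1) * opL n : Module.End ℂ V) =
        opL n * opL (-1) - ((n : ℂ) + 1) • opL (n - 1) := by
      rw [opL_mul_opL_neg_one, add_sub_cancel_right]
    rw [← smul_mul_assoc, succ_smul_divPow_succ, mul_assoc, hc, mul_sub,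
      ← mul_assoc, ih, mul_smul_comm, ih, Finset.sum_mul, Finset.smul_sum, Finset.smul_sum,
      sub_eq_add_neg, ← Finset.sum_neg_distrib]
    have h1 : ∀ i ∈ Finset.range (k + 1), ((-1) ^ i * intChoose (n + 1) i) •
        (opL (n - i) * divPow V (k - i)) * opL (-1) =
        (((k + 1 - i : ℂ)) * ((-1) ^ i * intChoose (n + 1) i)) •
          (opL (n - i) * divPow V (k + 1 - i)) := by
      intro i hi
      rw [Finset.mem_range] at hi
      obtain ⟨j, rfl⟩ : ∃ j, k = j + i := ⟨k - i, by omega⟩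
      rw [smul_mul_assoc, mul_assoc, Nat.add_sub_cancel, show j + i + 1 - i = j + 1 by omega,
        ← succ_smul_divPow_succ, mul_smul_comm, smul_smul]
      congr 1
      push_cast
      ring
    have h2 : ∀ i ∈ Finset.range (k + 1), -(((n : ℂ) + 1) • ((-1) ^ i * intChoose (n - 1 + 1) i) •
        (opL (n - 1 - i) * divPow V (k - i))) =
        (((i + 1 : ℕ) : ℂ) * ((-1) ^ (i + 1) * intChoose (n + 1) (i + 1))) •
          (opL (n - (i + 1 : ℕ)) * divPow V (k + 1 - (i + 1))) := by
      intro i _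
      rw [smul_smul, sub_add_cancel, Nat.add_sub_add_right, ← neg_smul]
      push_cast
      rw [sub_sub, add_comm (1 : ℤ), pow_succ]
      congr 1
      linear_combination (-1) ^ i * succ_mul_intChoose_succ_succ n i
    rw [Finset.sum_congr rfl h1, Finset.sum_congr rfl h2]
    have h5 := sum_range_succ_smul k (fun i => ((-1) ^ i * intChoose (n + 1) i) •
      (opL (n - i) * divPow V (k + 1 - i)))
    have h6 := sum_range_sub_smul k (fun i => ((-1) ^ i * intChoose (n + 1) i) •
      (opL (n - i) * divPow V (k + 1 - i)))
    simp only [smul_smul] at h5 h6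
    rw [h5, h6, ← Finset.sum_add_distrib]
    refine Finset.sum_congr rfl fun i _ => ?_
    rw [← add_smul, smul_smul]
    congr 1
    ring

end Virasoro

namespace truncSeries

open Virasoro

variable (V) in
/-- The operator `exp (z L_{-1})`. -/
def expL : Module.End ℂ (truncSeries V) := act (divPow V)

variable (V) in
/-- The operator `∑ i ≥ 0, (-1) ^ i binom(n + 1, i) z ^ i L_{n - i}`, which occurs in the iterate
formula. -/
def iterL (n : ℤ) : Module.End ℂ (truncSeries V) :=
  act fun i => ((-1) ^ i * intChoose (n + 1) i) • opL (n - i)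

/-- The conjugate of `L n` by `exp(z L₋₁)` is `∑ i ≥ 0, binom(n + 1, i) z ^ i L_{n - i}`. -/
theorem map_opL_expL (n : ℤ) (f : truncSeries V) :
    map (opL n) (expL V f) = expL V (act (fun i => intChoose (n + 1) i • opL (n - i)) f) := by
  rw [expL, map_act, act_act]
  congr 2
  funext k
  rw [opL_mul_divPow, ← Finset.sum_range_reflect]
  refine Finset.sum_congr rfl fun i hi => ?_
  rw [Finset.mem_range] at hi
  rw [show k + 1 - 1 - i = k - i by omega, show k - (k - i) = i by omega, mul_smul_comm]

theorem expL_map_opL (n : ℤ) (f : truncSeries V) :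
    expL V (map (opL n) f) = iterL V n (expL V f) := by
  rw [expL, iterL, act_map, act_act]
  congr 2
  funext k
  rw [divPow_mul_opL]
  refine Finset.sum_congr rfl fun i hi => ?_
  rw [smul_mul_assoc]

theorem deriv_expL (f : truncSeries V) :
    deriv (expL V f) = expL V (deriv f) + expL V (map (opL (-1)) f) := by
  rw [expL, deriv_act, act_map]
  simp only [succ_smul_divPow_succ]

theorem expL_shift (j : ℤ) (f : truncSeries V) : expL V (shift j f) = shift j (expL V f) :=
  act_shift _ _ _

/-- The operator `L n - (y ^ {n + 1} d / dy + (n + 1) h y ^ n)` with `y = -z`: the sum of the action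
of `L n` on the coefficients and of the action of the vector field `-y ^ {n + 1} d / dy` on
densities of weight `h`. By `homL_expL_natCast` it becomes the commutator action after
conjugation with `exp(z L₋₁)`. -/
def densityL (h : ℂ) (n : ℤ) : Module.End ℂ (truncSeries V) :=
  map (opL n) - ((-1 : ℂ) ^ n) • (shift (n + 1) * deriv + (((n : ℂ) + 1) * h) • shift n)

theorem densityL_apply (h : ℂ) (n : ℤ) (f : truncSeries V) :
    densityL h n f = map (opL n) f -
      ((-1 : ℂ) ^ n) • (shift (n + 1) (deriv f) + (((n : ℂ) + 1) * h) • shift n f) := rfl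

theorem densityL_coe_apply (h : ℂ) (n : ℤ) (f : truncSeries V) (a : ℂ) :
    (densityL h n f).1 a =
      ⁅L n, f.1 a⁆ - ((-1 : ℂ) ^ n * (a - n + (n + 1) * h)) • f.1 (a - n) := by
  rw [densityL_apply, sub_coe_apply, smul_coe_apply, add_coe_apply, shift_apply, deriv_apply,
    smul_coe_apply, shift_apply, map_apply, opL_apply, mul_smul, add_smul]
  push_cast
  rw [show a - (n + 1) + 1 = a - n by ring]
  module

theorem densityL_densityL {c : ℂ} (hC : ∀ v : V, ⁅C, v⁆ = c • v) (h : ℂ) (m n : ℤ)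
    (f : truncSeries V) :
    densityL h m (densityL h n f) = densityL h n (densityL h m f) +
      ((m : ℂ) - n) • densityL h (m + n) f +
      (if m = -n then ((m : ℂ) ^ 3 - m) / 12 else 0) • c • f := by
  ext a
  simp only [add_coe_apply, smul_coe_apply, densityL_coe_apply, lie_sub, lie_smul]
  rw [lie_L_lie_L hC m n (f.1 a), zpow_add₀ (by norm_num : (-1 : ℂ) ≠ 0)]
  push_cast
  rw [show a - (n : ℂ) - m = a - m - n by ring, show a - ((m : ℂ) + n) = a - m - n by ring]
  generalize (-1 : ℂ) ^ m = x
  generalize (-1 : ℂ) ^ n = y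
  module

end truncSeries

end Exponential

/-! ### The lowest weight series -/

section LowestSeries

open Virasoro

/-- The indicial polynomial `t x (x - 1) + x - h` of the differential equation
`t ∂² f = (L₋₂ - z⁻¹ ∂ + h z⁻²) f - t L₋₁² f - 2 t L₋₁ ∂ f`, which expresses that
`densityL h (-1) ^ 2 - t⁻¹ densityL h (-2)` annihilates `f`. -/
def indicial (t h x : ℂ) : ℂ := t * x * (x - 1) + x - h

variable {V : Type*} [AddCommGroup V] [Module ℂ V]

open Classical in
/-- The series `∑ n ≥ 0, u n z ^ (Δ + n)`. The index `n` is unique when it exists, so the choice is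
harmless. -/
def seriesOfSeq (Δ : ℂ) (u : ℕ → V) : truncSeries V :=
  ⟨fun a => if h : ∃ n : ℕ, a = Δ + n then u h.choose else 0, fun a => by
    by_cases ha : ∃ k : ℤ, a = Δ + k
    · obtain ⟨k, rfl⟩ := ha
      refine ⟨k.natAbs + 1, fun n hn => dif_neg ?_⟩
      rintro ⟨m, hm⟩
      have h1 : ((k - n - m : ℤ) : ℂ) = 0 := by
        push_cast
        linear_combination hm
      have h2 : k - n - m = 0 := by exact_mod_cast h1
      omega
    · refine ⟨0, fun n _ => dif_neg ?_⟩
      rintro ⟨m, hm⟩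
      exact ha ⟨n + m, by push_cast; linear_combination hm⟩⟩

theorem seriesOfSeq_add_natCast (Δ : ℂ) (u : ℕ → V) (n : ℕ) :
    (seriesOfSeq Δ u).1 (Δ + n) = u n := by
  have h : ∃ m : ℕ, Δ + n = Δ + m := ⟨n, rfl⟩
  have h1 : (seriesOfSeq Δ u).1 (Δ + n) = u h.choose := dif_pos h
  have h2 : h.choose = n := by
    have := h.choose_spec
    exact_mod_cast (add_left_cancel this).symm
  rw [h1, h2]

theorem seriesOfSeq_of_ne (Δ : ℂ) (u : ℕ → V) {a : ℂ} (h : ∀ n : ℕ, a ≠ Δ + n) :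
    (seriesOfSeq Δ u).1 a = 0 := dif_neg (by simpa using h)

theorem sub_natCast_succ_ne (Δ : ℂ) (k : ℕ) (n : ℕ) : Δ - (k + 1) ≠ Δ + n := by
  intro h
  have h1 : ((n + k + 1 : ℕ) : ℂ) = 0 := by
    push_cast
    linear_combination -h
  exact absurd (Nat.cast_eq_zero.mp h1) (by omega)

variable [LieRingModule Virasoro V]

/-- The coefficients of the solution `∑ n ≥ 0, f n z ^ (Δ + n)`, with `f 0 = v`, of the differential
equation with indicial polynomial `indicial t h`. -/
def lowestSeq (t h Δ : ℂ) (v : V) : ℕ → V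
  | 0 => v
  | 1 => (indicial t h (Δ + 1))⁻¹ • (-(2 * t * Δ) • ⁅L (-1), v⁆)
  | n + 2 => (indicial t h (Δ + (n + 2 : ℕ)))⁻¹ • (⁅L (-2), lowestSeq t h Δ v n⁆ -
      t • ⁅L (-1), ⁅L (-1), lowestSeq t h Δ v n⁆⁆ -
      (2 * t * (Δ + (n + 1 : ℕ))) • ⁅L (-1), lowestSeq t h Δ v (n + 1)⁆)

variable {t h Δ : ℂ}

/-- The recursion holds at every exponent `a`, including `a = Δ`, where both sides vanish. -/
theorem indicial_smul_lowestSeries (h0 : indicial t h Δ = 0)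
    (hne : ∀ n : ℕ, 1 ≤ n → indicial t h (Δ + n) ≠ 0) (v : V) (a : ℂ) :
    indicial t h a • (seriesOfSeq Δ (lowestSeq t h Δ v)).1 a =
      ⁅L (-2), (seriesOfSeq Δ (lowestSeq t h Δ v)).1 (a - 2)⁆ -
      t • ⁅L (-1), ⁅L (-1), (seriesOfSeq Δ (lowestSeq t h Δ v)).1 (a - 2)⁆⁆ -
      (2 * t * (a - 1)) • ⁅L (-1), (seriesOfSeq Δ (lowestSeq t h Δ v)).1 (a - 1)⁆ := by
  set u := lowestSeq t h Δ v with hu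
  by_cases ha : ∃ n : ℕ, a = Δ + n
  · obtain ⟨n, rfl⟩ := ha
    match n with
    | 0 =>
      have h1 := seriesOfSeq_of_ne Δ u (a := Δ + (0 : ℕ) - 1) fun n => by
        simpa using sub_natCast_succ_ne Δ 0 n
      have h2 := seriesOfSeq_of_ne Δ u (a := Δ + (0 : ℕ) - 2) fun n => by
        have := sub_natCast_succ_ne Δ 1 n
        norm_num at this ⊢
        exact this
      rw [h1, h2, Nat.cast_zero, add_zero, h0]
      simp
    | 1 =>
      have h2 := seriesOfSeq_of_ne Δ u (a := Δ + (1 : ℕ) - 2) fun n => by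
        rw [show Δ + ((1 : ℕ) : ℂ) - 2 = Δ - ((0 : ℕ) + 1) by push_cast; ring]
        exact sub_natCast_succ_ne Δ 0 n
      have h1 : (seriesOfSeq Δ u).1 (Δ + (1 : ℕ) - 1) = v := by
        have := seriesOfSeq_add_natCast Δ u 0
        rw [Nat.cast_zero, add_zero] at this
        rw [Nat.cast_one, add_sub_cancel_right, this, hu, lowestSeq]
      have h3 := hne 1 le_rfl
      rw [h1, h2, seriesOfSeq_add_natCast, hu, lowestSeq]
      rw [Nat.cast_one] at h3 ⊢
      rw [smul_inv_smul₀ h3]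
      simp
    | n + 2 =>
      have h1 : Δ + ((n + 2 : ℕ) : ℂ) - 1 = Δ + (n + 1 : ℕ) := by push_cast; ring
      have h2 : Δ + ((n + 2 : ℕ) : ℂ) - 2 = Δ + n := by push_cast; ring
      rw [h1, h2, seriesOfSeq_add_natCast, seriesOfSeq_add_natCast, seriesOfSeq_add_natCast]
      conv_lhs => rw [hu, lowestSeq]
      rw [smul_inv_smul₀ (hne _ (by omega))]
  · have ha' : ∀ n : ℕ, a ≠ Δ + n := by simpa using ha
    rw [seriesOfSeq_of_ne Δ u ha',
      seriesOfSeq_of_ne Δ u (a := a - 1) fun n hn => ha' (n + 1) (by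
        push_cast; linear_combination hn),
      seriesOfSeq_of_ne Δ u (a := a - 2) fun n hn => ha' (n + 2) (by
        push_cast; linear_combination hn)]
    simp

variable [LieModule ℂ Virasoro V]

/-- The series with coefficients `lowestSeq` is a vector of lowest weight `k` for the operators
`densityL h n`. The induction on the exponent applies `L n` to the recursion; it closes because `k`
and `c` are the weight `h_{1,2}` and the central charge for the parameter `t`. -/
theorem lie_lowestSeries {k c : ℂ} (hC : ∀ v : V, ⁅C, v⁆ = c • v)
    (ht : t ≠ 0) (hk : 4 * t * k = 3 - 2 * t) (hc : t * c = 13 * t - 6 * t ^ 2 - 6)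
    (h0 : indicial t h Δ = 0) (hne : ∀ n : ℕ, 1 ≤ n → indicial t h (Δ + n) ≠ 0) {v : V}
    (hv0 : ⁅L 0, v⁆ = (Δ + h + k) • v) (hv : ∀ n : ℤ, 0 < n → ⁅L n, v⁆ = 0) (a : ℂ) :
    ⁅L 0, (seriesOfSeq Δ (lowestSeq t h Δ v)).1 a⁆ =
      (a + h + k) • (seriesOfSeq Δ (lowestSeq t h Δ v)).1 a ∧
    ⁅L 1, (seriesOfSeq Δ (lowestSeq t h Δ v)).1 a⁆ =
      (-(a - 1 + 2 * h)) • (seriesOfSeq Δ (lowestSeq t h Δ v)).1 (a - 1) ∧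
    ⁅L 2, (seriesOfSeq Δ (lowestSeq t h Δ v)).1 a⁆ =
      (a - 2 + 3 * h) • (seriesOfSeq Δ (lowestSeq t h Δ v)).1 (a - 2) := by
  have hrec := indicial_smul_lowestSeries (V := V) h0 hne v
  set f := (seriesOfSeq Δ (lowestSeq t h Δ v)).1 with hf
  have hfΔ : f Δ = v := by
    have := seriesOfSeq_add_natCast Δ (lowestSeq t h Δ v) 0
    rwa [Nat.cast_zero, add_zero] at this
  have hout : ∀ a, (∀ n : ℕ, a ≠ Δ + n) → f a = 0 := fun a ha => seriesOfSeq_of_ne Δ _ ha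
  have hout' : ∀ a, (∀ n : ℕ, a ≠ Δ + n) → ⁅L 0, f a⁆ = (a + h + k) • f a ∧
      ⁅L 1, f a⁆ = (-(a - 1 + 2 * h)) • f (a - 1) ∧ ⁅L 2, f a⁆ = (a - 2 + 3 * h) • f (a - 2) := by
    intro a ha
    rw [hout a ha, hout (a - 1) fun n hn => ha (n + 1) (by push_cast; linear_combination hn),
      hout (a - 2) fun n hn => ha (n + 2) (by push_cast; linear_combination hn)]
    simp
  by_cases ha : ∃ n : ℕ, a = Δ + n
  swap
  · exact hout' a (by simpa using ha)
  obtain ⟨n, rfl⟩ := ha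
  induction n using Nat.strong_induction_on with
  | _ n ih =>
    have hm1 : ∀ m : ℕ, Δ - 1 ≠ Δ + m := fun m => by simpa using sub_natCast_succ_ne Δ 0 m
    have hm2 : ∀ m : ℕ, Δ - 2 ≠ Δ + m := fun m => by
      have := sub_natCast_succ_ne Δ 1 m
      norm_num at this ⊢
      exact this
    rcases Nat.eq_zero_or_pos n with rfl | hn
    · rw [Nat.cast_zero, add_zero, hout _ hm1, hout _ hm2, hfΔ, hv0, hv 1 one_pos, hv 2 two_pos]
      simp
    have ih1 := ih (n - 1) (by omega)
    rw [Nat.cast_sub hn, Nat.cast_one, ← add_sub_assoc] at ih1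
    have ih2 : ⁅L 0, f (Δ + n - 2)⁆ = (Δ + n - 2 + h + k) • f (Δ + n - 2) ∧
        ⁅L 1, f (Δ + n - 2)⁆ = (-(Δ + n - 2 - 1 + 2 * h)) • f (Δ + n - 2 - 1) ∧
        ⁅L 2, f (Δ + n - 2)⁆ = (Δ + n - 2 - 2 + 3 * h) • f (Δ + n - 2 - 2) := by
      rcases Nat.lt_or_ge n 2 with h2 | h2
      · obtain rfl : n = 1 := by omega
        rw [show Δ + ((1 : ℕ) : ℂ) - 2 = Δ - 1 by push_cast; ring]
        exact hout' _ hm1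
      · have := ih (n - 2) (by omega)
        rwa [Nat.cast_sub h2, Nat.cast_ofNat, ← add_sub_assoc] at this
    have hp := hne n hn
    generalize Δ + (n : ℂ) = a at *
    obtain ⟨h10, h11, h12⟩ := ih1
    obtain ⟨h20, h21, h22⟩ := ih2
    have ra := hrec a
    have rb := hrec (a - 1)
    have rc := hrec (a - 2)
    rw [show a - 1 - 1 = a - 2 by ring, show a - 1 - 2 = a - 3 by ring] at *
    rw [show a - 2 - 1 = a - 3 by ring, show a - 2 - 2 = a - 4 by ring] at *
    -- `L n` is moved past `L₋₁` and `L₋₂`, and the induction hypotheses are inserted; what remains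
    -- is a multiple of the recursion at the exponent `a`, `a - 1` or `a - 2`.
    have key : ∀ n : ℤ, indicial t h a • ⁅L n, f a⁆ =
        ⁅L n, ⁅L (-2), f (a - 2)⁆⁆ - t • ⁅L n, ⁅L (-1), ⁅L (-1), f (a - 2)⁆⁆⁆ -
          (2 * t * (a - 1)) • ⁅L n, ⁅L (-1), f (a - 1)⁆⁆ := by
      intro n
      rw [← lie_smul, ra, lie_sub, lie_sub, lie_smul, lie_smul]
    have e02 : ∀ y : V, ⁅L 0, ⁅L (-2), y⁆⁆ = ⁅L (-2), ⁅L 0, y⁆⁆ + (2 : ℂ) • ⁅L (-2), y⁆ :=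
      fun y => by rw [lie_L_lie_L hC]; norm_num
    have e01 : ∀ y : V, ⁅L 0, ⁅L (-1), y⁆⁆ = ⁅L (-1), ⁅L 0, y⁆⁆ + ⁅L (-1), y⁆ :=
      fun y => by rw [lie_L_lie_L hC]; norm_num
    have e12 : ∀ y : V, ⁅L 1, ⁅L (-2), y⁆⁆ = ⁅L (-2), ⁅L 1, y⁆⁆ + (3 : ℂ) • ⁅L (-1), y⁆ :=
      fun y => by rw [lie_L_lie_L hC]; norm_num
    have e11 : ∀ y : V, ⁅L 1, ⁅L (-1), y⁆⁆ = ⁅L (-1), ⁅L 1, y⁆⁆ + (2 : ℂ) • ⁅L 0, y⁆ :=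
      fun y => by rw [lie_L_lie_L hC]; norm_num
    have e22 : ∀ y : V, ⁅L 2, ⁅L (-2), y⁆⁆ =
        ⁅L (-2), ⁅L 2, y⁆⁆ + (4 : ℂ) • ⁅L 0, y⁆ + (2⁻¹ : ℂ) • c • y :=
      fun y => by rw [lie_L_lie_L hC]; norm_num
    have e21 : ∀ y : V, ⁅L 2, ⁅L (-1), y⁆⁆ = ⁅L (-1), ⁅L 2, y⁆⁆ + (3 : ℂ) • ⁅L 1, y⁆ :=
      fun y => by rw [lie_L_lie_L hC]; norm_num
    refine ⟨?_, ?_, ?_⟩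
    · rw [← (smul_right_injective _ hp).eq_iff, key]
      simp only [e02, e01, h10, h20, lie_add, lie_smul]
      linear_combination (norm := module) (-(a + h + k)) • ra
    · rw [← (smul_right_injective _ hp).eq_iff, key]
      simp only [e12, e11, e01, h10, h20, h11, h21, lie_add, lie_smul]
      linear_combination (norm := skip) (a - 3 + 2 * h) • rb
      simp only [indicial]
      match_scalars
      all_goals first | ring1 | linear_combination -hk | linear_combination (1 - a) * hk
    · rw [← (smul_right_injective _ hp).eq_iff, key]
      simp only [e22, e21, e11, h20, h11, h21, h12, h22, lie_add, lie_smul]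
      linear_combination (norm := skip) (-(a - 4 + 3 * h)) • rc
      simp only [indicial]
      match_scalars
      all_goals first | ring1 | skip
      refine mul_left_cancel₀ ht ?_
      linear_combination (1 - 3 * t / 2) * hk + hc / 2

end LowestSeries

/-! ### The action of the Virasoro algebra on series-valued maps -/

section TaylorAction

open Virasoro truncSeries

/-- The bracket relation `[x ^ {m + 1} d/dx, x ^ {n + 1} d/dx] = (n - m) x ^ {m + n + 1} d/dx` for
the Taylor coefficients at `x = z`. -/
theorem sum_range_mul_intChoose_mul_intChoose (m n : ℤ) (k : ℕ) :
    ∑ i ∈ Finset.range (k + 2), ((((k + 1 - i : ℕ) : ℂ)) - i) *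
      (intChoose (m + 1) i * intChoose (n + 1) (k + 1 - i)) =
    ((n : ℂ) - m) * intChoose (m + n + 1) k := by
  have h1 : ∑ i ∈ Finset.range (k + 2), ((k + 1 - i : ℕ) : ℂ) *
      (intChoose (m + 1) i * intChoose (n + 1) (k + 1 - i)) =
      ((n : ℂ) + 1) * intChoose (m + n + 1) k := by
    rw [Finset.sum_range_succ, Nat.sub_self, Nat.cast_zero, zero_mul, add_zero,
      show m + n + 1 = (m + 1) + n by ring, intChoose_add, Finset.mul_sum]
    refine Finset.sum_congr rfl fun i hi => ?_
    rw [Finset.mem_range] at hi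
    rw [show k + 1 - i = (k - i) + 1 by omega, Nat.cast_succ]
    linear_combination intChoose (m + 1) i * succ_mul_intChoose_succ_succ n (k - i)
  have h2 : ∑ i ∈ Finset.range (k + 2), (i : ℂ) *
      (intChoose (m + 1) i * intChoose (n + 1) (k + 1 - i)) =
      ((m : ℂ) + 1) * intChoose (m + n + 1) k := by
    rw [Finset.sum_range_succ', Nat.cast_zero, zero_mul, add_zero,
      show m + n + 1 = m + (n + 1) by ring, intChoose_add, Finset.mul_sum]
    refine Finset.sum_congr rfl fun i hi => ?_
    rw [Nat.add_sub_add_right, Nat.cast_succ]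
    linear_combination intChoose (n + 1) (k - i) * succ_mul_intChoose_succ_succ m i
  simp only [sub_mul, Finset.sum_sub_distrib]
  rw [h1, h2]
  ring

theorem sum_range_sum_range_eq_diag {X : Type*} [AddCommMonoid X] (B : ℕ) (u : ℕ → ℕ → X)
    (hu : ∀ i j, B ≤ i + j → u i j = 0) :
    ∑ i ∈ Finset.range B, ∑ j ∈ Finset.range B, u i j =
      ∑ s ∈ Finset.range B, ∑ i ∈ Finset.range (s + 1), u i (s - i) := by
  rw [Finset.sum_range_diag_flip]
  refine Finset.sum_congr rfl fun i _ => ?_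
  refine (Finset.sum_subset (Finset.range_subset_range.mpr (Nat.sub_le B i)) fun j _ hj => ?_).symm
  exact hu i j (by rw [Finset.mem_range] at hj; omega)

variable {V W : Type*} [AddCommGroup V] [Module ℂ V] [AddCommGroup W] [Module ℂ W]
  [LieRingModule Virasoro W] [LieModule ℂ Virasoro W] [IsSmoothModule W]

/-- The map `w ↦ ∑ i ≥ 0, binom(n + 1, i) z ^ {n + 1 - i} g (L_{i - 1} w)`, the correction term in
the commutator formula. -/
def taylorSum (n : ℤ) (g : W →ₗ[ℂ] truncSeries V) : W →ₗ[ℂ] truncSeries V :=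
  smoothSum (-1) fun i => intChoose (n + 1) i • (shift (n + 1 - i) ∘ₗ g)

theorem exists_taylorSum_eq_sum (w : W) : ∃ N : ℕ, ∀ B : ℕ, N ≤ B →
    ∀ (n : ℤ) (g : W →ₗ[ℂ] truncSeries V), taylorSum n g w =
      ∑ i ∈ Finset.range B, intChoose (n + 1) i • shift (n + 1 - i) (g ⁅L (-1 + i), w⁆) := by
  obtain ⟨N, hN⟩ := exists_smoothSum_eq_sum (X := truncSeries V) (-1) w
  exact ⟨N, fun B hB n g => hN B hB _⟩

theorem taylorSum_natCast (N : ℕ) (g : W →ₗ[ℂ] truncSeries V) (w : W) :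
    taylorSum (N - 1) g w = ∑ i ∈ Finset.range (N + 1),
      (N.choose i : ℂ) • shift (N - i) (g ⁅L (-1 + i), w⁆) := by
  refine (finsum_eq_sum_of_support_subset (s := Finset.range (N + 1)) _ fun i hi => ?_).trans
    (Finset.sum_congr rfl fun i _ => ?_)
  · by_contra hi'
    rw [Finset.mem_coe, Finset.mem_range, not_lt] at hi'
    refine hi ?_
    simp only
    rw [sub_add_cancel, intChoose_natCast, Nat.choose_eq_zero_of_lt (by omega), Nat.cast_zero,
      zero_smul, LinearMap.zero_apply]
  · simp only
    rw [sub_add_cancel, intChoose_natCast]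
    rfl

theorem taylorSum_add (n : ℤ) (g g' : W →ₗ[ℂ] truncSeries V) :
    taylorSum n (g + g') = taylorSum n g + taylorSum n g' := by
  ext1 w
  rw [LinearMap.add_apply, taylorSum, taylorSum, taylorSum, ← smoothSum_add]
  simp only [LinearMap.comp_add, smul_add]

theorem taylorSum_smul (n : ℤ) (a : ℂ) (g : W →ₗ[ℂ] truncSeries V) :
    taylorSum n (a • g) = a • taylorSum n g := by
  ext1 w
  rw [LinearMap.smul_apply, taylorSum, taylorSum, ← smoothSum_smul]
  simp only [LinearMap.comp_smul, smul_comm a]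

theorem taylorSum_sub (n : ℤ) (g g' : W →ₗ[ℂ] truncSeries V) :
    taylorSum n (g - g') = taylorSum n g - taylorSum n g' := by
  have h : g - g' = g + (-1 : ℂ) • g' := by
    ext1 w
    simp only [LinearMap.sub_apply, LinearMap.add_apply, LinearMap.smul_apply]
    module
  rw [h, taylorSum_add, taylorSum_smul]
  ext1 w
  simp only [LinearMap.sub_apply, LinearMap.add_apply, LinearMap.smul_apply]
  module

theorem map_taylorSum (T : Module.End ℂ V) (n : ℤ) (g : W →ₗ[ℂ] truncSeries V) (w : W) :
    map T (taylorSum n g w) = taylorSum n (map T ∘ₗ g) w := by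
  rw [taylorSum, taylorSum, map_smoothSum]
  congr 2
  funext i
  ext1 w
  simp only [LinearMap.comp_apply, LinearMap.smul_apply, map_smul, map_shift]

/-- The operators `taylorSum n` satisfy the relations of the vector fields `x ^ {n + 1} d/dx`. The
central term vanishes because `m ^ 3 - m = 0` for `m = -1, 0, 1`, the only modes `≥ -1` with
opposite mode `≥ -1`. -/
theorem taylorSum_taylorSum {c : ℂ} (hC : ∀ w : W, ⁅C, w⁆ = c • w) (m n : ℤ)
    (g : W →ₗ[ℂ] truncSeries V) (w : W) :
    taylorSum m (taylorSum n g) w =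
      taylorSum n (taylorSum m g) w + ((n : ℂ) - m) • taylorSum (m + n) g w := by
  obtain ⟨N, hN⟩ := IsSmoothModule.exists_lie_eq_zero w
  set B := N + 5 with hB
  have hsum : ∀ (n : ℤ) (g : W →ₗ[ℂ] truncSeries V) (w' : W),
      (∀ k : ℤ, (B : ℤ) - 1 ≤ k → ⁅L k, w'⁆ = 0) → taylorSum n g w' =
      ∑ i ∈ Finset.range B, intChoose (n + 1) i • shift (n + 1 - i) (g ⁅L (-1 + i), w'⁆) := by
    intro n g w' hw'
    refine finsum_eq_sum_of_support_subset _ fun i hi => ?_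
    by_contra hi'
    rw [Finset.mem_coe, Finset.mem_range, not_lt] at hi'
    exact hi (by simp [hw' (-1 + i) (by omega)])
  have hlie : ∀ j : ℕ, ∀ k : ℤ, (B : ℤ) - 1 ≤ k → ⁅L k, ⁅L (-1 + j), w⁆⁆ = 0 := by
    intro j k hk
    rw [lie_L_lie_L hC, hN k (by omega), hN (k + (-1 + j)) (by omega), if_neg (by omega)]
    simp
  have hexp : ∀ m n : ℤ, taylorSum m (taylorSum n g) w = ∑ i ∈ Finset.range B,
      ∑ j ∈ Finset.range B, (intChoose (m + 1) i * intChoose (n + 1) j) •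
        shift (m + n + 2 - i - j) (g ⁅L (-1 + j), ⁅L (-1 + i), w⁆⁆) := by
    intro m n
    rw [hsum m _ w fun k hk => hN k (by omega)]
    refine Finset.sum_congr rfl fun i _ => ?_
    rw [hsum n g _ (hlie i), map_sum, Finset.smul_sum]
    refine Finset.sum_congr rfl fun j _ => ?_
    rw [map_smul, shift_shift, smul_smul,
      show m + 1 - (i : ℤ) + (n + 1 - j) = m + n + 2 - i - j by ring]
  rw [hexp m n, hexp n m, Finset.sum_comm (s := Finset.range B) (t := Finset.range B)
    (f := fun i j => (intChoose (n + 1) i * intChoose (m + 1) j) •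
        shift (n + m + 2 - i - j) (g ⁅L (-1 + j), ⁅L (-1 + i), w⁆⁆)), ← sub_eq_iff_eq_add',
    ← Finset.sum_sub_distrib]
  simp only [← Finset.sum_sub_distrib]
  have hterm : ∀ i j : ℕ, (intChoose (m + 1) i * intChoose (n + 1) j) •
        shift (m + n + 2 - i - j) (g ⁅L (-1 + j), ⁅L (-1 + i), w⁆⁆) -
      (intChoose (n + 1) j * intChoose (m + 1) i) •
        shift (n + m + 2 - j - i) (g ⁅L (-1 + i), ⁅L (-1 + j), w⁆⁆) =
      (((j : ℂ) - i) * (intChoose (m + 1) i * intChoose (n + 1) j)) •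
        shift (m + n + 2 - ((i + j : ℕ) : ℤ)) (g ⁅L (-2 + ((i + j : ℕ) : ℤ)), w⁆) := by
    intro i j
    rw [lie_L_lie_L hC (-1 + j) (-1 + i)]
    have h0 : (if (-1 + j : ℤ) = -(-1 + i) then
        (((-1 + j : ℤ) : ℂ) ^ 3 - ((-1 + j : ℤ) : ℂ)) / 12 else 0) = 0 := by
      split_ifs with h
      · have : j = 0 ∨ j = 1 ∨ j = 2 := by omega
        rcases this with rfl | rfl | rfl <;> norm_num
      · rfl
    rw [h0, zero_smul, add_zero, map_add, map_smul, map_add, map_smul,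
      show m + n + 2 - (i : ℤ) - j = m + n + 2 - ((i + j : ℕ) : ℤ) by push_cast; ring,
      show n + m + 2 - (j : ℤ) - i = m + n + 2 - ((i + j : ℕ) : ℤ) by push_cast; ring,
      show (-1 + j : ℤ) + (-1 + i) = -2 + ((i + j : ℕ) : ℤ) by push_cast; ring,
      mul_comm (intChoose (n + 1) j)]
    push_cast
    module
  simp only [hterm]
  rw [sum_range_sum_range_eq_diag]
  swap
  · intro i j hij
    rw [hN _ (by omega)]
    simp
  have hB' : B = (B - 1) + 1 := by omega
  have hlast : taylorSum (m + n) g w = ∑ i ∈ Finset.range (B - 1), intChoose (m + n + 1) i •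
      shift (m + n + 1 - i) (g ⁅L (-1 + i), w⁆) := by
    refine finsum_eq_sum_of_support_subset _ fun i hi => ?_
    by_contra hi'
    rw [Finset.mem_coe, Finset.mem_range, not_lt] at hi'
    exact hi (by simp [hN (-1 + i) (by omega)])
  rw [hlast, hB', Finset.sum_range_succ', Finset.smul_sum, ← hB']
  rw [Finset.sum_range_one]
  simp only [Nat.sub_self, sub_self, zero_mul, zero_smul, add_zero]
  refine Finset.sum_congr rfl fun k _ => ?_
  rw [smul_smul, ← sum_range_mul_intChoose_mul_intChoose, Finset.sum_smul]
  refine Finset.sum_congr rfl fun i hi => ?_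
  rw [Finset.mem_range] at hi
  rw [show i + (k + 1 - i) = k + 1 by omega,
    show m + n + 2 - ((k + 1 : ℕ) : ℤ) = m + n + 1 - k by push_cast; ring,
    show -2 + ((k + 1 : ℕ) : ℤ) = -1 + k by push_cast; ring]

variable [LieRingModule Virasoro V] [LieModule ℂ Virasoro V]

/-- The action of `L n` on linear maps from a smooth module to series, for which the fixed maps
satisfy the commutator formula. -/
def homL (n : ℤ) : Module.End ℂ (W →ₗ[ℂ] truncSeries V) where
  toFun g := map (opL n) ∘ₗ g - taylorSum n g
  map_add' g g' := by rw [taylorSum_add, LinearMap.comp_add]; abel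
  map_smul' a g := by
    ext1 w
    simp only [taylorSum_smul, LinearMap.comp_smul, RingHom.id_apply, LinearMap.sub_apply,
      LinearMap.smul_apply, smul_sub]

theorem homL_apply (n : ℤ) (g : W →ₗ[ℂ] truncSeries V) (w : W) :
    homL n g w = map (opL n) (g w) - taylorSum n g w := rfl

theorem map_opL_map_opL {c : ℂ} (hC : ∀ v : V, ⁅C, v⁆ = c • v) (m n : ℤ) (f : truncSeries V) :
    map (opL m) (map (opL n) f) = map (opL n) (map (opL m) f) +
      ((m : ℂ) - n) • map (opL (m + n)) f +
      (if m = -n then ((m : ℂ) ^ 3 - m) / 12 else 0) • c • f := by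
  ext a
  exact lie_L_lie_L hC m n (f.1 a)

/-- The operators `homL n` form a representation whose central charge is that of `V`. -/
theorem homL_homL {c d : ℂ} (hC : ∀ v : V, ⁅C, v⁆ = c • v) (hD : ∀ w : W, ⁅C, w⁆ = d • w)
    (m n : ℤ) (g : W →ₗ[ℂ] truncSeries V) :
    homL m (homL n g) = homL n (homL m g) + ((m : ℂ) - n) • homL (m + n) g +
      (if m = -n then ((m : ℂ) ^ 3 - m) / 12 else 0) • c • g := by
  have h1 : ∀ (m n : ℤ) (w : W), homL m (homL n g) w = map (opL m) (map (opL n) (g w)) -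
      taylorSum n (map (opL m) ∘ₗ g) w - taylorSum m (map (opL n) ∘ₗ g) w +
      taylorSum m (taylorSum n g) w := by
    intro m n w
    rw [homL_apply, homL_apply, map_sub, map_taylorSum]
    have : homL n g = map (opL n) ∘ₗ g - taylorSum n g := rfl
    rw [this, taylorSum_sub, LinearMap.sub_apply]
    abel
  ext1 w
  simp only [LinearMap.add_apply, LinearMap.smul_apply]
  rw [h1, h1, map_opL_map_opL hC, taylorSum_taylorSum hD m n, homL_apply]
  module

end TaylorAction

/-! ### Commuting `L m` past the sums of the iterate formula -/

section Cocycle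

open Virasoro truncSeries

variable {V W X : Type*} [AddCommGroup V] [Module ℂ V] [LieRingModule Virasoro V]
  [LieModule ℂ Virasoro V] [AddCommGroup W] [Module ℂ W] [LieRingModule Virasoro W]
  [LieModule ℂ Virasoro W] [IsSmoothModule W] [AddCommGroup X] [Module ℂ X]

/-- Both the Witt algebra part and the central part of the commutator `[L_{i - 1}, L m]`
contribute. -/
theorem smoothSum_neg_one_lie {c : ℂ} (hC : ∀ w : W, ⁅C, w⁆ = c • w) (T : ℕ → W →ₗ[ℂ] X) (m : ℤ)
    (w : W) :
    smoothSum (-1) T ⁅L m, w⁆ = smoothSum (-1) (fun i => T i ∘ₗ opL m) w +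
      smoothSum (m - 1) (fun i => ((i : ℂ) - 1 - m) • T i) w +
      if m ≤ 1 then (-(((m : ℂ) ^ 3 - m) / 12) * c) • T (1 - m).toNat w else 0 := by
  have hfin : (Function.support fun i : ℕ => (if (-1 + i : ℤ) = -m then
      (((-1 + i : ℤ) : ℂ) ^ 3 - ((-1 + i : ℤ) : ℂ)) / 12 else 0) • c • T i w).Finite := by
    refine (Finset.range (2 + m.natAbs)).finite_toSet.subset fun i hi => ?_
    by_contra hi'
    rw [Finset.mem_coe, Finset.mem_range, not_lt] at hi'
    refine hi ?_
    simp only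
    rw [if_neg (by omega), zero_smul]
  have h1 : (if m ≤ 1 then (-(((m : ℂ) ^ 3 - m) / 12) * c) • T (1 - m).toNat w else 0) =
      ∑ᶠ i : ℕ, (if (-1 + i : ℤ) = -m then
        (((-1 + i : ℤ) : ℂ) ^ 3 - ((-1 + i : ℤ) : ℂ)) / 12 else 0) • c • T i w := by
    split_ifs with hm
    · rw [finsum_eq_single _ (1 - m).toNat fun i hi => by rw [if_neg (by omega), zero_smul],
        if_pos (by omega), show (-1 + ((1 - m).toNat : ℤ)) = -m by omega, smul_smul]
      push_cast
      ring_nf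
    · rw [finsum_eq_zero_of_forall_eq_zero fun i => by rw [if_neg (by omega), zero_smul]]
  have h2 := hasFiniteSupport_smooth (-1) (fun i => T i ∘ₗ opL m) w
  have h3 := hasFiniteSupport_smooth (m - 1) (fun i => ((i : ℂ) - 1 - m) • T i) w
  have h4 := (h2.union h3).subset (Function.support_add _ _)
  rw [h1, smoothSum_apply, smoothSum_apply, smoothSum_apply,
    ← finsum_add_distrib h2 h3, ← finsum_add_distrib h4 hfin]
  refine finsum_congr fun i => ?_
  rw [lie_L_lie_L hC, map_add, map_add, map_smul, map_smul, map_smul, LinearMap.smul_apply,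
    show -1 + (i : ℤ) + m = m - 1 + i by ring]
  push_cast
  rw [show -1 + (i : ℂ) - m = i - 1 - m by ring]
  rfl

theorem act_opL_mul_opL {c : ℂ} (hC : ∀ v : V, ⁅C, v⁆ = c • v) (m : ℤ) (f : truncSeries V) :
    act (fun i => opL (-2 - i) * opL m) f = act (fun i => opL m * opL (-2 - i)) f -
      act (fun i => ((m : ℂ) + 2 + i) • opL (m - 2 - i)) f +
      if 2 ≤ m then (-(((m : ℂ) ^ 3 - m) / 12) * c) • shift (m - 2) f else 0 := by
  have h2 : (if 2 ≤ m then (-(((m : ℂ) ^ 3 - m) / 12) * c) • shift (m - 2) f else 0) =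
      act (fun i => (if (-2 - i : ℤ) = -m then
        (((-2 - i : ℤ) : ℂ) ^ 3 - ((-2 - i : ℤ) : ℂ)) / 12 else 0) • c • 1) f := by
    ext a
    rw [act_apply]
    split_ifs with hm
    · rw [finsum_eq_single _ (m - 2).toNat fun i hi => by
        rw [if_neg (by omega), zero_smul, LinearMap.zero_apply],
        if_pos (by omega), show (-2 - ((m - 2).toNat : ℤ)) = -m by omega, smul_coe_apply,
        shift_apply, LinearMap.smul_apply, LinearMap.smul_apply, Module.End.one_apply, smul_smul]
      have : (((m - 2).toNat : ℕ) : ℂ) = ((m - 2 : ℤ) : ℂ) := by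
        have : (((m - 2).toNat : ℕ) : ℤ) = m - 2 := by omega
        exact_mod_cast congrArg (Int.cast : ℤ → ℂ) this
      rw [this]
      push_cast
      ring_nf
    · rw [finsum_eq_zero_of_forall_eq_zero fun i => by
        rw [if_neg (by omega), zero_smul, LinearMap.zero_apply]]
      rfl
  have h3 : act (fun i => opL m * opL (-2 - i)) f -
      act (fun i => ((m : ℂ) + 2 + i) • opL (m - 2 - i)) f = act (fun i => opL m * opL (-2 - i) +
        (-1 : ℂ) • ((m : ℂ) + 2 + i) • opL (m - 2 - i)) f := by
    rw [act_add, act_smul]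
    module
  rw [h2, h3, ← act_add]
  congr 2
  funext i
  ext v
  simp only [Module.End.mul_apply, LinearMap.add_apply, LinearMap.smul_apply, opL_apply,
    Module.End.one_apply]
  rw [lie_L_lie_L hC, show -2 - (i : ℤ) + m = m - 2 - i by ring]
  push_cast
  module

end Cocycle

/-! ### The derivative property and the iterate formula -/

section Extension

open Virasoro truncSeries

variable {U V W : Type*} [AddCommGroup U] [Module ℂ U] [LieRingModule Virasoro U]
  [LieModule ℂ Virasoro U] [IsSmoothModule U]
  [AddCommGroup V] [Module ℂ V] [LieRingModule Virasoro V] [LieModule ℂ Virasoro V]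
  [AddCommGroup W] [Module ℂ W] [LieRingModule Virasoro W]
  [LieModule ℂ Virasoro W] [IsSmoothModule W] {c : ℂ}

/-- The derivative property passes from `g` to `homL n g`. -/
theorem homL_lie_L_neg_one (hD : ∀ w : W, ⁅C, w⁆ = c • w) (n : ℤ) {g : W →ₗ[ℂ] truncSeries V}
    (hg : ∀ w, g ⁅L (-1), w⁆ = deriv (g w)) (w : W) :
    homL n g ⁅L (-1), w⁆ = deriv (homL n g w) := by
  have h1 : deriv (taylorSum n g w) = smoothSum (-1) (fun i => intChoose (n + 1) i •
      (shift (n + 1 - i) ∘ₗ g) ∘ₗ opL (-1)) w +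
      smoothSum (-1) (fun i => (((n : ℂ) + 1 - i) * intChoose (n + 1) i) •
        (shift (n - i) ∘ₗ g)) w := by
    rw [taylorSum, map_smoothSum, ← smoothSum_add]
    congr 2
    funext i
    ext1 w
    simp only [LinearMap.comp_apply, LinearMap.smul_apply, map_smul, LinearMap.add_apply, opL_apply,
      hg, deriv_shift]
    rw [show n + 1 - (i : ℤ) - 1 = n - i by ring]
    push_cast
    module
  rw [homL_apply, homL_apply, hg, map_deriv, map_sub, h1, taylorSum, smoothSum_neg_one_lie hD]
  congr 1
  have h2 : (if (-1 : ℤ) ≤ 1 then (-((((-1 : ℤ) : ℂ) ^ 3 - ((-1 : ℤ) : ℂ)) / 12) * c) •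
      (intChoose (n + 1) (1 - (-1 : ℤ)).toNat • (shift (n + 1 - ((1 - (-1 : ℤ)).toNat : ℤ)) ∘ₗ g)) w
        else 0) = 0 := by
    norm_num
  rw [h2, add_zero, smoothSum_succ (-1 - 1)]
  simp only [Nat.cast_zero, Int.cast_neg, Int.cast_one]
  rw [show (0 : ℂ) - 1 - -1 = 0 by ring, zero_smul, LinearMap.zero_apply, zero_add]
  congr 3
  funext i
  rw [smul_smul, show n + 1 - ((i + 1 : ℕ) : ℤ) = n - i by push_cast; ring]
  congr 1
  have := succ_mul_intChoose_succ (n + 1) i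
  push_cast at this ⊢
  linear_combination this

variable (Y : U →ₗ[ℂ] W →ₗ[ℂ] truncSeries V)

/-- The right-hand side of the iterate formula for the operator `w ↦ (u ↦ Y u w)`. -/
def iterSum (n : ℤ) (u : U) (w : W) : truncSeries V :=
  iterL V n (Y u w) + (-1 : ℂ) ^ n • smoothSum (-1)
    (fun i => ((-1) ^ i * intChoose (n + 1) i) • (shift (n + 1 - i) ∘ₗ Y.flip w)) u

variable {Y}

theorem iterL_natCast (N : ℕ) (f : truncSeries V) :
    iterL V (N - 1) f = ∑ i ∈ Finset.range (N + 1),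
      ((-1) ^ i * (N.choose i : ℂ)) • shift i (map (opL (N - 1 - i)) f) := by
  rw [iterL, act_eq_sum_range (N := N + 1) fun i hi => ?_]
  · refine Finset.sum_congr rfl fun i _ => ?_
    rw [sub_add_cancel, intChoose_natCast]
    rfl
  · rw [sub_add_cancel, intChoose_natCast, Nat.choose_eq_zero_of_lt (by omega), Nat.cast_zero,
      mul_zero, zero_smul]

/-- Binomial inversion. -/
theorem sum_range_choose_mul_choose (N j : ℕ) (hj : j ≤ N) :
    ∑ i ∈ Finset.range (N + 1), ((-1) ^ i * (N.choose i : ℂ)) * ((N - i).choose j : ℂ) =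
      if j = N then 1 else 0 := by
  have h1 : ∀ i ∈ Finset.range (N + 1), ((-1) ^ i * (N.choose i : ℂ)) * ((N - i).choose j : ℂ) =
      (N.choose j : ℂ) * ((-1) ^ i * ((N - j).choose i : ℂ)) := by
    intro i hi
    rw [Finset.mem_range] at hi
    rcases Nat.lt_or_ge (N - i) j with h | h
    · rw [Nat.choose_eq_zero_of_lt h, Nat.choose_eq_zero_of_lt (show N - j < i by omega)]
      simp
    · have h2 : N.choose i * (N - i).choose j = N.choose j * (N - j).choose i := by
        have h3 := Nat.choose_mul (n := N) (k := i + j) (s := i) (by omega)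
        have h4 := Nat.choose_mul (n := N) (k := i + j) (s := j) (by omega)
        rw [Nat.add_sub_cancel_left] at h3
        rw [Nat.add_sub_cancel_right] at h4
        rw [← h3, ← h4, Nat.choose_symm_add]
      have h3 : (N.choose i : ℂ) * ((N - i).choose j : ℂ) =
        (N.choose j : ℂ) * ((N - j).choose i : ℂ) := by exact_mod_cast h2
      linear_combination (-1) ^ i * h3
  rw [Finset.sum_congr rfl h1, ← Finset.mul_sum]
  have h2 : ∑ i ∈ Finset.range (N + 1), (-1 : ℂ) ^ i * ((N - j).choose i : ℂ) =
      ∑ i ∈ Finset.range (N - j + 1), (-1 : ℂ) ^ i * ((N - j).choose i : ℂ) := by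
    refine (Finset.sum_subset (Finset.range_subset_range.mpr (by omega)) fun i _ hi => ?_).symm
    rw [Finset.mem_range] at hi
    rw [Nat.choose_eq_zero_of_lt (by omega), Nat.cast_zero, mul_zero]
  have h3 := Int.alternating_sum_range_choose (n := N - j)
  have h4 : ∑ i ∈ Finset.range (N - j + 1), (-1 : ℂ) ^ i * ((N - j).choose i : ℂ) =
      if N - j = 0 then 1 else 0 := by
    exact_mod_cast congrArg (Int.cast : ℤ → ℂ) h3
  rw [h2, h4]
  by_cases hjN : j = N
  · subst hjN
    simp
  · rw [if_neg hjN, if_neg (by omega), mul_zero]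

/-- The iterate formula for `n ≥ -1`, where all sums are finite, is the commutator formula solved
for the terms `Y u (L_{N - 1} w)` by binomial inversion. -/
theorem iterate_natCast (hY : ∀ n u, Y ⁅L n, u⁆ = homL n (Y u)) (N : ℕ) (u : U) (w : W) :
    Y u ⁅L (N - 1), w⁆ = iterSum Y (N - 1) u w := by
  have hcomm : ∀ k : ℤ, map (opL k) (Y u w) - Y ⁅L k, u⁆ w = taylorSum k (Y u) w := by
    intro k
    rw [hY, homL_apply, sub_sub_cancel]
  have h1 : smoothSum (-1)
      (fun i => ((-1) ^ i * intChoose ((N : ℤ) - 1 + 1) i) •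
        (shift ((N : ℤ) - 1 + 1 - i) ∘ₗ Y.flip w)) u =
      ∑ i ∈ Finset.range (N + 1), ((-1) ^ i * (N.choose i : ℂ)) •
        shift (N - i) (Y ⁅L (-1 + i), u⁆ w) := by
    refine (finsum_eq_sum_of_support_subset (s := Finset.range (N + 1)) _ fun i hi => ?_).trans
      (Finset.sum_congr rfl fun i _ => ?_)
    · by_contra hi'
      rw [Finset.mem_coe, Finset.mem_range, not_lt] at hi'
      refine hi ?_
      simp only
      rw [sub_add_cancel, intChoose_natCast, Nat.choose_eq_zero_of_lt (by omega), Nat.cast_zero,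
        mul_zero, zero_smul, LinearMap.zero_apply]
    · simp only
      rw [sub_add_cancel, intChoose_natCast]
      rfl
  have h2 : iterSum Y (N - 1) u w = ∑ i ∈ Finset.range (N + 1),
      ((-1) ^ i * (N.choose i : ℂ)) • shift i (taylorSum (N - 1 - i) (Y u) w) := by
    rw [iterSum, h1, iterL_natCast, ← Finset.sum_range_reflect (n := N + 1)
      (f := fun i => ((-1) ^ i * (N.choose i : ℂ)) • shift (N - i) (Y ⁅L (-1 + i), u⁆ w)),
      Finset.smul_sum, ← Finset.sum_add_distrib]
    refine Finset.sum_congr rfl fun i hi => ?_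
    rw [Finset.mem_range] at hi
    obtain ⟨j, rfl⟩ : ∃ j, N = j + i := ⟨N - i, by omega⟩
    rw [← hcomm, map_sub, show j + i + 1 - 1 - i = j by omega, Nat.choose_symm_add,
      show ((j + i : ℕ) : ℤ) - j = i by push_cast; ring,
      show ((j + i : ℕ) : ℤ) - 1 - i = -1 + j by push_cast; ring,
      zpow_sub_one₀ (by norm_num), zpow_natCast, smul_smul]
    have : (-1 : ℂ) ^ (j + i) * (-1)⁻¹ * ((-1) ^ j * ((j + i).choose i : ℂ)) =
        -((-1) ^ i * ((j + i).choose i : ℂ)) := by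
      have h3 : (-1 : ℂ) ^ j * (-1) ^ j = 1 := by rw [← mul_pow]; norm_num
      rw [pow_add]
      norm_num
      linear_combination (-1) ^ i * ((j + i).choose i : ℂ) * h3
    rw [this]
    module
  have h3 : ∀ i ∈ Finset.range (N + 1),
      ((-1) ^ i * (N.choose i : ℂ)) • shift i (taylorSum (N - 1 - i) (Y u) w) =
      ∑ j ∈ Finset.range (N + 1), (((-1) ^ i * (N.choose i : ℂ)) * ((N - i).choose j : ℂ)) •
        shift (N - j) (Y u ⁅L (-1 + j), w⁆) := by
    intro i hi
    rw [Finset.mem_range] at hi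
    have h4 : ∑ j ∈ Finset.range (N + 1), (((-1) ^ i * (N.choose i : ℂ)) * ((N - i).choose j : ℂ)) •
        shift (N - j) (Y u ⁅L (-1 + j), w⁆) =
        ∑ j ∈ Finset.range (N - i + 1), (((-1) ^ i * (N.choose i : ℂ)) * ((N - i).choose j : ℂ)) •
        shift (N - j) (Y u ⁅L (-1 + j), w⁆) := by
      refine (Finset.sum_subset (Finset.range_subset_range.mpr (by omega)) fun j _ hj => ?_).symm
      rw [Finset.mem_range] at hj
      rw [Nat.choose_eq_zero_of_lt (show N - i < j by omega), Nat.cast_zero, mul_zero, zero_smul]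
    rw [h4, show (N : ℤ) - 1 - i = ((N - i : ℕ) : ℤ) - 1 by omega, taylorSum_natCast, map_sum,
      Finset.smul_sum]
    refine Finset.sum_congr rfl fun j _ => ?_
    rw [map_smul, shift_shift, smul_smul, show (i : ℤ) + (((N - i : ℕ) : ℤ) - j) = N - j by omega]
  rw [h2, Finset.sum_congr rfl h3, Finset.sum_comm]
  simp only [← Finset.sum_smul]
  rw [Finset.sum_eq_single N]
  · rw [sum_range_choose_mul_choose N N le_rfl, if_pos rfl, one_smul, sub_self, shift_zero,
      neg_add_eq_sub]
  · intro j hj hjN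
    rw [Finset.mem_range] at hj
    rw [sum_range_choose_mul_choose N j (by omega), if_neg hjN, zero_smul]
  · intro h
    simp at h

omit [IsSmoothModule W] in
/-- The iterate formula for `n - 1` follows from the one for `n` by taking the derivative, since
`[L₋₁, L_n] = (-1 - n) L_{n - 1}`. -/
theorem iterate_pred (hD : ∀ w : W, ⁅C, w⁆ = c • w)
    (hder : ∀ u w, Y u ⁅L (-1), w⁆ = deriv (Y u w)) {n : ℤ} (hn : n ≤ -2) (u : U)
    (hn' : ∀ w, Y u ⁅L n, w⁆ = iterSum Y n u w) (w : W) :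
    Y u ⁅L (n - 1), w⁆ = iterSum Y (n - 1) u w := by
  have hne : (-1 - (n : ℂ)) ≠ 0 := by
    intro h
    have : ((-1 - n : ℤ) : ℂ) = 0 := by push_cast; exact h
    have : -1 - n = 0 := by exact_mod_cast this
    omega
  have h1 : Y u ⁅L (-1), ⁅L n, w⁆⁆ = deriv (iterSum Y n u w) := by rw [hder, hn']
  have h2 : Y u ⁅L n, ⁅L (-1), w⁆⁆ = iterSum Y n u ⁅L (-1), w⁆ := hn' _
  have h3 : ⁅L (-1), ⁅L n, w⁆⁆ = ⁅L n, ⁅L (-1), w⁆⁆ + (-1 - (n : ℂ)) • ⁅L (n - 1), w⁆ := by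
    rw [lie_L_lie_L hD, if_neg (by omega), zero_smul, add_zero, show -1 + n = n - 1 by ring]
    push_cast
    rfl
  rw [h3, map_add, h2, map_smul] at h1
  refine smul_right_injective _ hne ?_
  simp only
  rw [eq_sub_of_add_eq' h1, iterSum, iterSum, iterSum, map_add, map_smul, hder, iterL, deriv_act,
    map_smoothSum]
  have h4 : smoothSum (-1) (fun i => truncSeries.deriv ∘ₗ (((-1) ^ i * intChoose (n + 1) i) •
      (shift (n + 1 - i) ∘ₗ Y.flip w))) u =
      smoothSum (-1) (fun i => ((-1) ^ i * intChoose (n + 1) i) •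
        (shift (n + 1 - i) ∘ₗ Y.flip ⁅L (-1), w⁆)) u +
      ((n : ℂ) + 1) • smoothSum (-1) (fun i => ((-1) ^ i * intChoose n i) •
        (shift (n - i) ∘ₗ Y.flip w)) u := by
    rw [← smoothSum_smul, ← smoothSum_add]
    congr 2
    funext i
    ext1 u
    simp only [LinearMap.comp_apply, LinearMap.smul_apply, map_smul, LinearMap.add_apply,
      LinearMap.flip_apply, hder, deriv_shift]
    rw [show n + 1 - (i : ℤ) - 1 = n - i by ring]
    have h5 : ((n : ℂ) + 1) * intChoose n i = ((n : ℂ) + 1 - i) * intChoose (n + 1) i := by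
      have := succ_mul_intChoose_succ (n + 1) i
      rw [succ_mul_intChoose_succ_succ] at this
      rw [this]
      push_cast
      ring
    rw [smul_smul ((n : ℂ) + 1), show ((n : ℂ) + 1) * ((-1) ^ i * intChoose n i) =
      (-1) ^ i * (((n : ℂ) + 1) * intChoose n i) by ring, h5]
    push_cast
    module
  have h6 : act (fun i => ((i : ℂ) + 1) • ((-1) ^ (i + 1) * intChoose (n + 1) (i + 1)) •
      (opL (n - (i + 1 : ℕ)) : Module.End ℂ V)) (Y u w) =
      (-1 - (n : ℂ)) • iterL V (n - 1) (Y u w) := by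
    rw [iterL, ← act_smul]
    congr 2
    funext i
    rw [smul_smul, smul_smul, sub_add_cancel,
      show n - ((i + 1 : ℕ) : ℤ) = n - 1 - i by push_cast; ring]
    congr 1
    rw [pow_succ]
    linear_combination -(-1) ^ i * succ_mul_intChoose_succ_succ n i
  rw [h4, h6, zpow_sub_one₀ (by norm_num), sub_add_cancel, iterL]
  have h7 : ((-1 : ℂ))⁻¹ = -1 := by norm_num
  rw [h7]
  module

end Extension

/-! ### The iterate formula for `L₋₂` -/

section NegTwo

open Virasoro truncSeries

variable {U V W : Type*} [AddCommGroup U] [Module ℂ U] [LieRingModule Virasoro U]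
  [LieModule ℂ Virasoro U] [IsSmoothModule U]
  [AddCommGroup V] [Module ℂ V] [LieRingModule Virasoro V] [LieModule ℂ Virasoro V]
  [AddCommGroup W] [Module ℂ W] [LieRingModule Virasoro W]
  [LieModule ℂ Virasoro W] [IsSmoothModule W] {c : ℂ} (Y : U →ₗ[ℂ] W →ₗ[ℂ] truncSeries V)

/-- The sum of `z ^ {m - 2 - j} L_j` over all `j`, where the modes with `j ≤ m - 2` act on `Y u w`
and the modes with `j ≥ m - 1` act on `u`. For `m = 0` it is the right-hand side of the iterate formula
for `L₋₂`. -/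
def splitSum (m : ℤ) (u : U) (w : W) : truncSeries V :=
  act (fun i => opL (m - 2 - i)) (Y u w) +
    smoothSum (m - 1) (fun i => shift (-1 - i) ∘ₗ Y.flip w) u

/-- The same sum as in `splitSum`, with `z ^ {m - 2 - j} L_j` weighted by `2 m - j`. For `m = -1`
it is the right-hand side of the iterate formula for `L₋₃`. -/
def splitSumDeriv (m : ℤ) (u : U) (w : W) : truncSeries V :=
  act (fun i => ((m : ℂ) + 2 + i) • opL (m - 2 - i)) (Y u w) +
    smoothSum (m - 1) (fun i => ((m : ℂ) + 1 - i) • (shift (-1 - i) ∘ₗ Y.flip w)) u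

variable {Y}

/-- Passing from `m` to `m + 1` moves the mode `L_{m - 1}` from `u` to `Y u w`, which is accounted
for by the commutator formula. -/
theorem splitSum_add_one (hY : ∀ n u, Y ⁅L n, u⁆ = homL n (Y u)) (m : ℤ) (u : U) (w : W) :
    splitSum Y (m + 1) u w = shift 1 (splitSum Y m u w) + taylorSum (m - 1) (Y u) w := by
  have h1 : taylorSum (m - 1) (Y u) w = map (opL (m - 1)) (Y u w) - Y ⁅L (m - 1), u⁆ w := by
    rw [hY, homL_apply, sub_sub_cancel]
  rw [splitSum, splitSum, act_succ, smoothSum_succ (m - 1), map_add, map_add, map_smoothSum, h1]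
  have h2 : (fun i : ℕ => shift 1 ∘ₗ shift (-1 - ((i + 1 : ℕ) : ℤ)) ∘ₗ Y.flip w) =
      fun i : ℕ => shift (-1 - (i : ℤ)) ∘ₗ Y.flip w := by
    funext i
    ext1 u
    simp only [LinearMap.comp_apply, shift_shift]
    congr 2
    push_cast
    ring
  have h3 : (fun i : ℕ => (opL (m + 1 - 2 - ((i + 1 : ℕ) : ℤ)) : Module.End ℂ V)) =
      fun i : ℕ => opL (m - 2 - i) := by
    funext i
    congr 1
    push_cast
    ring
  rw [h2, h3, show m + 1 - 1 = m - 1 + 1 by ring, LinearMap.comp_apply, shift_shift,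
    show m + 1 - 2 - ((0 : ℕ) : ℤ) = m - 1 by push_cast; ring,
    show (1 : ℤ) + (-1 - ((0 : ℕ) : ℤ)) = 0 by norm_num, shift_zero, LinearMap.flip_apply]
  abel

theorem splitSumDeriv_add_one (hY : ∀ n u, Y ⁅L n, u⁆ = homL n (Y u)) (m : ℤ) (u : U) (w : W) :
    splitSumDeriv Y (m + 1) u w = shift 1 (splitSumDeriv Y m u w) +
      (2 : ℂ) • shift 1 (splitSum Y m u w) + ((m : ℂ) + 3) • taylorSum (m - 1) (Y u) w := by
  have h1 : taylorSum (m - 1) (Y u) w = map (opL (m - 1)) (Y u w) - Y ⁅L (m - 1), u⁆ w := by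
    rw [hY, homL_apply, sub_sub_cancel]
  rw [splitSumDeriv, splitSumDeriv, splitSum, act_succ, smoothSum_succ (m - 1),
    smoothSum_succ (m - 1), map_add, map_add, map_add, map_add, map_smoothSum, map_smoothSum, h1]
  have h2 : smoothSum (m - 1 + 1) (fun i : ℕ => (((m + 1 : ℤ) : ℂ) + 1 - i) •
      (shift (-1 - (i : ℤ)) ∘ₗ Y.flip w)) u =
      smoothSum (m - 1 + 1) (fun i : ℕ => shift 1 ∘ₗ
        (((m : ℂ) + 1 - ((i + 1 : ℕ) : ℂ)) • (shift (-1 - ((i + 1 : ℕ) : ℤ)) ∘ₗ Y.flip w))) u +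
      (2 : ℂ) • smoothSum (m - 1 + 1)
        (fun i : ℕ => shift 1 ∘ₗ shift (-1 - ((i + 1 : ℕ) : ℤ)) ∘ₗ Y.flip w) u := by
    rw [← smoothSum_smul, ← smoothSum_add]
    congr 2
    funext i
    ext1 u
    simp only [LinearMap.comp_apply, LinearMap.smul_apply, LinearMap.add_apply, map_smul,
      shift_shift]
    rw [show (1 : ℤ) + (-1 - ((i + 1 : ℕ) : ℤ)) = -1 - i by push_cast; ring]
    push_cast
    module
  have h3 : act (fun i : ℕ => (((m + 1 : ℤ) : ℂ) + 2 + ((i + 1 : ℕ) : ℂ)) •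
      (opL (m + 1 - 2 - ((i + 1 : ℕ) : ℤ)) : Module.End ℂ V)) (Y u w) =
      act (fun i : ℕ => ((m : ℂ) + 2 + i) • opL (m - 2 - i)) (Y u w) +
        (2 : ℂ) • act (fun i => opL (m - 2 - i)) (Y u w) := by
    rw [← act_smul, ← act_add]
    congr 2
    funext i
    rw [show m + 1 - 2 - ((i + 1 : ℕ) : ℤ) = m - 2 - i by push_cast; ring]
    push_cast
    module
  have h4 : map (((((m + 1 : ℤ) : ℂ) + 2 + ((0 : ℕ) : ℂ))) •
      (opL (m + 1 - 2 - ((0 : ℕ) : ℤ)) : Module.End ℂ V)) (Y u w) =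
      ((m : ℂ) + 3) • map (opL (m - 1)) (Y u w) := by
    rw [show m + 1 - 2 - ((0 : ℕ) : ℤ) = m - 1 by push_cast; ring]
    ext a
    rw [smul_coe_apply, map_apply, map_apply, LinearMap.smul_apply]
    push_cast
    congr 1
    ring
  rw [h3, h4, show m + 1 - 1 = m - 1 + 1 by ring, h2, LinearMap.smul_apply, map_smul,
    LinearMap.comp_apply, shift_shift,
    show (1 : ℤ) + (-1 - ((0 : ℕ) : ℤ)) = 0 by norm_num, shift_zero, LinearMap.flip_apply, map_add,
    map_smul]
  push_cast
  module

theorem intChoose_zero_succ (i : ℕ) : intChoose 0 (i + 1) = 0 := by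
  have := intChoose_natCast 0 (i + 1)
  simpa using this

theorem smoothSum_eq_zero {X : Type*} [AddCommGroup X] [Module ℂ X] (r : ℤ) (T : ℕ → W →ₗ[ℂ] X)
    (hT : ∀ i, T i = 0) (w : W) : smoothSum r T w = 0 := by
  rw [smoothSum_apply]
  exact finsum_eq_zero_of_forall_eq_zero fun i => by rw [hT, LinearMap.zero_apply]

/-- If the iterate formula for `L₋₂` holds at `u`, then `splitSum` is known for every splitting
point `m`. -/
theorem splitSum_eq (hY : ∀ n u, Y ⁅L n, u⁆ = homL n (Y u)) (u : U)
    (h2 : ∀ w, Y u ⁅L (-2), w⁆ = splitSum Y 0 u w) (m : ℤ) (w : W) :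
    splitSum Y m u w = shift m (Y u ⁅L (-2), w⁆) +
      smoothSum (-1) (fun i => intChoose m (i + 1) • (shift (m - 1 - i) ∘ₗ Y u)) w := by
  have hsucc : ∀ m : ℤ, shift (m + 1) (Y u ⁅L (-2), w⁆) + smoothSum (-1)
      (fun i => intChoose (m + 1) (i + 1) • (shift (m + 1 - 1 - i) ∘ₗ Y u)) w =
      shift 1 (shift m (Y u ⁅L (-2), w⁆) +
      smoothSum (-1) (fun i => intChoose m (i + 1) • (shift (m - 1 - i) ∘ₗ Y u)) w) +
      taylorSum (m - 1) (Y u) w := by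
    intro m
    rw [map_add, shift_shift, map_smoothSum, taylorSum, add_comm 1 m, add_assoc, ← smoothSum_add]
    congr 3
    funext i
    ext1 w
    simp only [LinearMap.comp_apply, LinearMap.smul_apply, LinearMap.add_apply, map_smul,
      shift_shift, sub_add_cancel, add_sub_cancel_right]
    rw [show (1 : ℤ) + (m - 1 - i) = m - i by ring, intChoose_succ_succ]
    module
  induction m using Int.induction_on with
  | zero =>
    rw [smoothSum_eq_zero _ _ (fun i => by rw [intChoose_zero_succ, zero_smul]), shift_zero,
      add_zero, h2]
  | succ m ih => rw [splitSum_add_one hY, hsucc, ih]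
  | pred m ih =>
    have h3 := splitSum_add_one hY (-(m : ℤ) - 1) u w
    have h4 := hsucc (-(m : ℤ) - 1)
    rw [sub_add_cancel] at h3 h4
    rw [ih, h4] at h3
    have h5 := congrArg (shift (-1)) (add_right_cancel h3)
    rw [shift_shift, shift_shift, neg_add_cancel, shift_zero, shift_zero] at h5
    exact h5.symm

theorem splitSumDeriv_eq (hY : ∀ n u, Y ⁅L n, u⁆ = homL n (Y u)) (u : U)
    (h2 : ∀ w, Y u ⁅L (-2), w⁆ = splitSum Y 0 u w)
    (h3 : ∀ w, Y u ⁅L (-3), w⁆ = splitSumDeriv Y (-1) u w) (m : ℤ) (w : W) :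
    splitSumDeriv Y m u w = shift (m + 1) (Y u ⁅L (-3), w⁆) +
      (2 * ((m : ℂ) + 1)) • shift m (Y u ⁅L (-2), w⁆) + smoothSum (-1)
        (fun i => (((i : ℂ) + 3) * intChoose (m + 1) (i + 2)) • (shift (m - 1 - i) ∘ₗ Y u)) w := by
  have hsucc : ∀ m : ℤ, shift (m + 1 + 1) (Y u ⁅L (-3), w⁆) +
      (2 * (((m + 1 : ℤ) : ℂ) + 1)) • shift (m + 1) (Y u ⁅L (-2), w⁆) + smoothSum (-1)
        (fun i => (((i : ℂ) + 3) * intChoose (m + 1 + 1) (i + 2)) •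
          (shift (m + 1 - 1 - i) ∘ₗ Y u)) w =
      shift 1 (shift (m + 1) (Y u ⁅L (-3), w⁆) +
        (2 * ((m : ℂ) + 1)) • shift m (Y u ⁅L (-2), w⁆) + smoothSum (-1)
        (fun i => (((i : ℂ) + 3) * intChoose (m + 1) (i + 2)) • (shift (m - 1 - i) ∘ₗ Y u)) w) +
      (2 : ℂ) • shift 1 (splitSum Y m u w) + ((m : ℂ) + 3) • taylorSum (m - 1) (Y u) w := by
    intro m
    have h4 : smoothSum (-1) (fun i => (((i : ℂ) + 3) * intChoose (m + 1 + 1) (i + 2)) •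
          (shift (m + 1 - 1 - i) ∘ₗ Y u)) w =
        smoothSum (-1) (fun i => shift 1 ∘ₗ
          ((((i : ℂ) + 3) * intChoose (m + 1) (i + 2)) • (shift (m - 1 - i) ∘ₗ Y u))) w +
        (2 : ℂ) • smoothSum (-1)
          (fun i => shift 1 ∘ₗ (intChoose m (i + 1) • (shift (m - 1 - i) ∘ₗ Y u))) w +
        ((m : ℂ) + 3) • taylorSum (m - 1) (Y u) w := by
      rw [taylorSum, ← smoothSum_smul, ← smoothSum_smul, ← smoothSum_add, ← smoothSum_add]
      congr 2
      funext i
      ext1 w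
      simp only [LinearMap.comp_apply, LinearMap.smul_apply, LinearMap.add_apply, map_smul,
        shift_shift, sub_add_cancel, add_sub_cancel_right]
      rw [show (1 : ℤ) + (m - 1 - i) = m - i by ring]
      simp only [smul_smul, ← add_smul]
      congr 1
      have h5 := intChoose_succ_succ (m + 1) (i + 1)
      have h6 := intChoose_succ_succ m i
      have h7 := succ_mul_intChoose_succ m i
      rw [show i + 2 = i + 1 + 1 by ring]
      linear_combination ((i : ℂ) + 3) * h5 + ((i : ℂ) + 3) * h6 + h7
    rw [h4, splitSum_eq hY u h2, map_add, map_add, map_add, map_smul, shift_shift, shift_shift,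
      map_smoothSum, map_smoothSum, add_comm 1 m, show 1 + (m + 1) = m + 1 + 1 by ring]
    push_cast
    module
  induction m using Int.inductionOn' (b := -1) with
  | zero =>
    rw [smoothSum_eq_zero _ _ (fun i => by
      rw [neg_add_cancel, intChoose_zero_succ, mul_zero, zero_smul]), neg_add_cancel, shift_zero,
      add_zero, h3]
    simp
  | succ m _ ih => rw [splitSumDeriv_add_one hY, hsucc, ih]
  | pred m _ ih =>
    have h3 := splitSumDeriv_add_one hY (m - 1) u w
    have h4 := hsucc (m - 1)
    rw [sub_add_cancel] at h3 h4
    rw [ih, h4] at h3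
    have h5 := congrArg (shift (-1)) (add_right_cancel (add_right_cancel h3))
    rw [shift_shift, shift_shift, neg_add_cancel, shift_zero, shift_zero] at h5
    rw [← h5, sub_add_cancel]

omit [LieRingModule Virasoro W] [LieModule ℂ Virasoro W] [IsSmoothModule W] in
theorem iterSum_neg_two (u : U) (w : W) : iterSum Y (-2) u w = splitSum Y 0 u w := by
  have h : ∀ i : ℕ, (-1 : ℂ) ^ i * intChoose (-2 + 1) i = 1 := by
    intro i
    rw [show (-2 + 1 : ℤ) = -1 by norm_num, intChoose_neg_one, ← mul_pow]
    norm_num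
  rw [iterSum, iterL, splitSum]
  simp only [h, one_smul]
  norm_num

omit [LieRingModule Virasoro W] [LieModule ℂ Virasoro W] [IsSmoothModule W] in
theorem iterSum_neg_three (u : U) (w : W) : iterSum Y (-3) u w = splitSumDeriv Y (-1) u w := by
  have h : ∀ i : ℕ, (-1 : ℂ) ^ i * intChoose (-3 + 1) i = i + 1 := by
    intro i
    have h1 := succ_mul_intChoose_succ_succ (-2) i
    have h2 := succ_mul_intChoose_succ (-1) i
    norm_num at h1 h2 ⊢
    rw [intChoose_neg_one] at h1 h2
    have h3 : (-1 : ℂ) ^ i * (-1) ^ i = 1 := by rw [← mul_pow]; norm_num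
    rw [pow_succ] at h1
    linear_combination (-1) ^ i * h1 + ((i : ℂ) + 1) * h3
  rw [iterSum, iterL, splitSumDeriv, smoothSum_succ (-1 - 1)]
  simp only [h]
  congr 1
  · congr 2
    funext i
    push_cast
    congr 1
    ring
  · rw [show (((-1 : ℤ) : ℂ) + 1 - ((0 : ℕ) : ℂ)) = 0 by push_cast; ring, zero_smul,
      LinearMap.zero_apply, zero_add, ← smoothSum_smul]
    norm_num
    congr 2
    funext i
    rw [show (-2 - (i : ℤ)) = -1 - (i + 1) by ring]
    module

omit [LieRingModule Virasoro V] [LieModule ℂ Virasoro V] in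
theorem taylorSum_smoothSum (m : ℤ) (Z : U →ₗ[ℂ] W →ₗ[ℂ] truncSeries V) (r : ℤ)
    (e : ℕ → ℤ) (u : U) (w : W) (G : W →ₗ[ℂ] truncSeries V)
    (hG : ∀ w, G w = smoothSum r (fun j => shift (e j) ∘ₗ Z.flip w) u) :
    taylorSum m G w = ∑ᶠ j : ℕ, shift (e j) (taylorSum m (Z ⁅L (r + j), u⁆) w) := by
  obtain ⟨N, hN⟩ := IsSmoothModule.exists_lie_eq_zero u
  have h1 : ∀ w, G w = ∑ j ∈ Finset.range (N + r.natAbs), shift (e j) (Z ⁅L (r + j), u⁆ w) := by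
    intro w
    rw [hG]
    refine finsum_eq_sum_of_support_subset _ fun i hi => ?_
    by_contra hi'
    rw [Finset.mem_coe, Finset.mem_range, not_lt] at hi'
    exact hi (by simp [hN (r + i) (by omega)])
  obtain ⟨K, hK⟩ := exists_taylorSum_eq_sum (V := V) w
  have h2 : ∑ᶠ j : ℕ, shift (e j) (taylorSum m (Z ⁅L (r + j), u⁆) w) =
      ∑ j ∈ Finset.range (N + r.natAbs), shift (e j) (taylorSum m (Z ⁅L (r + j), u⁆) w) := by
    refine finsum_eq_sum_of_support_subset _ fun i hi => ?_
    by_contra hi'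
    rw [Finset.mem_coe, Finset.mem_range, not_lt] at hi'
    refine hi ?_
    have h3 : taylorSum m (0 : W →ₗ[ℂ] truncSeries V) w = 0 := by
      rw [hK K le_rfl]
      simp
    simp only
    rw [hN (r + i) (by omega), map_zero, h3, map_zero]
  rw [h2, hK K le_rfl]
  simp only [hK K le_rfl, h1, map_sum, Finset.smul_sum, map_smul]
  rw [Finset.sum_comm]
  refine Finset.sum_congr rfl fun j _ => Finset.sum_congr rfl fun i _ => ?_
  rw [shift_shift, shift_shift, add_comm (e j)]

/-- The iterate formula for `L₋₂` passes from `u` to `L m u`. Both sides are computed by commuting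
`L m` to the left; the commutators with `L_j` add up to `splitSumDeriv Y m u w` on each side, and
the central terms agree because the three modules have the same central charge. -/
theorem iterate_neg_two_lie (hY : ∀ n u, Y ⁅L n, u⁆ = homL n (Y u))
    (hCU : ∀ u : U, ⁅C, u⁆ = c • u) (hCV : ∀ v : V, ⁅C, v⁆ = c • v)
    (hD : ∀ w : W, ⁅C, w⁆ = c • w)
    (hder : ∀ u w, Y u ⁅L (-1), w⁆ = deriv (Y u w)) (u : U)
    (h2 : ∀ w, Y u ⁅L (-2), w⁆ = iterSum Y (-2) u w) (m : ℤ) (w : W) :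
    Y ⁅L m, u⁆ ⁅L (-2), w⁆ = iterSum Y (-2) ⁅L m, u⁆ w := by
  have hlie : ∀ (k : ℤ) (u' : U) (w' : W),
      Y ⁅L k, u'⁆ w' = map (opL k) (Y u' w') - taylorSum k (Y u') w' := by
    intro k u' w'
    rw [hY, homL_apply]
  have h2' : ∀ w, Y u ⁅L (-2), w⁆ = splitSum Y 0 u w := fun w => by rw [h2, iterSum_neg_two]
  have h3' : ∀ w, Y u ⁅L (-3), w⁆ = splitSumDeriv Y (-1) u w := fun w => by
    have := iterate_pred hD hder le_rfl u h2 w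
    rw [show (-2 : ℤ) - 1 = -3 by norm_num] at this
    rw [this, iterSum_neg_three]
  have hsplit : ∀ u' w', splitSum Y 0 u' w' = act (fun i => opL (-2 - i)) (Y u' w') +
      smoothSum (-1) (fun i => shift (-1 - i) ∘ₗ Y.flip w') u' := by
    intro u' w'
    rw [splitSum, zero_sub, zero_sub]
  -- The left-hand side: `L m` is commuted with `L₋₂` inside the correction term.
  have hG : ∀ w', (Y u ∘ₗ opL (-2) - act (fun i => opL (-2 - i)) ∘ₗ Y u) w' =
      smoothSum (-1) (fun i => shift (-1 - i) ∘ₗ Y.flip w') u := by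
    intro w'
    rw [LinearMap.sub_apply, LinearMap.comp_apply, LinearMap.comp_apply, opL_apply, h2', hsplit,
      add_sub_cancel_left]
  have hact : taylorSum m (act (fun i => opL (-2 - i)) ∘ₗ Y u) w =
      act (fun i => opL (-2 - i)) (taylorSum m (Y u) w) := by
    rw [taylorSum, taylorSum, map_smoothSum]
    congr 2
    funext i
    ext1 w
    simp only [LinearMap.comp_apply, LinearMap.smul_apply, map_smul, act_shift]
  have hfirst : smoothSum (-1)
      (fun i => (intChoose (m + 1) i • (shift (m + 1 - i) ∘ₗ Y u)) ∘ₗ opL (-2)) w =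
      act (fun i => opL (-2 - i)) (taylorSum m (Y u) w) +
        ∑ᶠ j : ℕ, shift (-1 - j) (taylorSum m (Y ⁅L (-1 + j), u⁆) w) := by
    rw [← taylorSum_smoothSum m Y (-1) _ u w _ hG, ← hact, taylorSum_sub, LinearMap.sub_apply,
      add_sub_cancel]
    rfl
  have hsecond : smoothSum (-2 - 1) (fun i => ((i : ℂ) - 1 - ((-2 : ℤ) : ℂ)) •
      (intChoose (m + 1) i • (shift (m + 1 - i) ∘ₗ Y u))) w = splitSumDeriv Y m u w := by
    rw [splitSumDeriv_eq hY u h2' h3', smoothSum_succ, smoothSum_succ]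
    norm_num
    rw [intChoose_zero, show intChoose (m + 1) 1 = (m : ℂ) + 1 by simp [intChoose], one_smul,
      smul_smul, ← add_assoc]
    congr 3
    funext i
    rw [smul_smul, show m - ((i : ℤ) + 1) = m - 1 - i by ring]
    congr 1
    ring
  have hleft : taylorSum m (Y u) ⁅L (-2), w⁆ = _ := smoothSum_neg_one_lie hD
    (fun i => intChoose (m + 1) i • (shift (m + 1 - i) ∘ₗ Y u)) (-2) w
  rw [hfirst, hsecond, if_pos (by norm_num)] at hleft
  -- The right-hand side: `L m` is commuted with the modes that act on `u` and on `Y u w`.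
  have hright := smoothSum_neg_one_lie hCU (fun i => shift (-1 - i) ∘ₗ Y.flip w) m u
  have hτ : ∀ u', (map (opL m) ∘ₗ Y.flip w - Y.flip w ∘ₗ opL m) u' = taylorSum m (Y u') w := by
    intro u'
    rw [LinearMap.sub_apply, LinearMap.comp_apply, LinearMap.comp_apply, LinearMap.flip_apply,
      LinearMap.flip_apply, opL_apply, hlie, sub_sub_cancel]
  have hthird : smoothSum (-1) (fun i => (shift (-1 - i) ∘ₗ Y.flip w) ∘ₗ opL m) u =
      map (opL m) (smoothSum (-1) (fun i => shift (-1 - i) ∘ₗ Y.flip w) u) -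
        ∑ᶠ j : ℕ, shift (-1 - j) (taylorSum m (Y ⁅L (-1 + j), u⁆) w) := by
    have h4 : ∑ᶠ j : ℕ, shift (-1 - j) (taylorSum m (Y ⁅L (-1 + j), u⁆) w) =
        smoothSum (-1) (fun i : ℕ => shift (-1 - (i : ℤ)) ∘ₗ
          (map (opL m) ∘ₗ Y.flip w - Y.flip w ∘ₗ opL m)) u := by
      rw [smoothSum_apply]
      refine finsum_congr fun j => ?_
      rw [LinearMap.comp_apply, hτ]
    rw [h4, map_smoothSum, ← smoothSum_sub]
    congr 2
    funext i
    ext1 u'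
    simp only [LinearMap.comp_apply, LinearMap.sub_apply, map_sub, map_shift, sub_sub_cancel]
  rw [hthird] at hright
  have hA := act_opL_mul_opL hCV m (Y u w)
  rw [iterSum_neg_two, hlie, hsplit, hlie m u w, map_sub, act_map, hA, hright, hleft, h2',
    hsplit, map_add, map_act, splitSumDeriv]
  have h5 : smoothSum (m - 1) (fun i => ((i : ℂ) - 1 - m) • (shift (-1 - i) ∘ₗ Y.flip w)) u =
      (-1 : ℂ) • smoothSum (m - 1)
        (fun i => ((m : ℂ) + 1 - i) • (shift (-1 - i) ∘ₗ Y.flip w)) u := by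
    rw [← smoothSum_smul]
    congr 2
    funext i
    module
  have hb : intChoose (m + 1) 3 = ((m : ℂ) + 1) * m * (m - 1) / 6 := by
    have e1 := succ_mul_intChoose_succ (m + 1) 2
    have e2 := succ_mul_intChoose_succ (m + 1) 1
    have e3 := succ_mul_intChoose_succ (m + 1) 0
    rw [intChoose_zero] at e3
    push_cast at e1 e2 e3
    norm_num at e1 e2 e3
    rw [e3] at e2
    linear_combination e1 / 3 + ((m : ℂ) - 1) / 6 * e2
  -- The central term comes from the modes acting on `Y u w` for `m ≥ 2`, from those acting on `u`
  -- for `m ≤ 1`, and from the single mode `L 2` on the left-hand side.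
  have h6 : (if 2 ≤ m then (-(((m : ℂ) ^ 3 - m) / 12) * c) • shift (m - 2) (Y u w) else 0) +
      (if m ≤ 1 then (-(((m : ℂ) ^ 3 - m) / 12) * c) •
        (shift (-1 - ((1 - m).toNat : ℤ)) ∘ₗ Y.flip w) u else 0) =
      (-(((m : ℂ) ^ 3 - m) / 12) * c) • shift (m - 2) (Y u w) := by
    rcases le_or_gt m 1 with h | h
    · rw [if_neg (by omega), if_pos h, zero_add, show -1 - ((1 - m).toNat : ℤ) = m - 2 by omega]
      rfl
    · rw [if_pos (by omega), if_neg (by omega), add_zero]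
  have h7 : (-((((-2 : ℤ) : ℂ) ^ 3 - ((-2 : ℤ) : ℂ)) / 12) * c) •
      (intChoose (m + 1) (1 - (-2 : ℤ)).toNat •
        (shift (m + 1 - ((1 - (-2 : ℤ)).toNat : ℤ)) ∘ₗ Y u)) w =
      ((((m : ℂ) ^ 3 - m) / 12) * c) • shift (m - 2) (Y u w) := by
    rw [show (1 - (-2 : ℤ)).toNat = 3 by rfl, hb, LinearMap.smul_apply, LinearMap.comp_apply,
      smul_smul, show m + 1 - ((3 : ℕ) : ℤ) = m - 2 by push_cast; ring]
    congr 1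
    push_cast
    ring
  rw [h5, h7]
  linear_combination (norm := module) -h6

end NegTwo

open Virasoro truncSeries

/-! ### The intertwining operator attached to a family of series -/

instance Verma.isSmoothModule (c h : ℂ) : IsSmoothModule (Verma c h) where
  exists_lie_eq_zero := Verma.mem_of_vec_mem (smoothVectors _)
    ⟨1, fun _ hn => Verma.lie_L_vec_of_pos (by omega)⟩
    fun n _ hw => lie_L_mem_smoothVectors Verma.lie_C n hw

instance KacOneTwo.isSmoothModule (t : ℂ) : IsSmoothModule (KacOneTwo t) where
  exists_lie_eq_zero := KacOneTwo.mem_of_vec_mem (smoothVectors _)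
    ⟨1, fun _ hn => KacOneTwo.lie_L_vec_of_pos (by omega)⟩
    fun n _ hw => lie_L_mem_smoothVectors KacOneTwo.lie_C n hw

section SeriesFamilies

variable {U V W : Type*} [AddCommGroup U] [Module ℂ U] [AddCommGroup V] [Module ℂ V]
  [AddCommGroup W] [Module ℂ W]

/-- The operator `w ↦ (u ↦ Y u w)`, as a series in `z` concentrated in degree `0` in `log z`. -/
def intertwiningOfSeries (Y : U →ₗ[ℂ] W →ₗ[ℂ] truncSeries V) : W →ₗ[ℂ] LogSeries (U →ₗ[ℂ] V) :=
  Finsupp.lsingle 0 ∘ₗ LinearMap.pi fun a => LinearMap.compRight ℂ (coeff a) ∘ₗ Y.flip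

theorem intertwiningOfSeries_zero_apply (Y : U →ₗ[ℂ] W →ₗ[ℂ] truncSeries V) (w : W) (a : ℂ)
    (u : U) : intertwiningOfSeries Y w 0 a u = (Y u w).1 a := by
  have h : intertwiningOfSeries Y w =
      Finsupp.single 0 fun a => coeff a ∘ₗ Y.flip w := rfl
  rw [h, Finsupp.single_eq_same]
  rfl

theorem intertwiningOfSeries_succ (Y : U →ₗ[ℂ] W →ₗ[ℂ] truncSeries V) (w : W) (k : ℕ) (a : ℂ) :
    intertwiningOfSeries Y w (k + 1) a = 0 := by
  have h : intertwiningOfSeries Y w =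
      Finsupp.single 0 fun a => coeff a ∘ₗ Y.flip w := rfl
  rw [h, Finsupp.single_eq_of_ne (by omega)]
  rfl

variable [LieRingModule Virasoro U] [LieModule ℂ Virasoro U] [IsSmoothModule U]
  [LieRingModule Virasoro V] [LieModule ℂ Virasoro V]
  [LieRingModule Virasoro W] [LieModule ℂ Virasoro W] [IsSmoothModule W]

theorem isIntertwiningOperator_intertwiningOfSeries {Y : U →ₗ[ℂ] W →ₗ[ℂ] truncSeries V}
    (hY : ∀ n u, Y ⁅L n, u⁆ = homL n (Y u))
    (hder : ∀ u w, Y u ⁅L (-1), w⁆ = truncSeries.deriv (Y u w))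
    (hiter : ∀ n u w, Y u ⁅L n, w⁆ = iterSum Y n u w) :
    IsIntertwiningOperator (intertwiningOfSeries Y) where
  lower_truncation w u h := by
    obtain ⟨N, hN⟩ := (Y u w).2 (-h - 1)
    refine ⟨N, fun n hn k => ?_⟩
    rw [intertwiningMode]
    cases k with
    | zero =>
      lift n to ℕ using by omega
      rw [intertwiningOfSeries_zero_apply, Int.cast_natCast,
        show -(h + (n : ℂ)) - 1 = -h - 1 - n by ring]
      exact hN n (by omega)
    | succ k => rw [intertwiningOfSeries_succ, LinearMap.zero_apply]
  commutator_formula w n u k a := by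
    cases k with
    | zero =>
      have h1 : (taylorSum n (Y u) w).1 a = ∑ᶠ i : ℕ, ((Ring.choose (n + 1) i : ℤ) : ℂ) •
          (Y u ⁅L ((i : ℤ) - 1), w⁆).1 (a - ((n : ℂ) + 1 - i)) := by
        rw [← coeff_apply, taylorSum, map_smoothSum, smoothSum_apply]
        refine finsum_congr fun i => ?_
        rw [neg_add_eq_sub, LinearMap.comp_apply, LinearMap.smul_apply, map_smul, intChoose,
          LinearMap.comp_apply, coeff_apply, shift_apply]
        push_cast
        rfl
      simp only [intertwiningOfSeries_zero_apply]
      rw [← h1, hY, homL_apply, sub_coe_apply, sub_add_cancel]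
      rfl
    | succ k => simp [intertwiningOfSeries_succ]
  iterate_formula w n u k a := by
    cases k with
    | zero =>
      simp only [intertwiningOfSeries_zero_apply]
      have hfin := finite_support_act
        (fun i => ((-1 : ℂ) ^ i * intChoose (n + 1) i) • opL (n - i)) (Y u w) a
      have hfin' := hasFiniteSupport_smooth (-1)
        (fun i => (-1 : ℂ) ^ n • (coeff a ∘ₗ (((-1 : ℂ) ^ i * intChoose (n + 1) i) •
          (shift (n + 1 - i) ∘ₗ Y.flip w)))) u
      rw [hiter, iterSum, add_coe_apply, smul_coe_apply, iterL, act_apply,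
        ← coeff_apply a (smoothSum _ _ _), map_smoothSum, ← smoothSum_smul, smoothSum_apply,
        ← finsum_add_distrib hfin hfin']
      refine finsum_congr fun i => ?_
      simp only [neg_add_eq_sub, LinearMap.comp_apply, LinearMap.smul_apply, map_smul,
        coeff_apply, shift_apply, smul_add, intChoose, LinearMap.flip_apply]
      rw [smul_comm]
      push_cast
      rfl
    | succ k => simp [intertwiningOfSeries_succ]
  derivative_property w k a := by
    ext u
    cases k with
    | zero =>
      rw [LinearMap.add_apply, LinearMap.smul_apply, LinearMap.smul_apply,
        intertwiningOfSeries_zero_apply, intertwiningOfSeries_zero_apply, intertwiningOfSeries_succ,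
        LinearMap.zero_apply, smul_zero, add_zero, hder, deriv_apply]
    | succ k => simp [intertwiningOfSeries_succ]

end SeriesFamilies

open Virasoro truncSeries

/-! ### Construction of the intertwining operator -/

section General

variable {U V W : Type*} [AddCommGroup U] [Module ℂ U] [AddCommGroup V] [Module ℂ V]
  [AddCommGroup W] [Module ℂ W]
  [LieRingModule Virasoro U] [LieModule ℂ Virasoro U] [IsSmoothModule U]
  [LieRingModule Virasoro V] [LieModule ℂ Virasoro V]
  [LieRingModule Virasoro W] [LieModule ℂ Virasoro W] [IsSmoothModule W]

theorem densityL_neg_one (h : ℂ) (f : truncSeries V) :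
    densityL h (-1) f = map (opL (-1)) f + truncSeries.deriv f := by
  rw [densityL_apply]
  norm_num
  rw [shift_zero]
  module

theorem densityL_neg_two (h : ℂ) (f : truncSeries V) :
    densityL h (-2) f = map (opL (-2)) f - shift (-1) (truncSeries.deriv f) + h • shift (-2) f := by
  rw [densityL_apply]
  norm_num
  module

theorem act_intChoose_natCast (N : ℕ) (f : truncSeries V) :
    act (fun i => intChoose ((N : ℤ) - 1 + 1) i • opL ((N : ℤ) - 1 - i)) f =
      ∑ i ∈ Finset.range (N + 1), (N.choose i : ℂ) • shift i (map (opL ((N : ℤ) - 1 - i)) f) := by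
  rw [act_eq_sum_range (N := N + 1) fun i hi => ?_]
  · refine Finset.sum_congr rfl fun i _ => ?_
    rw [sub_add_cancel, intChoose_natCast]
    rfl
  · rw [sub_add_cancel, intChoose_natCast, Nat.choose_eq_zero_of_lt (by omega), Nat.cast_zero,
      zero_smul]

/-- The action of `homL (N - 1)` on `exp(z L₋₁) ∘ g` in terms of `densityL`; for `N = 1, 2, 3` the
sum collapses, so that `exp(z L₋₁) ∘ g` is of lowest weight `h` for the operators `homL n`. -/
theorem homL_expL_natCast {h : ℂ} {g : W →ₗ[ℂ] truncSeries V}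
    (hg : ∀ n w, g ⁅L n, w⁆ = densityL h n (g w)) (N : ℕ) (w : W) :
    homL ((N : ℤ) - 1) (expL V ∘ₗ g) w = expL V (∑ i ∈ Finset.range (N + 1), (N.choose i : ℂ) •
      (shift i (map (opL ((N : ℤ) - 1 - i)) (g w)) -
        shift ((N : ℤ) - i) (densityL h (-1 + i) (g w)))) := by
  rw [homL_apply, taylorSum_natCast, LinearMap.comp_apply, map_opL_expL, act_intChoose_natCast]
  simp only [LinearMap.comp_apply, hg, ← expL_shift, smul_sub, Finset.sum_sub_distrib, map_sub,
    map_sum, map_smul]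

theorem homL_zero_expL {h : ℂ} {g : W →ₗ[ℂ] truncSeries V}
    (hg : ∀ n w, g ⁅L n, w⁆ = densityL h n (g w)) :
    homL 0 (expL V ∘ₗ g) = h • (expL V ∘ₗ g) := by
  ext1 w
  have h1 := homL_expL_natCast hg 1 w
  rw [show ((1 : ℕ) : ℤ) - 1 = 0 by norm_num] at h1
  rw [h1, LinearMap.smul_apply, LinearMap.comp_apply, ← map_smul]
  congr 1
  simp only [Finset.sum_range_succ, Finset.sum_range_zero]
  simp [densityL_apply, shift_zero, shift_shift, map_add, map_sub, map_smul]
  module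

theorem homL_one_expL {h : ℂ} {g : W →ₗ[ℂ] truncSeries V}
    (hg : ∀ n w, g ⁅L n, w⁆ = densityL h n (g w)) : homL 1 (expL V ∘ₗ g) = 0 := by
  ext1 w
  have h1 := homL_expL_natCast hg 2 w
  rw [show ((2 : ℕ) : ℤ) - 1 = 1 by norm_num] at h1
  rw [h1, LinearMap.zero_apply, ← map_zero (expL V)]
  congr 1
  simp only [Finset.sum_range_succ, Finset.sum_range_zero]
  simp [densityL_apply, shift_zero, shift_shift, map_add, map_sub, map_smul]
  module

theorem homL_two_expL {h : ℂ} {g : W →ₗ[ℂ] truncSeries V}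
    (hg : ∀ n w, g ⁅L n, w⁆ = densityL h n (g w)) : homL 2 (expL V ∘ₗ g) = 0 := by
  ext1 w
  have h1 := homL_expL_natCast hg 3 w
  rw [show ((3 : ℕ) : ℤ) - 1 = 2 by norm_num] at h1
  rw [h1, LinearMap.zero_apply, ← map_zero (expL V)]
  congr 1
  simp only [Finset.sum_range_succ, Finset.sum_range_zero]
  simp [densityL_apply, shift_zero, shift_shift, map_add, map_sub, map_smul]
  module

omit [LieModule ℂ Virasoro W] [IsSmoothModule W] in
theorem expL_lie_L_neg_one {h : ℂ} {g : W →ₗ[ℂ] truncSeries V}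
    (hg : ∀ n w, g ⁅L n, w⁆ = densityL h n (g w)) (w : W) :
    (expL V ∘ₗ g) ⁅L (-1), w⁆ = truncSeries.deriv ((expL V ∘ₗ g) w) := by
  rw [LinearMap.comp_apply, LinearMap.comp_apply, hg, densityL_neg_one, deriv_expL, map_add,
    add_comm]

theorem smoothSum_neg_one_of_lie_eq_zero {X : Type*} [AddCommGroup X] [Module ℂ X] {h : ℂ} {u : U}
    (h0 : ⁅L 0, u⁆ = h • u) (hpos : ∀ n : ℤ, 0 < n → ⁅L n, u⁆ = 0) (T : ℕ → U →ₗ[ℂ] X) :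
    smoothSum (-1) T u = T 0 ⁅L (-1), u⁆ + h • T 1 u := by
  have h1 : smoothSum (-1 + 1 + 1) (fun i => T (i + 1 + 1)) u = 0 :=
    finsum_eq_zero_of_forall_eq_zero fun i => by rw [hpos _ (by omega), map_zero]
  rw [smoothSum_succ, smoothSum_succ, h1, add_zero, neg_add_cancel, h0, map_smul]

/-- The iterate formula for `L₋₂` at a vector `u` of lowest weight `h`. -/
theorem expL_lie_L_neg_two {h : ℂ} {g : W →ₗ[ℂ] truncSeries V}
    (hg : ∀ n w, g ⁅L n, w⁆ = densityL h n (g w)) {Y : U →ₗ[ℂ] W →ₗ[ℂ] truncSeries V}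
    (hY : ∀ n u, Y ⁅L n, u⁆ = homL n (Y u)) {u : U} (hu : Y u = expL V ∘ₗ g)
    (h0 : ⁅L 0, u⁆ = h • u) (hpos : ∀ n : ℤ, 0 < n → ⁅L n, u⁆ = 0) (w : W) :
    Y u ⁅L (-2), w⁆ = iterSum Y (-2) u w := by
  have h1 : Y ⁅L (-1), u⁆ w = map (opL (-1)) (expL V (g w)) -
      truncSeries.deriv (expL V (g w)) := by
    have h2 := taylorSum_natCast 0 (Y u) w
    rw [hY, homL_apply, show (-1 : ℤ) = ((0 : ℕ) : ℤ) - 1 by norm_num, h2, hu]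
    simp only [zero_add, Finset.sum_range_one]
    norm_num
    rw [shift_zero]
    exact expL_lie_L_neg_one hg w
  have h3 : map (opL (-1)) (expL V (g w)) = expL V (map (opL (-1)) (g w)) := by
    have h4 := map_opL_expL (-1) (g w)
    have h5 := act_intChoose_natCast 0 (g w)
    rw [show ((0 : ℕ) : ℤ) - 1 = -1 by norm_num] at h5
    rw [h4, h5]
    simp only [zero_add, Finset.sum_range_one]
    norm_num
    rw [shift_zero]
  rw [iterSum, smoothSum_neg_one_of_lie_eq_zero h0 hpos]
  simp only [LinearMap.comp_apply, LinearMap.smul_apply, LinearMap.flip_apply]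
  rw [h1, h3, hu, LinearMap.comp_apply, LinearMap.comp_apply, hg, densityL_neg_two, map_add,
    map_sub, expL_map_opL, deriv_expL]
  have h6 : intChoose (-2 + 1) 0 = 1 := intChoose_zero _
  have h7 : intChoose (-2 + 1) 1 = -1 := by
    rw [show (-2 : ℤ) + 1 = -1 by norm_num, intChoose_neg_one]; norm_num
  rw [h6, h7]
  simp only [map_add, map_sub, map_smul, expL_shift]
  norm_num
  module

end General

theorem four_mul_weightOneTwo {t : ℂ} (ht : t ≠ 0) : 4 * t * weightOneTwo t = 3 - 2 * t := by
  rw [weightOneTwo]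
  field_simp
  ring

theorem mul_centralCharge {t : ℂ} (ht : t ≠ 0) :
    t * centralCharge t = 13 * t - 6 * t ^ 2 - 6 := by
  rw [centralCharge]
  field_simp

/-- The family `u ↦ Y u` with leading coefficient `v_{h₂}`, where `exp(z L₋₁)` applied to the lowest
weight series is the value at the two generators. -/
theorem exists_intertwining_series {t h₁ h₂ Δ : ℂ} (ht : t ≠ 0)
    (hΔ : h₂ = Δ + h₁ + weightOneTwo t) (h0 : indicial t h₁ Δ = 0)
    (hne : ∀ n : ℕ, 1 ≤ n → indicial t h₁ (Δ + n) ≠ 0) :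
    ∃ Y : Verma (centralCharge t) h₁ →ₗ[ℂ] KacOneTwo t →ₗ[ℂ]
        truncSeries (Verma (centralCharge t) h₂),
      (∀ n u, Y ⁅L n, u⁆ = homL n (Y u)) ∧
      (∀ u w, Y u ⁅L (-1), w⁆ = truncSeries.deriv (Y u w)) ∧
      (∀ n u w, Y u ⁅L n, w⁆ = iterSum Y n u w) ∧
      (Y (Verma.vec _ _) (KacOneTwo.vec t)).1 Δ = Verma.vec _ _ := by
  set v := Verma.vec (centralCharge t) h₂ with hv
  set f := seriesOfSeq Δ (lowestSeq t h₁ Δ v) with hf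
  have hlow := lie_lowestSeries (Verma.lie_C (h := h₂)) ht (four_mul_weightOneTwo ht)
    (mul_centralCharge ht) h0 hne (v := v) (by rw [hv, Verma.lie_L_zero_vec, hΔ])
    (fun n hn => Verma.lie_L_vec_of_pos hn)
  obtain ⟨g, hgv, hg⟩ := KacOneTwo.exists_lift (densityL h₁) (densityL_densityL Verma.lie_C h₁) f
    (by
      ext a
      rw [densityL_coe_apply, (hlow a).1, smul_coe_apply]
      simp only [Int.cast_zero, sub_zero, zpow_zero]
      module)
    (by
      ext a
      rw [densityL_coe_apply, (hlow a).2.1, zero_coe_apply]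
      simp only [Int.cast_one, zpow_one]
      module)
    (by
      ext a
      rw [densityL_coe_apply, (hlow a).2.2, zero_coe_apply]
      norm_num
      module)
    (by
      ext a
      have hrec := indicial_smul_lowestSeries h0 hne v (a + 2)
      rw [← hf, add_sub_cancel_right, show a + 2 - 1 = a + 1 by ring, indicial] at hrec
      rw [densityL_neg_one, densityL_neg_one, densityL_neg_two,
        ← smul_right_injective _ ht |>.eq_iff]
      simp only [smul_coe_apply, add_coe_apply, sub_coe_apply, map_apply, map_add, opL_apply,
        deriv_apply, shift_apply, lie_smul, smul_smul, mul_inv_cancel₀ ht, one_smul]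
      push_cast
      rw [sub_neg_eq_add, sub_neg_eq_add, show a + 1 + 1 = a + 2 by ring]
      rw [← sub_eq_zero] at hrec ⊢
      rw [← hrec]
      module)
  obtain ⟨Y, hYv, hY⟩ := Verma.exists_lift (c := centralCharge t) (h := h₁)
    (homL (V := Verma (centralCharge t) h₂) (W := KacOneTwo t))
    (homL_homL Verma.lie_C KacOneTwo.lie_C) (expL _ ∘ₗ g)
    (homL_zero_expL hg) (homL_one_expL hg) (homL_two_expL hg)
  have hder : ∀ u w, Y u ⁅L (-1), w⁆ = truncSeries.deriv (Y u w) := by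
    let S : Submodule ℂ (Verma (centralCharge t) h₁) :=
      { carrier := {u | ∀ w, Y u ⁅L (-1), w⁆ = truncSeries.deriv (Y u w)}
        zero_mem' := fun w => by simp
        add_mem' := fun {u u'} hu hu' w => by
          rw [map_add, LinearMap.add_apply, LinearMap.add_apply, map_add, hu w, hu' w]
        smul_mem' := fun b u hu w => by
          rw [map_smul, LinearMap.smul_apply, LinearMap.smul_apply, map_smul, hu w] }
    refine Verma.mem_of_vec_mem S (fun w => ?_) fun n u hu w => ?_
    · rw [hYv]
      exact expL_lie_L_neg_one hg w
    · rw [hY]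
      exact homL_lie_L_neg_one KacOneTwo.lie_C n hu w
  have hiter2 : ∀ u w, Y u ⁅L (-2), w⁆ = iterSum Y (-2) u w := by
    let S : Submodule ℂ (Verma (centralCharge t) h₁) :=
      { carrier := {u | ∀ w, Y u ⁅L (-2), w⁆ = iterSum Y (-2) u w}
        zero_mem' := fun w => by simp [iterSum]
        add_mem' := fun {u u'} hu hu' w => by
          rw [map_add, LinearMap.add_apply, hu w, hu' w]
          simp only [iterSum, map_add, LinearMap.add_apply, smul_add]
          abel
        smul_mem' := fun b u hu w => by
          rw [map_smul, LinearMap.smul_apply, hu w]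
          simp only [iterSum, map_smul, LinearMap.smul_apply, smul_add]
          rw [smul_comm] }
    refine Verma.mem_of_vec_mem S (fun w => ?_) fun n u hu w => ?_
    · exact expL_lie_L_neg_two hg hY hYv Verma.lie_L_zero_vec
        (fun n hn => Verma.lie_L_vec_of_pos hn) w
    · exact iterate_neg_two_lie hY Verma.lie_C Verma.lie_C KacOneTwo.lie_C hder u hu n w
  have hneg : ∀ (k : ℕ) u w, Y u ⁅L (-2 - k), w⁆ = iterSum Y (-2 - k) u w := by
    intro k
    induction k with
    | zero => simpa using hiter2
    | succ k ih =>
      intro u w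
      rw [Nat.cast_succ, ← sub_sub]
      exact iterate_pred KacOneTwo.lie_C hder (by omega) u (ih u) w
  refine ⟨Y, hY, hder, fun n u w => ?_, ?_⟩
  · rcases le_or_gt n (-2) with hn | hn
    · have := hneg (-2 - n).toNat u w
      rwa [Int.toNat_of_nonneg (by omega), sub_sub_cancel] at this
    · have := iterate_natCast hY (n + 1).toNat u w
      rwa [Int.toNat_of_nonneg (by omega), add_sub_cancel_right] at this
  · rw [hYv, LinearMap.comp_apply, hgv, expL, act_apply, finsum_eq_single _ 0]
    · rw [divPow_zero, Nat.cast_zero, sub_zero, Module.End.one_apply]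
      simpa [lowestSeq] using seriesOfSeq_add_natCast Δ (lowestSeq t h₁ Δ v) 0
    · intro i hi
      obtain ⟨j, rfl⟩ := Nat.exists_eq_succ_of_ne_zero hi
      rw [hf, seriesOfSeq_of_ne, map_zero]
      intro n
      push_cast
      exact sub_natCast_succ_ne Δ j n

open Virasoro truncSeries

/-! ### Weight spaces of Verma modules -/

namespace Verma

variable {c h : ℂ}

/-- The vectors obtained from `vec c h` by applying operators `L (-m)`, `m > 0`, together with
their conformal weights. -/
inductive IsDescendant (c h : ℂ) : ℂ → Verma c h → Prop
  | vec : IsDescendant c h h (vec c h)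
  | lie (m : ℕ) {b : ℂ} {v : Verma c h} : IsDescendant c h b v →
      IsDescendant c h (b + m + 1) ⁅L (-m - 1), v⁆

/-- The span of the descendants of `vec c h` of conformal weight `b`. -/
def weightSpace (c h b : ℂ) : Submodule ℂ (Verma c h) :=
  Submodule.span ℂ {v | IsDescendant c h b v}

theorem IsDescendant.exists_eq {b : ℂ} {v : Verma c h} (hv : IsDescendant c h b v) :
    ∃ n : ℕ, b = h + n ∧ (n = 0 → v = Verma.vec c h) := by
  induction hv with
  | vec => exact ⟨0, by simp, fun _ => rfl⟩
  | lie m _ ih =>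
    obtain ⟨n, rfl, -⟩ := ih
    exact ⟨n + m + 1, by push_cast; ring, fun h => absurd h (by omega)⟩

theorem lie_neg_mem_weightSpace (m : ℕ) {b : ℂ} {v : Verma c h} (hv : v ∈ weightSpace c h b) :
    ⁅L (-m - 1), v⁆ ∈ weightSpace c h (b + m + 1) := by
  induction hv using Submodule.span_induction with
  | mem v hv => exact Submodule.subset_span (hv.lie m)
  | zero => rw [lie_zero]; exact Submodule.zero_mem _
  | add v w _ _ hv hw => rw [lie_add]; exact Submodule.add_mem _ hv hw
  | smul a v _ hv => rw [lie_smul]; exact Submodule.smul_mem _ _ hv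

theorem lie_mem_weightSpace_of_isDescendant {b : ℂ} {v : Verma c h} (hv : IsDescendant c h b v)
    (m : ℤ) : ⁅L m, v⁆ ∈ weightSpace c h (b - m) := by
  induction hv generalizing m with
  | vec =>
    rcases lt_trichotomy m 0 with hm | rfl | hm
    · have h1 := (IsDescendant.vec (c := c) (h := h)).lie (-m - 1).toNat
      have h2 : ((-m - 1).toNat : ℤ) = -m - 1 := Int.toNat_of_nonneg (by omega)
      have h3 : ((-m - 1).toNat : ℂ) = -m - 1 := by exact_mod_cast congrArg (Int.cast : ℤ → ℂ) h2
      rw [h2, h3, show -(-m - 1) - 1 = m by ring, show h + (-(m : ℂ) - 1) + 1 = h - m by ring] at h1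
      exact Submodule.subset_span h1
    · rw [lie_L_zero_vec, Int.cast_zero, sub_zero]
      exact Submodule.smul_mem _ _ (Submodule.subset_span .vec)
    · rw [lie_L_vec_of_pos hm]
      exact Submodule.zero_mem _
  | @lie j b v hv ih =>
    rw [lie_L_lie_L lie_C]
    refine Submodule.add_mem _ (Submodule.add_mem _ ?_ (Submodule.smul_mem _ _ ?_)) ?_
    · have := lie_neg_mem_weightSpace j (ih m)
      rwa [show b - m + j + 1 = b + j + 1 - m by ring] at this
    · have := ih (m + (-j - 1))
      push_cast at this
      rwa [show b - ((m : ℂ) + (-j - 1)) = b + j + 1 - m by ring] at this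
    · split_ifs with hm
      · subst hm
        push_cast
        rw [show b + j + 1 - -(-(j : ℂ) - 1) = b by ring]
        exact Submodule.smul_mem _ _ (Submodule.smul_mem _ _ (Submodule.subset_span hv))
      · rw [zero_smul]
        exact Submodule.zero_mem _

theorem IsDescendant.lie_L_zero {b : ℂ} {v : Verma c h} (hv : IsDescendant c h b v) :
    ⁅L 0, v⁆ = b • v := by
  induction hv with
  | vec => exact lie_L_zero_vec
  | lie m _ ih =>
    rw [lie_L_lie_L lie_C, ih, if_neg (by omega), zero_add, lie_smul]
    push_cast
    module

theorem lie_L_zero_of_mem_weightSpace {b : ℂ} {v : Verma c h} (hv : v ∈ weightSpace c h b) :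
    ⁅L 0, v⁆ = b • v := by
  induction hv using Submodule.span_induction with
  | mem v hv => exact hv.lie_L_zero
  | zero => rw [lie_zero, smul_zero]
  | add v w _ _ hv hw => rw [lie_add, hv, hw, smul_add]
  | smul a v _ hv => rw [lie_smul, hv, smul_comm]

theorem iSup_weightSpace : ⨆ b, weightSpace c h b = ⊤ := by
  rw [eq_top_iff]
  intro w _
  refine mem_of_vec_mem _ ?_ (fun n w hw => ?_) w
  · exact Submodule.mem_iSup_of_mem h (Submodule.subset_span .vec)
  · induction hw using Submodule.iSup_induction' with
    | mem b v hv =>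
      induction hv using Submodule.span_induction with
      | mem v hv => exact Submodule.mem_iSup_of_mem _ (lie_mem_weightSpace_of_isDescendant hv n)
      | zero => rw [lie_zero]; exact Submodule.zero_mem _
      | add v w _ _ hv hw => rw [lie_add]; exact Submodule.add_mem _ hv hw
      | smul a v _ hv => rw [lie_smul]; exact Submodule.smul_mem _ _ hv
    | zero => rw [lie_zero]; exact Submodule.zero_mem _
    | add v w _ _ hv hw => rw [lie_add]; exact Submodule.add_mem _ hv hw

/-- The operator `L 0` is semisimple on a Verma module: its generalized eigenspaces are spanned by
descendants of the lowest weight vector. -/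
theorem maxGenEigenspace_opL_zero_le (b : ℂ) :
    (opL 0 : Module.End ℂ (Verma c h)).maxGenEigenspace b ≤ weightSpace c h b := by
  have hle : ∀ b, weightSpace c h b ≤ (opL 0 : Module.End ℂ (Verma c h)).maxGenEigenspace b := by
    intro b v hv
    rw [Module.End.mem_maxGenEigenspace]
    exact ⟨1, by simp [opL_apply, lie_L_zero_of_mem_weightSpace hv]⟩
  have hdis := (Module.End.independent_maxGenEigenspace
    (opL 0 : Module.End ℂ (Verma c h))) b
  have hsup : weightSpace c h b ⊔ ⨆ j, ⨆ (_ : j ≠ b), weightSpace c h j = ⊤ :=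
    (iSup_split_single _ b).symm.trans iSup_weightSpace
  intro x hx
  obtain ⟨y, hy, z, hz, hyz⟩ := Submodule.mem_sup.mp (hsup ▸ Submodule.mem_top : x ∈ _)
  have hz' : z ∈ (opL 0 : Module.End ℂ (Verma c h)).maxGenEigenspace b := by
    rw [eq_sub_of_add_eq' hyz]
    exact Submodule.sub_mem _ hx (hle b hy)
  have hz0 : z = 0 := Submodule.disjoint_def.mp hdis z hz' (iSup₂_mono (fun j _ => hle j) hz)
  rw [← hyz, hz0, add_zero]
  exact hy

theorem eq_zero_of_mem_weightSpace {b : ℂ} (hb : ∀ n : ℕ, b ≠ h + n) {v : Verma c h}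
    (hv : v ∈ weightSpace c h b) : v = 0 := by
  have h1 : {v | IsDescendant c h b v} = ∅ := by
    ext v
    refine ⟨fun hv => ?_, fun hv => hv.elim⟩
    obtain ⟨n, hn, -⟩ := IsDescendant.exists_eq hv
    exact hb n hn
  rw [weightSpace, h1, Submodule.span_empty] at hv
  exact (Submodule.mem_bot ℂ).mp hv

theorem exists_eq_smul_vec_of_mem_weightSpace {v : Verma c h} (hv : v ∈ weightSpace c h h) :
    ∃ a : ℂ, v = a • vec c h := by
  have h1 : weightSpace c h h ≤ Submodule.span ℂ {vec c h} := by
    refine Submodule.span_mono fun v hv => ?_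
    obtain ⟨n, hn, hn'⟩ := IsDescendant.exists_eq hv
    refine hn' ?_
    rw [left_eq_add] at hn
    exact_mod_cast hn
  obtain ⟨a, ha⟩ := Submodule.mem_span_singleton.mp (h1 hv)
  exact ⟨a, ha.symm⟩

end Verma

open Virasoro truncSeries

/-! ### Surjectivity and uniqueness -/

theorem finsum_eq_add_of_two_le {X : Type*} [AddCommMonoid X] (f : ℕ → X)
    (hf : ∀ i, 2 ≤ i → f i = 0) : ∑ᶠ i, f i = f 0 + f 1 := by
  rw [finsum_eq_sum_of_support_subset (s := Finset.range 2) _ fun i hi => ?_]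
  · simp [Finset.sum_range_succ]
  · by_contra hi'
    rw [Finset.mem_coe, Finset.mem_range, not_lt] at hi'
    exact hi (hf i hi')

namespace IsIntertwiningOperator

section General

variable {W₁ W₂ W₃ : Type*}
  [AddCommGroup W₁] [Module ℂ W₁] [LieRingModule Virasoro W₁]
  [AddCommGroup W₂] [Module ℂ W₂] [LieRingModule Virasoro W₂]
  [AddCommGroup W₃] [Module ℂ W₃] [LieRingModule Virasoro W₃]
  {𝒴 𝒴' : W₁ →ₗ[ℂ] LogSeries (W₂ →ₗ[ℂ] W₃)}

theorem smul [LieModule ℂ Virasoro W₃] (h𝒴 : IsIntertwiningOperator 𝒴) (b : ℂ) :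
    IsIntertwiningOperator (b • 𝒴) where
  lower_truncation w₁ w₂ h := by
    obtain ⟨N, hN⟩ := h𝒴.lower_truncation w₁ w₂ h
    refine ⟨N, fun n hn k => ?_⟩
    change b • 𝒴 w₁ k (-(h + n) - 1) w₂ = 0
    rw [show 𝒴 w₁ k (-(h + n) - 1) w₂ = 0 from hN n hn k, smul_zero]
  commutator_formula w₁ n w₂ k a := by
    change ⁅L n, b • 𝒴 w₁ k a w₂⁆ = b • 𝒴 w₁ k a ⁅L n, w₂⁆ + ∑ᶠ i : ℕ, _ • (b • (_ : W₃))
    rw [lie_smul, h𝒴.commutator_formula, smul_add, smul_finsum]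
    simp only [smul_comm b]
  iterate_formula w₁ n w₂ k a := by
    change b • 𝒴 ⁅L n, w₁⁆ k a w₂ = ∑ᶠ i : ℕ, _ • (⁅L (n - i), b • 𝒴 w₁ k (a - i) w₂⁆ + _ • (b • _))
    rw [h𝒴.iterate_formula, smul_finsum]
    refine finsum_congr fun i => ?_
    rw [lie_smul, smul_comm _ b, ← smul_add, smul_comm]
  derivative_property w₁ k a := by
    change b • 𝒴 ⁅L (-1), w₁⁆ k a = (a + 1) • (b • 𝒴 w₁ k (a + 1)) +
      ((k : ℂ) + 1) • (b • 𝒴 w₁ (k + 1) (a + 1))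
    rw [h𝒴.derivative_property, smul_add, smul_comm b, smul_comm b]

/-- The span of all coefficients of an intertwining operator is stable under `L n`. -/
theorem lie_mem_span (h𝒴 : IsIntertwiningOperator 𝒴) [LieModule ℂ Virasoro W₃] (n : ℤ) {w₃ : W₃}
    (hw₃ : w₃ ∈ Submodule.span ℂ {w₃ : W₃ | ∃ (w₁ : W₁) (w₂ : W₂) (h : ℂ) (k : ℕ),
      w₃ = intertwiningMode 𝒴 w₁ h k w₂}) :
    ⁅L n, w₃⁆ ∈ Submodule.span ℂ {w₃ : W₃ | ∃ (w₁ : W₁) (w₂ : W₂) (h : ℂ) (k : ℕ),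
      w₃ = intertwiningMode 𝒴 w₁ h k w₂} := by
  set S := Submodule.span ℂ {w₃ : W₃ | ∃ (w₁ : W₁) (w₂ : W₂) (h : ℂ) (k : ℕ),
      w₃ = intertwiningMode 𝒴 w₁ h k w₂} with hS
  have hmem : ∀ w₁ k a w₂, 𝒴 w₁ k a w₂ ∈ S := fun w₁ k a w₂ => Submodule.subset_span
    ⟨w₁, w₂, -a - 1, k, by rw [intertwiningMode, show -(-a - 1) - 1 = a by ring]⟩
  induction hw₃ using Submodule.span_induction with
  | mem w₃ hw₃ =>
    obtain ⟨w₁, w₂, h, k, rfl⟩ := hw₃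
    rw [intertwiningMode, h𝒴.commutator_formula]
    refine S.add_mem (hmem _ _ _ _) (finsum_induction (· ∈ S) S.zero_mem (fun _ _ => S.add_mem) ?_)
    exact fun i => S.smul_mem _ (hmem _ _ _ _)
  | zero => rw [lie_zero]; exact S.zero_mem
  | add v w _ _ hv hw => rw [lie_add]; exact S.add_mem hv hw
  | smul a v _ hv => rw [lie_smul]; exact S.smul_mem _ hv

variable {b : ℂ} {v : W₁}

/-- The commutator formula at a vector of lowest weight `b`. -/
theorem lie_apply_of_lie_eq_zero (h𝒴 : IsIntertwiningOperator 𝒴) (h0 : ⁅L 0, v⁆ = b • v)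
    (hpos : ∀ n : ℤ, 0 < n → ⁅L n, v⁆ = 0) (n : ℤ) (w₂ : W₂) (k : ℕ) (a : ℂ) :
    ⁅L n, 𝒴 v k a w₂⁆ = 𝒴 v k a ⁅L n, w₂⁆ + (a - n + (n + 1) * b) • 𝒴 v k (a - n) w₂ +
      ((k : ℂ) + 1) • 𝒴 v (k + 1) (a - n) w₂ := by
  rw [h𝒴.commutator_formula, finsum_eq_add_of_two_le]
  · simp only [Ring.choose_zero_right, Ring.choose_one_right, Nat.cast_zero, Nat.cast_one, zero_sub,
      sub_self, sub_zero, h0]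
    rw [h𝒴.derivative_property, map_smul, show a - ((n : ℂ) + 1) + 1 = a - n by ring,
      show a - ((n : ℂ) + 1 - 1) = a - n by ring]
    simp only [LinearMap.add_apply, LinearMap.smul_apply, Finsupp.smul_apply, Pi.smul_apply]
    push_cast
    module
  · intro i hi
    rw [hpos _ (by omega), map_zero]
    simp

end General

section KacOneTwo

variable {t h₁ h₂ Δ : ℂ} {𝒴 𝒴' : KacOneTwo t →ₗ[ℂ]
  LogSeries (Verma (centralCharge t) h₁ →ₗ[ℂ] Verma (centralCharge t) h₂)}

theorem lie_L_zero_apply_vec (h𝒴 : IsIntertwiningOperator 𝒴) (k : ℕ) (a : ℂ) :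
    ⁅L 0, 𝒴 (KacOneTwo.vec t) k a (Verma.vec _ h₁)⁆ =
      (a + h₁ + weightOneTwo t) • 𝒴 (KacOneTwo.vec t) k a (Verma.vec _ h₁) +
        ((k : ℂ) + 1) • 𝒴 (KacOneTwo.vec t) (k + 1) a (Verma.vec _ h₁) := by
  rw [h𝒴.lie_apply_of_lie_eq_zero KacOneTwo.lie_L_zero_vec
    (fun n hn => KacOneTwo.lie_L_vec_of_pos hn), Verma.lie_L_zero_vec, map_smul, Int.cast_zero,
    sub_zero]
  module

/-- The coefficients at the generating vectors are generalized eigenvectors of `L 0`: up to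
a scalar, `L 0 - b` maps the coefficient of `(log z) ^ k` to the one of `(log z) ^ (k + 1)`, and the
powers of `log z` are bounded. -/
theorem apply_vec_mem_weightSpace (h𝒴 : IsIntertwiningOperator 𝒴) (k : ℕ) (a : ℂ) :
    𝒴 (KacOneTwo.vec t) k a (Verma.vec _ h₁) ∈
      Verma.weightSpace (centralCharge t) h₂ (a + h₁ + weightOneTwo t) := by
  refine Verma.maxGenEigenspace_opL_zero_le _ ?_
  obtain ⟨M, hM⟩ := (𝒴 (KacOneTwo.vec t)).support.exists_nat_subset_range
  have key : ∀ j k : ℕ, M ≤ k + j → 𝒴 (KacOneTwo.vec t) k a (Verma.vec _ h₁) ∈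
      (opL 0 : Module.End ℂ (Verma (centralCharge t) h₂)).maxGenEigenspace
        (a + h₁ + weightOneTwo t) := by
    intro j
    induction j with
    | zero =>
      intro k hk
      have h1 : 𝒴 (KacOneTwo.vec t) k = 0 := by
        by_contra h2
        have := Finset.mem_range.mp (hM (Finsupp.mem_support_iff.mpr h2))
        omega
      rw [h1]
      exact Submodule.zero_mem _
    | succ j ih =>
      intro k hk
      obtain ⟨r, hr⟩ := (Module.End.mem_maxGenEigenspace _ _ _).mp (ih (k + 1) (by omega))
      refine (Module.End.mem_maxGenEigenspace _ _ _).mpr ⟨r + 1, ?_⟩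
      rw [pow_succ, Module.End.mul_apply, LinearMap.sub_apply, opL_apply, h𝒴.lie_L_zero_apply_vec,
        LinearMap.smul_apply, Module.End.one_apply, add_sub_cancel_left, map_smul, hr, smul_zero]
  exact key M k (by omega)

/-- There are no logarithms, since `L 0` is semisimple on a Verma module. -/
theorem apply_vec_succ (h𝒴 : IsIntertwiningOperator 𝒴) (k : ℕ) (a : ℂ) :
    𝒴 (KacOneTwo.vec t) (k + 1) a (Verma.vec _ h₁) = 0 := by
  have h1 := Verma.lie_L_zero_of_mem_weightSpace (h𝒴.apply_vec_mem_weightSpace k a)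
  rw [h𝒴.lie_L_zero_apply_vec, add_eq_left] at h1
  exact (smul_eq_zero.mp h1).resolve_left (by exact_mod_cast k.succ_ne_zero)

theorem apply_vec_eq_zero (h𝒴 : IsIntertwiningOperator 𝒴) (hΔ : h₂ = Δ + h₁ + weightOneTwo t)
    (k : ℕ) {a : ℂ} (ha : ∀ n : ℕ, a ≠ Δ + n) :
    𝒴 (KacOneTwo.vec t) k a (Verma.vec _ h₁) = 0 := by
  refine Verma.eq_zero_of_mem_weightSpace (fun n hn => ha n ?_) (h𝒴.apply_vec_mem_weightSpace k a)
  rw [hΔ] at hn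
  linear_combination hn

theorem exists_apply_vec_eq_smul_vec (h𝒴 : IsIntertwiningOperator 𝒴)
    (hΔ : h₂ = Δ + h₁ + weightOneTwo t) :
    ∃ b : ℂ, 𝒴 (KacOneTwo.vec t) 0 Δ (Verma.vec _ h₁) = b • Verma.vec _ h₂ := by
  have h1 := h𝒴.apply_vec_mem_weightSpace 0 Δ
  rw [← hΔ] at h1
  exact Verma.exists_eq_smul_vec_of_mem_weightSpace h1

/-- The relation `L₋₁² v = t⁻¹ L₋₂ v` in `K_{1,2}` gives a second order recursion. -/
theorem indicial_smul_apply_vec (h𝒴 : IsIntertwiningOperator 𝒴) (ht : t ≠ 0) (a : ℂ) :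
    indicial t h₁ (a + 2) • 𝒴 (KacOneTwo.vec t) 0 (a + 2) (Verma.vec _ h₁) =
      ∑ᶠ i : ℕ, ⁅L (-2 - i), 𝒴 (KacOneTwo.vec t) 0 (a - i) (Verma.vec _ h₁)⁆ +
        ⁅L (-1), 𝒴 (KacOneTwo.vec t) 0 (a + 1) (Verma.vec _ h₁)⁆ := by
  have hleft : 𝒴 ⁅L (-1), ⁅L (-1), KacOneTwo.vec t⁆⁆ 0 a (Verma.vec _ h₁) =
      ((a + 1) * (a + 2)) • 𝒴 (KacOneTwo.vec t) 0 (a + 2) (Verma.vec _ h₁) := by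
    rw [h𝒴.derivative_property, h𝒴.derivative_property, h𝒴.derivative_property]
    simp only [LinearMap.add_apply, LinearMap.smul_apply, h𝒴.apply_vec_succ, smul_zero, add_zero,
      smul_smul]
    rw [show a + 1 + 1 = a + 2 by ring]
  have hcomm := h𝒴.lie_apply_of_lie_eq_zero KacOneTwo.lie_L_zero_vec
    (fun n hn => KacOneTwo.lie_L_vec_of_pos hn) (-1) (Verma.vec _ h₁) 0 (a + 1)
  rw [h𝒴.apply_vec_succ, smul_zero, add_zero] at hcomm
  push_cast at hcomm
  rw [sub_neg_eq_add, show a + 1 + 1 = a + 2 by ring, neg_add_cancel, zero_mul, add_zero] at hcomm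
  have hfin : (Function.support fun i : ℕ =>
      ⁅L (-2 - i), 𝒴 (KacOneTwo.vec t) 0 (a - i) (Verma.vec _ h₁)⁆).Finite := by
    obtain ⟨N, hN⟩ := h𝒴.lower_truncation (KacOneTwo.vec t) (Verma.vec _ h₁) (-a - 1)
    refine (Finset.range N.toNat).finite_toSet.subset fun i hi => ?_
    by_contra hi'
    rw [Finset.mem_coe, Finset.mem_range, not_lt] at hi'
    refine hi ?_
    have h1 := hN i (by omega) 0
    rw [intertwiningMode, Int.cast_natCast, show -(-a - 1 + (i : ℂ)) - 1 = a - i by ring] at h1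
    simp only [h1, lie_zero]
  have hzero : ∀ i : ℕ, 2 ≤ i → 𝒴 (KacOneTwo.vec t) 0 (a + 1 + i)
      ⁅L ((i : ℤ) - 1), Verma.vec (centralCharge t) h₁⁆ = 0 := fun i hi => by
    rw [Verma.lie_L_vec_of_pos (by omega), map_zero]
  have hfin' : (Function.support fun i : ℕ => 𝒴 (KacOneTwo.vec t) 0 (a + 1 + i)
      ⁅L ((i : ℤ) - 1), Verma.vec (centralCharge t) h₁⁆).Finite := by
    refine (Finset.range 2).finite_toSet.subset fun i hi => ?_
    by_contra hi'
    rw [Finset.mem_coe, Finset.mem_range, not_lt] at hi'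
    exact hi (hzero i hi')
  have hright : 𝒴 ⁅L (-2), KacOneTwo.vec t⁆ 0 a (Verma.vec _ h₁) =
      ∑ᶠ i : ℕ, ⁅L (-2 - i), 𝒴 (KacOneTwo.vec t) 0 (a - i) (Verma.vec _ h₁)⁆ +
        (𝒴 (KacOneTwo.vec t) 0 (a + 1) ⁅L (-1), Verma.vec _ h₁⁆ +
          h₁ • 𝒴 (KacOneTwo.vec t) 0 (a + 2) (Verma.vec _ h₁)) := by
    have h2 : 𝒴 (KacOneTwo.vec t) 0 (a + 1) ⁅L (-1), Verma.vec _ h₁⁆ +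
          h₁ • 𝒴 (KacOneTwo.vec t) 0 (a + 2) (Verma.vec _ h₁) =
        ∑ᶠ i : ℕ, 𝒴 (KacOneTwo.vec t) 0 (a + 1 + i) ⁅L ((i : ℤ) - 1), Verma.vec _ h₁⁆ := by
      rw [finsum_eq_add_of_two_le _ hzero, Nat.cast_zero, Nat.cast_one, add_zero, Nat.cast_zero,
        zero_sub, Nat.cast_one, sub_self, Verma.lie_L_zero_vec, map_smul,
        show a + 1 + 1 = a + 2 by ring]
    rw [h2, ← finsum_add_distrib hfin hfin', h𝒴.iterate_formula]
    refine finsum_congr fun i => ?_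
    have h3 : (-1 : ℂ) ^ i * ((Ring.choose (-2 + 1 : ℤ) i : ℤ) : ℂ) = 1 := by
      have := intChoose_neg_one i
      rw [intChoose] at this
      rw [show (-2 + 1 : ℤ) = -1 by norm_num, this, ← mul_pow]
      norm_num
    rw [h3, one_smul]
    norm_num
    rw [show a - (-1 - (i : ℂ)) = a + 1 + i by ring]
  rw [KacOneTwo.lie_L_neg_one_lie_L_neg_one_vec, map_smul] at hleft
  have h4 : t • (t⁻¹ • 𝒴 ⁅L (-2), KacOneTwo.vec t⁆ 0 a (Verma.vec _ h₁)) =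
      t • (((a + 1) * (a + 2)) • 𝒴 (KacOneTwo.vec t) 0 (a + 2) (Verma.vec _ h₁)) := congrArg (t • ·) hleft
  rw [smul_inv_smul₀ ht, hright] at h4
  rw [hcomm, indicial]
  rw [← sub_eq_zero] at h4 ⊢
  rw [← neg_zero, ← h4]
  module

theorem apply_vec_congr (h𝒴 : IsIntertwiningOperator 𝒴) (h𝒴' : IsIntertwiningOperator 𝒴')
    (ht : t ≠ 0) (hΔ : h₂ = Δ + h₁ + weightOneTwo t)
    (hne : ∀ n : ℕ, 1 ≤ n → indicial t h₁ (Δ + n) ≠ 0)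
    (heq : 𝒴 (KacOneTwo.vec t) 0 Δ (Verma.vec _ h₁) = 𝒴' (KacOneTwo.vec t) 0 Δ (Verma.vec _ h₁))
    (k : ℕ) (a : ℂ) :
    𝒴 (KacOneTwo.vec t) k a (Verma.vec _ h₁) = 𝒴' (KacOneTwo.vec t) k a (Verma.vec _ h₁) := by
  cases k with
  | succ k => rw [h𝒴.apply_vec_succ, h𝒴'.apply_vec_succ]
  | zero =>
    by_cases ha : ∃ n : ℕ, a = Δ + n
    · obtain ⟨n, rfl⟩ := ha
      induction n using Nat.strong_induction_on with
      | _ n ih =>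
        rcases Nat.eq_zero_or_pos n with rfl | hn
        · simpa using heq
        · have hlt : ∀ j : ℕ, 1 ≤ j → 𝒴 (KacOneTwo.vec t) 0 (Δ + n - j) (Verma.vec _ h₁) =
              𝒴' (KacOneTwo.vec t) 0 (Δ + n - j) (Verma.vec _ h₁) := by
            intro j hj
            rcases le_or_gt j n with hjn | hjn
            · have := ih (n - j) (by omega)
              rwa [Nat.cast_sub hjn, ← add_sub_assoc] at this
            · have hout : ∀ m : ℕ, Δ + n - j ≠ Δ + m := by
                intro m hm
                have := sub_natCast_succ_ne Δ (j - n - 1) m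
                refine this (hm ▸ ?_)
                rw [Nat.cast_sub (by omega), Nat.cast_sub (by omega)]
                push_cast
                ring
              rw [h𝒴.apply_vec_eq_zero hΔ 0 hout, h𝒴'.apply_vec_eq_zero hΔ 0 hout]
          have h1 := h𝒴.indicial_smul_apply_vec ht (Δ + n - 2)
          have h2 := h𝒴'.indicial_smul_apply_vec ht (Δ + n - 2)
          rw [sub_add_cancel, show Δ + n - 2 + 1 = Δ + n - (1 : ℕ) by push_cast; ring] at h1 h2
          have h3 : ∀ i : ℕ, Δ + n - 2 - i = Δ + n - (i + 2 : ℕ) := fun i => by push_cast; ring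
          simp only [h3] at h1 h2
          refine smul_right_injective _ (hne n hn) ?_
          change indicial t h₁ (Δ + n) • _ = indicial t h₁ (Δ + n) • _
          rw [h1, h2, hlt 1 le_rfl]
          congr 1
          exact finsum_congr fun i => by rw [hlt (i + 2) (by omega)]
    · rw [h𝒴.apply_vec_eq_zero hΔ 0 (by simpa using ha),
        h𝒴'.apply_vec_eq_zero hΔ 0 (by simpa using ha)]

/-- An intertwining operator is determined by its leading coefficient: the commutator formula
extends the equality from `v_{h₁}` to all of `V_{h₁}`, and the iterate formula from `v_{1,2}` to
`K_{1,2}`. -/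
theorem eq_of_apply_vec_eq (h𝒴 : IsIntertwiningOperator 𝒴) (h𝒴' : IsIntertwiningOperator 𝒴')
    (ht : t ≠ 0) (hΔ : h₂ = Δ + h₁ + weightOneTwo t)
    (hne : ∀ n : ℕ, 1 ≤ n → indicial t h₁ (Δ + n) ≠ 0)
    (heq : 𝒴 (KacOneTwo.vec t) 0 Δ (Verma.vec _ h₁) =
      𝒴' (KacOneTwo.vec t) 0 Δ (Verma.vec _ h₁)) : 𝒴 = 𝒴' := by
  have hvec : ∀ u k a, 𝒴 (KacOneTwo.vec t) k a u = 𝒴' (KacOneTwo.vec t) k a u := by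
    let S : Submodule ℂ (Verma (centralCharge t) h₁) :=
      { carrier := {u | ∀ k a, 𝒴 (KacOneTwo.vec t) k a u = 𝒴' (KacOneTwo.vec t) k a u}
        zero_mem' := fun k a => by rw [map_zero, map_zero]
        add_mem' := fun {u u'} hu hu' k a => by rw [map_add, map_add, hu k a, hu' k a]
        smul_mem' := fun b u hu k a => by rw [map_smul, map_smul, hu k a] }
    refine Verma.mem_of_vec_mem S (h𝒴.apply_vec_congr h𝒴' ht hΔ hne heq) fun n u hu k a => ?_
    have h1 := h𝒴.lie_apply_of_lie_eq_zero KacOneTwo.lie_L_zero_vec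
      (fun n hn => KacOneTwo.lie_L_vec_of_pos hn) n u k a
    have h2 := h𝒴'.lie_apply_of_lie_eq_zero KacOneTwo.lie_L_zero_vec
      (fun n hn => KacOneTwo.lie_L_vec_of_pos hn) n u k a
    rw [hu k a, hu k (a - n), hu (k + 1) (a - n), h2] at h1
    exact (add_right_cancel (add_right_cancel h1)).symm
  have hall : ∀ w k a u, 𝒴 w k a u = 𝒴' w k a u := by
    let S : Submodule ℂ (KacOneTwo t) :=
      { carrier := {w | ∀ k a u, 𝒴 w k a u = 𝒴' w k a u}
        zero_mem' := fun k a u => by rw [map_zero, map_zero]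
        add_mem' := fun {w w'} hw hw' k a u => by
          rw [map_add, map_add]
          exact congrArg₂ (· + ·) (hw k a u) (hw' k a u)
        smul_mem' := fun b w hw k a u => by
          rw [map_smul, map_smul]
          exact congrArg (b • ·) (hw k a u) }
    refine KacOneTwo.mem_of_vec_mem S (fun k a u => hvec u k a) fun n w hw k a u => ?_
    rw [h𝒴.iterate_formula, h𝒴'.iterate_formula]
    exact finsum_congr fun i => by rw [hw, hw]
  ext1 w
  ext k a u
  exact hall w k a u

end KacOneTwo

end IsIntertwiningOperator

end

theorem theorem3p3 (t : ℂ) (ht : t ≠ 0) (h₁ h₂ s : ℂ)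
    (hs : s ^ 2 = 4 * t * h₁ + (t - 1) ^ 2)
    (hh : h₂ = h₁ + 1 / (4 * t) - 1 / (2 * t) * s)
    (hst : ∀ n : ℕ, 1 ≤ n → 1 / t * s ≠ (n : ℂ)) :
    ∃ 𝒴 : KacOneTwo t →ₗ[ℂ]
        LogSeries (Verma (centralCharge t) h₁ →ₗ[ℂ] Verma (centralCharge t) h₂),
      IsIntertwiningOperator 𝒴 ∧ IsSurjectiveIntertwining 𝒴 ∧
      ∀ 𝒴' : KacOneTwo t →ₗ[ℂ]
          LogSeries (Verma (centralCharge t) h₁ →ₗ[ℂ] Verma (centralCharge t) h₂),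
        IsIntertwiningOperator 𝒴' → IsSurjectiveIntertwining 𝒴' →
          ∃ a : ℂ, a ≠ 0 ∧ 𝒴' = a • 𝒴 := by
  -- `Δ` is the leading exponent, one of the two roots of the indicial polynomial.
  obtain ⟨Δ, hΔs⟩ : ∃ Δ : ℂ, 2 * t * Δ = t - 1 - s := ⟨(t - 1 - s) / (2 * t), by field_simp⟩
  have hs' : s = t - 1 - 2 * t * Δ := by linear_combination hΔs
  have h0 : indicial t h₁ Δ = 0 := by
    rw [hs'] at hs
    refine (mul_eq_zero.mp (?_ : 4 * t * _ = 0)).resolve_left (mul_ne_zero (by norm_num) ht)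
    rw [indicial]
    linear_combination hs
  have hne : ∀ n : ℕ, 1 ≤ n → indicial t h₁ (Δ + n) ≠ 0 := by
    intro n hn h
    have hn0 : (n : ℂ) ≠ 0 := by exact_mod_cast (by omega : n ≠ 0)
    have h1 : (n : ℂ) * (t * n - s) = 0 := by
      rw [indicial] at h h0
      rw [hs']
      linear_combination h - h0
    have h2 := (mul_eq_zero.mp h1).resolve_left hn0
    refine hst n hn ?_
    rw [← sub_eq_zero.mp h2]
    field_simp
  have hΔ : h₂ = Δ + h₁ + weightOneTwo t := by
    rw [hh, hs', weightOneTwo]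
    field_simp
    ring
  obtain ⟨Y, hY, hder, hiter, hvec⟩ := exists_intertwining_series ht hΔ h0 hne
  have h𝒴 := isIntertwiningOperator_intertwiningOfSeries hY hder hiter
  have hlead : intertwiningOfSeries Y (KacOneTwo.vec t) 0 Δ (Verma.vec _ h₁) = Verma.vec _ h₂ := by
    rw [intertwiningOfSeries_zero_apply, hvec]
  refine ⟨intertwiningOfSeries Y, h𝒴, ?_, fun 𝒴' h𝒴' hsurj => ?_⟩
  · rw [IsSurjectiveIntertwining, eq_top_iff]
    intro w _
    refine Verma.mem_of_vec_mem _ ?_ (fun n w hw => h𝒴.lie_mem_span n hw) w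
    refine Submodule.subset_span ⟨KacOneTwo.vec t, Verma.vec _ h₁, -Δ - 1, 0, ?_⟩
    rw [intertwiningMode, show -(-Δ - 1) - 1 = Δ by ring, hlead]
  · obtain ⟨a, ha⟩ := h𝒴'.exists_apply_vec_eq_smul_vec hΔ
    have heq : 𝒴' = a • intertwiningOfSeries Y :=
      h𝒴'.eq_of_apply_vec_eq (h𝒴.smul a) ht hΔ hne (ha.trans (congrArg (a • ·) hlead).symm)
    by_cases ha0 : a = 0
    · -- A surjective zero operator exists only if the target vanishes, and then all scalars agree.
      have h1 : (⊤ : Submodule ℂ (Verma (centralCharge t) h₂)) = ⊥ := by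
        rw [IsSurjectiveIntertwining] at hsurj
        rw [← hsurj, Submodule.span_eq_bot]
        rintro _ ⟨w₁, w₂, h, k, rfl⟩
        rw [heq, ha0, zero_smul]
        rfl
      refine ⟨1, one_ne_zero, ?_⟩
      ext w k b u
      have h2 : ∀ v : Verma (centralCharge t) h₂, v = 0 := fun v =>
        (Submodule.mem_bot ℂ).mp (h1 ▸ Submodule.mem_top)
      rw [h2 (𝒴' w k b u), h2 ((1 • intertwiningOfSeries Y) w k b u)]
    · exact ⟨a, ha0, heq⟩
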